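/- Notation. Let $\mathcal F u(\xi)=\int_{\mathbb R^3}e^{-i\xi\cdot x}u(x)\,dx$ be the Fourier transform on $\mathbb R^3$ and put $\lambda_q=2^q$. Fix any nonnegative radial function $\chi\in C_0^\infty(B(0,1))$ with $\chi(\xi)=1$ for $|\xi|\le 1/2$, let $\varphi(\xi)=\chi(\xi/2)-\chi(\xi)$, and define $$\Delta_{-1}u=\mathcal F^{-1}(\chi\,\mathcal F u),\qquad \Delta_q u=\mathcal F^{-1}\big(\varphi(\lambda_q^{-1}\cdot)\,\mathcal F u\big)\ (q\ge 0),\qquad S_Q=\sum_{q=-1}^{Q}\Delta_q .$$ Let $B^{1/3}_{3,c(\mathbb N)}$ be the class of tempered distributions $u$ on $\mathbb R^3$ with $\lim_{q\to\infty}\lambda_q^{1/3}\|\Delta_q u\|_{L^3}=0$, endowed with the norm of $B^{1/3}_{3,\infty}$, $$\|u\|=\|\Delta_{-1}u\|_{L^3}+\sup_{q\ge 0}\lambda_q^{1/3}\|\Delta_q u\|_{L^3}.$$ For a divergence-free (in the sense of distributions) vector field $u\in L^2(\mathbb R^3;\mathbb R^3)$, the Littlewood–Paley energy flux at wave number $\lambda_Q$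 is $$\Pi_Q=\int_{\mathbb R^3}\operatorname{Tr}\big[S_Q(u\otimes u)\cdot\nabla S_Qu\big]\,dx .$$ Let $T>0$, and let $C_w([0,T];L^2)$ be the space of weakly continuous functions from $[0,T]$ to $L^2=L^2(\mathbb R^3;\mathbb R^3)$. A weak solution of the Euler equations on $[0,T]$ is a function $u\in C_w([0,T];L^2)$ such that $\nabla\cdot u(t)=0$ in the sense of distributions for every $t\in[0,T]$ and such that, for every $\psi\in C^1([0,T];\mathcal S(\mathbb R^3)^3)$ with $\nabla_x\cdot\psi=0$ and every $t\in[0,T]$, $$(u(t),\psi(t))-(u(0),\psi(0))-\int_0^t(u(s),\partial_s\psi(s))\,ds=\int_0^t b(u,\psi,u)(s)\,ds,$$ where $(u,v)=\int_{\mathbb R^3}u\cdot v\,dx$ and $b(u,v,w)=\int_{\mathbb R^3}(u\cdot\nabla v)\cdot w\,dx$. Theorem. (1) For every divergence-free vector field $u\in B^{1/3}_{3,c(\mathbb N)}\cap L^2(\mathbb R^3;\mathbb R^3)$, the integral defining $\Pi_Q$ converges absolutely for every $Q\in\mathbb N$, and $\lim_{Q\to\infty}\Pi_Q=0$. (2)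 Every weak solution $u$ of the Euler equations on $[0,T]$ that belongs to $L^3([0,T];B^{1/3}_{3,c(\mathbb N)})\cap C_w([0,T];L^2)$ conserves energy: $\frac12\|u(t)\|_{L^2}^2=\frac12\|u(0)\|_{L^2}^2$ for every $t\in[0,T]$. -/

import Mathlib

open MeasureTheory Set Filter Topology
open scoped ENNReal ContDiff FourierTransform SchwartzMap Convolution

noncomputable section

namespace EulerFlux

/-- Physical space `ℝ³` with its Euclidean norm. -/
abbrev E3 : Type := EuclideanSpace ℝ (Fin 3)

/-- The `i`-th standard basis vector of `ℝ³`. -/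
def stdVec (i : Fin 3) : E3 := EuclideanSpace.single i 1

/-! ### Littlewood-Paley decomposition -/

/-- The dyadic wave numbers `λ_q = 2 ^ q`. -/
def waveNumber (q : ℕ) : ℝ := 2 ^ q

/-- Admissible cutoffs: nonnegative radial functions `χ ∈ C_c^∞(B(0,1))` with `χ(ξ) = 1` for
`|ξ| ≤ 1/2`. (A closed set contained in the unit ball is compact.) -/
structure IsCutoff (χ : E3 → ℝ) : Prop where
  smooth : ContDiff ℝ ∞ χ
  nonneg : ∀ ξ, 0 ≤ χ ξ
  radial : ∀ ξ η, ‖ξ‖ = ‖η‖ → χ ξ = χ η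
  support_subset : tsupport χ ⊆ Metric.ball 0 1
  eq_one : ∀ ξ, ‖ξ‖ ≤ 1 / 2 → χ ξ = 1

/-- The shell function `φ(ξ) = χ(ξ / 2) - χ(ξ)`. -/
def shell (χ : E3 → ℝ) (ξ : E3) : ℝ := χ ((2 : ℝ)⁻¹ • ξ) - χ ξ

/-- The inverse Fourier transform
`(F⁻¹ m)(x) = (2π)⁻³ ∫ m(ξ) exp(i x · ξ) dξ = ∫ m(2π η) exp(2π i x · η) dη`
of a real symbol `m`. The symbols used below are even, so this is a real number and taking the
real part only changes the type. -/
def symbolKernel (m : E3 → ℝ) (x : E3) : ℝ :=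
  (𝓕⁻ (fun η : E3 => ((m ((2 * Real.pi) • η) : ℝ) : ℂ)) x).re

section Blocks

variable {F : Type*} [NormedAddCommGroup F] [NormedSpace ℝ F]

/-- The Fourier multiplier `F⁻¹(m(ξ) F u)`, that is the convolution
`x ↦ ∫ (F⁻¹ m)(y) u(x - y) dy`. -/
def multiplier (m : E3 → ℝ) (u : E3 → F) : E3 → F :=
  symbolKernel m ⋆[ContinuousLinearMap.lsmul ℝ ℝ, volume] u

/-- The block `Δ_{-1}`, with symbol `χ(ξ)`. -/
def lowBlock (χ : E3 → ℝ) (u : E3 → F) : E3 → F := multiplier χ u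

/-- The block `Δ_q` for `q ≥ 0`, with symbol `φ(λ_q⁻¹ ξ)`. -/
def block (χ : E3 → ℝ) (q : ℕ) (u : E3 → F) : E3 → F :=
  multiplier (fun ξ => shell χ ((waveNumber q)⁻¹ • ξ)) u

/-- The partial sum `S_Q = ∑_{q = -1}^{Q} Δ_q`. -/
def partialSum (χ : E3 → ℝ) (Q : ℕ) (u : E3 → F) (x : E3) : F :=
  lowBlock χ u x + ∑ q ∈ Finset.range (Q + 1), block χ q u x

/-- The quantity `λ_q^{1/3} ‖Δ_q u‖_{L³}`. -/
def dyadicSize (χ : E3 → ℝ) (q : ℕ) (u : E3 → F) : ℝ≥0∞ :=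
  ENNReal.ofReal (waveNumber q) ^ (1 / 3 : ℝ) * eLpNorm (block χ q u) 3 volume

/-- The inhomogeneous Besov norm of `B^{1/3}_{3,∞}`, with value `∞` allowed. -/
def besovNorm (χ : E3 → ℝ) (u : E3 → F) : ℝ≥0∞ :=
  eLpNorm (lowBlock χ u) 3 volume + ⨆ q : ℕ, dyadicSize χ q u

/-- The condition `lim_{q → ∞} λ_q^{1/3} ‖Δ_q u‖_{L³} = 0` that defines `B^{1/3}_{3,c(ℕ)}`.
It is only used for `u ∈ L²(ℝ³)`, for which the convolutions above converge at every point and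
represent the Littlewood-Paley blocks of the tempered distribution `u`. -/
def MemBesovC (χ : E3 → ℝ) (u : E3 → F) : Prop :=
  Tendsto (fun q : ℕ => dyadicSize χ q u) atTop (𝓝 0)

end Blocks

/-! ### Divergence-free fields and the energy flux -/

/-- `∇ · u = 0` in the sense of distributions: `∫ u · ∇g = 0` for every `g ∈ C_c^∞(ℝ³)`. -/
def IsDivFree (u : E3 → E3) : Prop :=
  ∀ g : E3 → ℝ, ContDiff ℝ ∞ g → HasCompactSupport g → ∫ x, fderiv ℝ g x (u x) = 0

/-- The matrix `∇v(x)`, with entries `∂_i v_j(x)`. -/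
def gradMatrix (v : E3 → E3) (x : E3) : Matrix (Fin 3) (Fin 3) ℝ :=
  Matrix.of fun i j => (fderiv ℝ v x (stdVec i)) j

/-- The matrix `S_Q(u ⊗ u)(x)`, with entries `S_Q(u_i u_j)(x)`. -/
def partialSumTensor (χ : E3 → ℝ) (Q : ℕ) (u : E3 → E3) (x : E3) : Matrix (Fin 3) (Fin 3) ℝ :=
  Matrix.of fun i j => partialSum χ Q (fun y => u y i * u y j) x

/-- The density `Tr[S_Q(u ⊗ u) · ∇ S_Q u]` of the energy flux. -/
def fluxDensity (χ : E3 → ℝ) (Q : ℕ) (u : E3 → E3) (x : E3) : ℝ :=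
  (partialSumTensor χ Q u x * gradMatrix (partialSum χ Q u) x).trace

/-- The Littlewood-Paley energy flux `Π_Q = ∫ Tr[S_Q(u ⊗ u) · ∇ S_Q u] dx`. -/
def energyFlux (χ : E3 → ℝ) (Q : ℕ) (u : E3 → E3) : ℝ :=
  ∫ x, fluxDensity χ Q u x

/-! ### Weak solutions of the Euler equations -/

/-- The pairing `(u, v) = ∫ u · v dx`. -/
def pairing (u v : E3 → E3) : ℝ := ∫ x, inner ℝ (u x) (v x)

/-- The trilinear form `b(u, v, w) = ∫ (u · ∇v) · w dx`. -/
def trilinear (u v w : E3 → E3) : ℝ := ∫ x, inner ℝ (fderiv ℝ v x (u x)) (w x)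

/-- The kinetic energy `½ ∫ |u|² dx`. -/
def energy (u : E3 → E3) : ℝ := 1 / 2 * ∫ x, ‖u x‖ ^ 2

/-- `ψ ∈ C¹([0,T]; 𝓢(ℝ³)³)` with time derivative `ψ'` and `∇ · ψ(t) = 0` for all `t ∈ [0,T]`.
Derivative and continuity refer to the Fréchet topology of the Schwartz space, and are one-sided
at the end points. -/
structure IsTestField (T : ℝ) (ψ ψ' : ℝ → 𝓢(E3, E3)) : Prop where
  hasDeriv : ∀ t ∈ Icc 0 T, HasDerivWithinAt ψ (ψ' t) (Icc 0 T) t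
  continuous_deriv : ContinuousOn ψ' (Icc 0 T)
  divFree : ∀ t ∈ Icc 0 T, ∀ x, (gradMatrix (ψ t) x).trace = 0

/-- Weak solutions of the Euler equations on `[0,T]` (with initial data `u 0`): weakly continuous
curves in `L²(ℝ³)³`, divergence free at every time, that satisfy the weak formulation. -/
structure IsWeakSolution (T : ℝ) (u : ℝ → Lp E3 2 (volume : Measure E3)) : Prop where
  weaklyContinuous : ∀ v : Lp E3 2 (volume : Measure E3),
    ContinuousOn (fun t => inner ℝ (u t) v) (Icc 0 T)
  weakForm : ∀ ψ ψ' : ℝ → 𝓢(E3, E3), IsTestField T ψ ψ' → ∀ t ∈ Icc 0 T,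
    pairing (u t) (ψ t) - pairing (u 0) (ψ 0) - ∫ s in (0 : ℝ)..t, pairing (u s) (ψ' s) =
      ∫ s in (0 : ℝ)..t, trilinear (u s) (ψ s) (u s)
  divFree : ∀ t ∈ Icc 0 T, IsDivFree (u t)

/-- `u ∈ L³([0,T]; B^{1/3}_{3,c(ℕ)})`, where the space carries the norm of `B^{1/3}_{3,∞}`.
It is only used for weakly continuous curves in `L²`, for which measurability in time is
automatic. -/
def MemL3BesovC (χ : E3 → ℝ) (T : ℝ) (u : ℝ → Lp E3 2 (volume : Measure E3)) : Prop :=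
  (∀ᵐ t ∂(volume.restrict (Icc 0 T)), MemBesovC χ (u t)) ∧
    ∫⁻ t in Icc 0 T, besovNorm χ (u t) ^ 3 < ⊤

end EulerFlux

end

noncomputable section

namespace EulerFlux

open LineDeriv Laplacian

/-! ### Convolution of a kernel with a square integrable field -/

section Conv

variable {F : Type*} [NormedAddCommGroup F]

/-! Write `k_q(x) = 2^{3q} k(2^q x)` with `k = F⁻¹ χ`, an even Schwartz kernel of integral one. The
symbols of the blocks telescope, so `S_Q` is convolution with `k_{Q+1}`. Convolution with an even
kernel is symmetric, and the flux becomes `Π_Q = b(u, h ⋆ u, u)` with `h = k_{Q+1} ⋆ k_{Q+1}`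
(`IsCutoff.energyFlux_eq`).

The cancellation that makes this form small is the identity of Duchon and Robert: for even `h` and
divergence-free `u ∈ L² ∩ L³`, four times `b(u, h ⋆ u, u)` equals `∫∫ |δ|² ∇h(w)·δ dw dx` with `δ =
u(x-w) - u(x)` (`duchonRobert`). Hence the flux is at most `∫ |∇h(w)| ‖δ_w u‖₃³ dw`. Bernstein's
inequality on the blocks below `Q` and the triangle inequality on those above give `‖δ_w u‖₃ ≤ A (1
+ 2^Q |w|) 2^{-Q/3} D_Q`, where `D_Q` is `dyadicTail` (`IsCutoff.eLpNorm_increment_le`). The factor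
`2^Q` from `∇h` cancels the cube of `2^{-Q/3}`, so `|Π_Q| ≤ C D_Q³`
(`IsCutoff.exists_enorm_trilinear_le`). The geometric weights make `D_Q` tend to zero as soon as
`λ_q^{1/3} ‖Δ_q u‖₃` does, and bound it by a multiple of the Besov norm uniformly in `Q`. This
proves (1).

For (2), the equation is tested with `k ⋆ k ⋆ φ`, where `φ` is a divergence-free Schwartz field
independent of time. Such `φ` are dense among divergence-free `L²` fields (`schwartzSolenoidal_eq`,
through a Liouville theorem), so `φ` may be replaced by `u(a) ± u(b)`. The mollified curve is then
Lipschitz in time, and its energy minus the integrated flux has increments of size `O((b-a)²)`, so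
it is constant (`norm_sq_sub_eq_integral`). Letting the mollification scale vanish, the pointwise
flux limit and the dominating function `‖u(s)‖³` in the Besov norm remove the flux. -/

lemma memLp_comp_sub_left {p : ℝ≥0∞} {u : E3 → F} (hu : MemLp u p volume) (x : E3) :
    MemLp (fun t => u (x - t)) p volume :=
  hu.comp_measurePreserving (Measure.measurePreserving_sub_left volume x)

lemma memLp_comp_sub_right {p : ℝ≥0∞} {u : E3 → F} (hu : MemLp u p volume) (y : E3) :
    MemLp (fun t => u (t - y)) p volume :=
  hu.comp_measurePreserving (measurePreserving_sub_right volume y)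

lemma eLpNorm_comp_sub_left {p : ℝ≥0∞} {u : E3 → F} (hu : AEStronglyMeasurable u volume) (x : E3) :
    eLpNorm (fun t => u (x - t)) p volume = eLpNorm u p volume :=
  eLpNorm_comp_measurePreserving hu (Measure.measurePreserving_sub_left volume x)

lemma eLpNorm_comp_sub_right {p : ℝ≥0∞} {u : E3 → F} (hu : AEStronglyMeasurable u volume) (y : E3) :
    eLpNorm (fun t => u (t - y)) p volume = eLpNorm u p volume :=
  eLpNorm_comp_measurePreserving hu (measurePreserving_sub_right volume y)

lemma aestronglyMeasurable_uncurry_sub {u : E3 → F} (hu : AEStronglyMeasurable u volume) :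
    AEStronglyMeasurable (fun z : E3 × E3 => u (z.1 - z.2)) (volume.prod volume) :=
  hu.comp_quasiMeasurePreserving (quasiMeasurePreserving_sub volume volume)

variable [NormedSpace ℝ F]

/-- The convolution `x ↦ ∫ k(t) u(x - t) dt`. -/
def conv (k : E3 → ℝ) (u : E3 → F) (x : E3) : F := ∫ t, k t • u (x - t)

lemma multiplier_eq_conv (m : E3 → ℝ) (u : E3 → F) : multiplier m u = conv (symbolKernel m) u :=
  rfl

lemma integrable_conv {k : E3 → ℝ} {u : E3 → F} (hk : MemLp k 2 volume) (hu : MemLp u 2 volume)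
    (x : E3) : Integrable (fun t => k t • u (x - t)) volume :=
  memLp_one_iff_integrable.1 ((memLp_comp_sub_left hu x).smul hk)

lemma enorm_conv_le {k : E3 → ℝ} {u : E3 → F} (hk : MemLp k 2 volume) (hu : MemLp u 2 volume)
    (x : E3) : ‖conv k u x‖ₑ ≤ eLpNorm k 2 volume * eLpNorm u 2 volume := by
  calc ‖conv k u x‖ₑ ≤ ∫⁻ t, ‖k t • u (x - t)‖ₑ := enorm_integral_le_lintegral_enorm _
    _ = eLpNorm (k • fun t => u (x - t)) 1 volume := by rw [eLpNorm_one_eq_lintegral_enorm]; rfl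
    _ ≤ eLpNorm k 2 volume * eLpNorm (fun t => u (x - t)) 2 volume :=
        eLpNorm_smul_le_mul_eLpNorm (memLp_comp_sub_left hu x).1 hk.1
    _ = _ := by rw [eLpNorm_comp_sub_left hu.1]

lemma norm_conv_le {k : E3 → ℝ} {u : E3 → F} (hk : MemLp k 2 volume) (hu : MemLp u 2 volume)
    (x : E3) : ‖conv k u x‖ ≤ (eLpNorm k 2 volume).toReal * (eLpNorm u 2 volume).toReal := by
  rw [← ENNReal.toReal_mul, ← toReal_enorm]
  exact ENNReal.toReal_mono (ENNReal.mul_ne_top hk.2.ne hu.2.ne) (enorm_conv_le hk hu x)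

lemma conv_congr_ae (k : E3 → ℝ) {u v : E3 → F} (h : u =ᵐ[volume] v) : conv k u = conv k v := by
  ext x
  refine integral_congr_ae ?_
  filter_upwards [(Measure.measurePreserving_sub_left volume x).quasiMeasurePreserving.ae h]
    with t ht
  rw [ht]

lemma conv_swap (k : E3 → ℝ) (u : E3 → F) (x : E3) : conv k u x = ∫ t, k (x - t) • u t := by
  rw [conv, ← integral_sub_left_eq_self _ volume x]
  simp

lemma conv_sub_left {k₁ k₂ : E3 → ℝ} {u : E3 → F} (hk₁ : MemLp k₁ 2 volume)
    (hk₂ : MemLp k₂ 2 volume) (hu : MemLp u 2 volume) (x : E3) :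
    conv (fun y => k₁ y - k₂ y) u x = conv k₁ u x - conv k₂ u x := by
  simp only [conv, sub_smul]
  exact integral_sub (integrable_conv hk₁ hu x) (integrable_conv hk₂ hu x)

lemma conv_add_right {k : E3 → ℝ} {u v : E3 → F} (hk : MemLp k 2 volume)
    (hu : MemLp u 2 volume) (hv : MemLp v 2 volume) (x : E3) :
    conv k (fun y => u y + v y) x = conv k u x + conv k v x := by
  simp only [conv, smul_add]
  exact integral_add (integrable_conv hk hu x) (integrable_conv hk hv x)

lemma conv_smul_right (k : E3 → ℝ) (c : ℝ) (u : E3 → F) (x : E3) :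
    conv k (fun y => c • u y) x = c • conv k u x := by
  simp only [conv, smul_comm _ c]
  exact integral_smul c _

lemma conv_comp_clm {G : Type*} [NormedAddCommGroup G] [NormedSpace ℝ G] [CompleteSpace F]
    [CompleteSpace G] (L : F →L[ℝ] G) {k : E3 → ℝ} {u : E3 → F} (hk : MemLp k 2 volume)
    (hu : MemLp u 2 volume) (x : E3) : conv k (fun y => L (u y)) x = L (conv k u x) := by
  rw [conv, conv, ← L.integral_comp_comm (integrable_conv hk hu x)]
  simp

/-! ### Differentiation -/

lemma exists_decay_bound {G : Type*} [NormedAddCommGroup G] [NormedSpace ℝ G] (f : 𝓢(E3, G))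
    (n : ℕ) : ∃ C, 0 ≤ C ∧ ∀ x, ‖f x‖ ≤ C * (1 + ‖x‖) ^ (-(n : ℝ)) := by
  refine ⟨2 ^ n * ((Finset.Iic (n, 0)).sup fun m => SchwartzMap.seminorm ℝ m.1 m.2) f,
    by positivity, fun x => ?_⟩
  have h := SchwartzMap.one_add_le_sup_seminorm_apply (𝕜 := ℝ) (m := (n, 0)) (k := n) (n := 0)
    le_rfl le_rfl f x
  rw [norm_iteratedFDeriv_zero] at h
  rw [Real.rpow_neg (by positivity), Real.rpow_natCast, ← div_eq_mul_inv, le_div_iff₀ (by positivity)]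
  linarith

lemma memLp_one_add_norm : MemLp (fun x : E3 => (1 + ‖x‖) ^ (-(4 : ℝ))) 2 volume := by
  have hm : Continuous fun x : E3 => (1 + ‖x‖) ^ (-(4 : ℝ)) :=
    (by fun_prop : Continuous fun x : E3 => 1 + ‖x‖).rpow_const
      fun x => Or.inl (by positivity)
  rw [memLp_two_iff_integrable_sq_norm hm.aestronglyMeasurable]
  have h : Integrable (fun x : E3 => (1 + ‖x‖) ^ (-(8 : ℝ))) volume :=
    integrable_one_add_norm (by simp; norm_num)
  refine h.congr (.of_forall fun x => ?_)
  have : 0 < 1 + ‖x‖ := by positivity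
  beta_reduce
  rw [Real.norm_of_nonneg (by positivity), ← Real.rpow_natCast, ← Real.rpow_mul this.le]
  norm_num

/-- Differentiation under the integral, dominated by a multiple of `(1 + |x-t|)^{-4} |u(t)|`; this
is integrable because `(1 + |·|)^{-4}` lies in `L²(ℝ³)`. The integrability clause lets the
derivative be evaluated on vectors afterwards. -/
lemma hasFDerivAt_conv [CompleteSpace F] (k : 𝓢(E3, ℝ)) {u : E3 → F} (hu : MemLp u 2 volume)
    (x : E3) :
    Integrable (fun t => (fderiv ℝ k (x - t)).smulRight (u t)) volume ∧
    HasFDerivAt (conv k u) (∫ t, (fderiv ℝ k (x - t)).smulRight (u t)) x := by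
  obtain ⟨C, hC0, hC⟩ := exists_decay_bound (SchwartzMap.fderivCLM ℝ E3 ℝ k) 4
  simp only [SchwartzMap.fderivCLM_apply, Nat.cast_ofNat] at hC
  have hbint : Integrable (fun t => (C * 16 * (1 + ‖x - t‖) ^ (-(4 : ℝ))) * ‖u t‖) volume := by
    have := (memLp_comp_sub_left memLp_one_add_norm x).integrable_mul hu.norm
    refine (this.const_mul (C * 16)).congr (.of_forall fun t => ?_)
    simp [mul_assoc]
  have hmeas : ∀ y : E3,
      AEStronglyMeasurable (fun t => (fderiv ℝ k (y - t)).smulRight (u t)) volume := by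
    intro y
    have h1 : Continuous fun t : E3 => fderiv ℝ k (y - t) :=
      ((k.smooth 1).continuous_fderiv (by norm_num)).comp (by fun_prop)
    exact (ContinuousLinearMap.smulRightL ℝ E3 F).aestronglyMeasurable_comp₂
      h1.aestronglyMeasurable hu.1
  have hbound : ∀ t, ∀ y ∈ Metric.ball x 1, ‖(fderiv ℝ k (y - t)).smulRight (u t)‖ ≤
      (C * 16 * (1 + ‖x - t‖) ^ (-(4 : ℝ))) * ‖u t‖ := by
    intro t y hy
    rw [ContinuousLinearMap.norm_smulRight_apply]
    refine mul_le_mul_of_nonneg_right ((hC _).trans ?_) (norm_nonneg _)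
    rw [mul_assoc]
    refine mul_le_mul_of_nonneg_left ?_ hC0
    -- Moving the centre from `y` to `x` costs a factor 2, which raised to the fourth power is the
    -- 16 in the majorant.
    have h2 : 1 + ‖x - t‖ ≤ 2 * (1 + ‖y - t‖) := by
      have : ‖x - t‖ ≤ ‖x - y‖ + ‖y - t‖ := by
        simpa using norm_add_le (x - y) (y - t)
      have h3 : ‖x - y‖ < 1 := by rw [norm_sub_rev, ← dist_eq_norm]; exact hy
      linarith [norm_nonneg (y - t)]
    rw [Real.rpow_neg (by positivity), Real.rpow_neg (by positivity), ← div_eq_mul_inv,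
      inv_eq_one_div, div_le_div_iff₀ (by positivity) (by positivity)]
    calc 1 * (1 + ‖x - t‖) ^ (4 : ℝ) ≤ (2 * (1 + ‖y - t‖)) ^ (4 : ℝ) := by
          rw [one_mul]; exact Real.rpow_le_rpow (by positivity) h2 (by norm_num)
      _ = _ := by rw [Real.mul_rpow (by positivity) (by positivity)]; norm_num
  refine ⟨hbint.mono' (hmeas x) (.of_forall fun t => hbound t x (Metric.mem_ball_self one_pos)), ?_⟩
  have heq : conv k u = fun y => ∫ t, k (y - t) • u t := funext (conv_swap k u)
  rw [heq]
  refine hasFDerivAt_integral_of_dominated_of_fderiv_le (Metric.ball_mem_nhds x one_pos)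
    (.of_forall fun y => ?_) ?_ (hmeas x) (.of_forall hbound) hbint
    (.of_forall fun t y _ => ?_)
  · have h1 : Continuous fun t : E3 => k (y - t) := k.continuous.comp (by fun_prop)
    exact h1.aestronglyMeasurable.smul hu.1
  · exact memLp_one_iff_integrable.1 (hu.smul (memLp_comp_sub_left (k.memLp 2) x))
  · have h1 : HasFDerivAt (fun y : E3 => k (y - t)) (fderiv ℝ k (y - t)) y :=
      hasFDerivAt_comp_sub t |>.2 (k.hasFDerivAt (y - t))
    exact h1.smul_const (u t)

lemma differentiable_conv [CompleteSpace F] (k : 𝓢(E3, ℝ)) {u : E3 → F} (hu : MemLp u 2 volume) :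
    Differentiable ℝ (conv k u) :=
  fun x => (hasFDerivAt_conv k hu x).2.differentiableAt

lemma fderiv_conv_apply [CompleteSpace F] (k : 𝓢(E3, ℝ)) {u : E3 → F} (hu : MemLp u 2 volume)
    (x v : E3) : fderiv ℝ (conv k u) x v = conv (∂_{v} k : 𝓢(E3, ℝ)) u x := by
  rw [(hasFDerivAt_conv k hu x).2.fderiv,
    ContinuousLinearMap.integral_apply (hasFDerivAt_conv k hu x).1, conv_swap]
  simp [SchwartzMap.lineDerivOp_apply_eq_fderiv]

/-! ### Young's inequality -/

lemma eLpNorm_natCast_pow {α G : Type*} [MeasurableSpace α] [NormedAddCommGroup G] {μ : Measure α}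
    (f : α → G) {n : ℕ} (hn : n ≠ 0) : eLpNorm f n μ ^ n = ∫⁻ x, ‖f x‖ₑ ^ n ∂μ := by
  have h := eLpNorm_nnreal_pow_eq_lintegral (f := f) (μ := μ) (p := (n : NNReal)) (by simpa using hn)
  simpa [ENNReal.rpow_natCast] using h

/-- Hölder applied to `a b = a^{n/(n+1)} (a b^{n+1})^{1/(n+1)}`, that is, Jensen for the
unnormalised measure `a dμ`. Natural exponents suffice: only `L¹`, `L²` and `L³` occur later. -/
lemma lintegral_mul_pow_le {α : Type*} [MeasurableSpace α] {μ : Measure α} {a b : α → ℝ≥0∞}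
    (ha : AEMeasurable a μ) (hb : AEMeasurable b μ) (n : ℕ) :
    (∫⁻ y, a y * b y ∂μ) ^ (n + 1) ≤ (∫⁻ y, a y ∂μ) ^ n * ∫⁻ y, a y * b y ^ (n + 1) ∂μ := by
  set p : ℝ := n / (n + 1)
  set q : ℝ := 1 / (n + 1)
  have hp : 0 ≤ p := by positivity
  have hq : 0 ≤ q := by positivity
  have hpq : p + q = 1 := by simp only [p, q]; field_simp
  have h := ENNReal.lintegral_mul_norm_pow_le (μ := μ) ha (ha.mul (hb.pow_const (n + 1))) hp hq hpq
  have e1 : ∀ y, a y ^ p * (a * fun y => b y ^ (n + 1)) y ^ q = a y * b y := by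
    intro y
    simp only [Pi.mul_apply]
    rw [ENNReal.mul_rpow_of_nonneg _ _ hq, ← mul_assoc, ← ENNReal.rpow_add_of_nonneg _ _ hp hq,
      hpq, ENNReal.rpow_one, ← ENNReal.rpow_natCast, ← ENNReal.rpow_mul]
    have : ((n + 1 : ℕ) : ℝ) * q = 1 := by simp only [q]; push_cast; field_simp
    rw [this, ENNReal.rpow_one]
  simp only [e1] at h
  refine (pow_le_pow_left' h (n + 1)).trans (le_of_eq ?_)
  rw [mul_pow, ← ENNReal.rpow_natCast, ← ENNReal.rpow_mul, ← ENNReal.rpow_natCast,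
    ← ENNReal.rpow_mul]
  have e2 : p * ((n + 1 : ℕ) : ℝ) = n := by simp only [p]; push_cast; field_simp
  have e3 : q * ((n + 1 : ℕ) : ℝ) = 1 := by simp only [q]; push_cast; field_simp
  rw [e2, e3, ENNReal.rpow_natCast, ENNReal.rpow_one]
  rfl

/-- Jensen's inequality for a superposition `∫ k(y) g(·, y) dy`. -/
lemma eLpNorm_integral_smul_pow_le {k : E3 → ℝ} {g : E3 → E3 → F}
    (hk : AEStronglyMeasurable k volume)
    (hg : AEStronglyMeasurable (Function.uncurry g) (volume.prod volume)) (n : ℕ) :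
    eLpNorm (fun x => ∫ y, k y • g x y) (n + 1 : ℕ) volume ^ (n + 1) ≤
      (∫⁻ y, ‖k y‖ₑ) ^ n *
        ∫⁻ y, ‖k y‖ₑ * eLpNorm (fun x => g x y) (n + 1 : ℕ) volume ^ (n + 1) := by
  rw [eLpNorm_natCast_pow _ n.succ_ne_zero]
  have hpt : ∀ᵐ x : E3, ‖∫ y, k y • g x y‖ₑ ^ (n + 1) ≤
      (∫⁻ y, ‖k y‖ₑ) ^ n * ∫⁻ y, ‖k y‖ₑ * ‖g x y‖ₑ ^ (n + 1) := by
    filter_upwards [hg.prodMk_left] with x hx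
    refine (pow_le_pow_left' ((enorm_integral_le_lintegral_enorm _).trans (le_of_eq ?_)) _).trans
      (lintegral_mul_pow_le hk.enorm hx.enorm n)
    simp [enorm_smul, Function.uncurry]
  have hmeas : AEMeasurable (Function.uncurry fun x y => ‖k y‖ₑ * ‖g x y‖ₑ ^ (n + 1))
      (volume.prod volume) :=
    hk.comp_snd.enorm.mul (hg.enorm.pow_const _)
  refine (lintegral_mono_ae hpt).trans ?_
  have hin : AEMeasurable (fun x => ∫⁻ y, ‖k y‖ₑ * ‖g x y‖ₑ ^ (n + 1)) volume :=
    hmeas.lintegral_prod_right'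
  rw [lintegral_const_mul'' _ hin, lintegral_lintegral_swap hmeas]
  refine mul_le_mul' le_rfl (lintegral_mono_ae ?_)
  filter_upwards [hg.prod_swap.prodMk_left] with y hy
  rw [eLpNorm_natCast_pow _ n.succ_ne_zero]
  exact (lintegral_const_mul'' _ (hy.enorm.pow_const _)).le

lemma aestronglyMeasurable_conv {k : E3 → ℝ} {u : E3 → F} (hk : AEStronglyMeasurable k volume)
    (hu : AEStronglyMeasurable u volume) : AEStronglyMeasurable (conv k u) volume :=
  (hk.comp_snd.smul (aestronglyMeasurable_uncurry_sub hu)).integral_prod_right'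

/-- Young's inequality. -/
lemma eLpNorm_conv_le {k : E3 → ℝ} {u : E3 → F} (hk : AEStronglyMeasurable k volume)
    (hu : AEStronglyMeasurable u volume) (n : ℕ) :
    eLpNorm (conv k u) (n + 1 : ℕ) volume ≤ (∫⁻ y, ‖k y‖ₑ) * eLpNorm u (n + 1 : ℕ) volume := by
  have h := eLpNorm_integral_smul_pow_le hk (g := fun x y => u (x - y))
    (aestronglyMeasurable_uncurry_sub hu) n
  simp only [eLpNorm_comp_sub_right hu] at h
  rw [lintegral_mul_const'' _ hk.enorm, ← mul_assoc, ← pow_succ, ← mul_pow] at h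
  exact (ENNReal.pow_le_pow_left_iff n.succ_ne_zero).1 h

lemma memLp_conv {k : E3 → ℝ} {u : E3 → F} (hk : Integrable k volume) (n : ℕ)
    (hu : MemLp u (n + 1 : ℕ) volume) : MemLp (conv k u) (n + 1 : ℕ) volume :=
  ⟨aestronglyMeasurable_conv hk.1 hu.1,
    (eLpNorm_conv_le hk.1 hu.1 n).trans_lt (ENNReal.mul_lt_top hk.2 hu.2)⟩

lemma memLp_two_conv {k : E3 → ℝ} {u : E3 → F} (hk : Integrable k volume)
    (hu : MemLp u 2 volume) : MemLp (conv k u) 2 volume :=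
  memLp_conv hk 1 hu

/-! ### Associativity -/

/-- Square integrability of the kernels makes every convolution converge at every point; their
integrability keeps the convolutions in `L²`. Associativity therefore holds everywhere and not only
almost everywhere. -/
lemma conv_assoc [CompleteSpace F] {k₁ k₂ : E3 → ℝ} {u : E3 → F} (h₁ : Integrable k₁ volume)
    (h₁' : MemLp k₁ 2 volume) (h₂ : Integrable k₂ volume) (h₂' : MemLp k₂ 2 volume)
    (hu : MemLp u 2 volume) (x : E3) : conv (conv k₁ k₂) u x = conv k₁ (conv k₂ u) x := by
  refine convolution_assoc (μ := volume) (ν := volume) (ContinuousLinearMap.lsmul ℝ ℝ)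
    (ContinuousLinearMap.lsmul ℝ ℝ) (ContinuousLinearMap.lsmul ℝ ℝ)
    (ContinuousLinearMap.lsmul ℝ ℝ) (fun a b c => ?_) h₁.1 h₂.1 hu.1
    (.of_forall fun y => ?_) (.of_forall fun y => ?_) ?_
  · simp [mul_smul, smul_comm a b c]
  · exact integrable_conv h₁' h₂' y
  · exact integrable_conv h₂'.norm hu.norm y
  · exact integrable_conv h₁'.norm (memLp_two_conv h₂.norm hu.norm) x

lemma conv_comm (k₁ k₂ : E3 → ℝ) : conv k₁ k₂ = conv k₂ k₁ := by
  ext x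
  rw [conv_swap, conv]
  simp only [smul_eq_mul, mul_comm]

lemma conv_left_comm [CompleteSpace F] {k₁ k₂ : E3 → ℝ} {u : E3 → F} (h₁ : Integrable k₁ volume)
    (h₁' : MemLp k₁ 2 volume) (h₂ : Integrable k₂ volume) (h₂' : MemLp k₂ 2 volume)
    (hu : MemLp u 2 volume) (x : E3) : conv k₁ (conv k₂ u) x = conv k₂ (conv k₁ u) x := by
  rw [← conv_assoc h₁ h₁' h₂ h₂' hu, conv_comm, conv_assoc h₂ h₂' h₁ h₁' hu]

/-! ### Translation of the kernel -/

/-- The fundamental theorem of calculus along the segment from `x` to `x - y`, then Tonelli and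
translation invariance. -/
lemma lintegral_enorm_sub_translate_le (k : 𝓢(E3, ℝ)) (y : E3) :
    ∫⁻ x, ‖k (x - y) - k x‖ₑ ≤ ‖y‖ₑ * ∫⁻ x, ‖fderiv ℝ k x‖ₑ := by
  have hc : Continuous fun x => fderiv ℝ k x := (k.smooth 1).continuous_fderiv (by norm_num)
  have hpt : ∀ x, ‖k (x - y) - k x‖ₑ ≤
      ∫⁻ s in Icc (0 : ℝ) 1, ‖y‖ₑ * ‖fderiv ℝ k (x - s • y)‖ₑ := by
    intro x
    have hd : ∀ s : ℝ, HasDerivAt (fun s : ℝ => k (x - s • y)) (-(fderiv ℝ k (x - s • y) y)) s := by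
      intro s
      have h1 : HasDerivAt (fun s : ℝ => x - s • y) (-y) s := by
        simpa using ((hasDerivAt_id s).smul_const y).const_sub x
      have h2 := (k.hasFDerivAt (x - s • y)).comp_hasDerivAt s h1
      rw [map_neg] at h2
      exact h2
    have hcd : Continuous fun s : ℝ => -(fderiv ℝ k (x - s • y) y) := by
      exact ((hc.comp (by fun_prop : Continuous fun s : ℝ => x - s • y)).clm_apply
        continuous_const).neg
    have h := intervalIntegral.integral_eq_sub_of_hasDerivAt (a := 0) (b := 1)
      (fun s _ => hd s) (hcd.intervalIntegrable 0 1)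
    simp only [one_smul, zero_smul, sub_zero] at h
    rw [← h, intervalIntegral.integral_of_le zero_le_one]
    refine (enorm_integral_le_lintegral_enorm _).trans
      ((lintegral_mono fun s => ?_).trans (lintegral_mono_set Ioc_subset_Icc_self))
    rw [enorm_neg, mul_comm]
    exact ContinuousLinearMap.le_opENorm _ _
  refine (lintegral_mono hpt).trans ?_
  have hm : Measurable (Function.uncurry fun (x : E3) (s : ℝ) =>
      ‖y‖ₑ * ‖fderiv ℝ k (x - s • y)‖ₑ) := by
    refine Measurable.const_mul ?_ _
    exact (hc.comp (by fun_prop : Continuous fun z : E3 × ℝ => z.1 - z.2 • y)).enorm.measurable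
  rw [lintegral_lintegral_swap hm.aemeasurable]
  have : ∀ s : ℝ, ∫⁻ x, ‖y‖ₑ * ‖fderiv ℝ k (x - s • y)‖ₑ = ‖y‖ₑ * ∫⁻ x, ‖fderiv ℝ k x‖ₑ := by
    intro s
    have hms : Measurable fun x : E3 => ‖fderiv ℝ k (x - s • y)‖ₑ :=
      (hc.comp (by fun_prop : Continuous fun x : E3 => x - s • y)).enorm.measurable
    rw [lintegral_const_mul _ hms,
      lintegral_sub_right_eq_self (fun x => ‖fderiv ℝ k x‖ₑ)]
  simp [this]

end Conv

/-! ### Dilations of Schwartz functions -/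

lemma lintegral_comp_smul_pos (f : E3 → ℝ≥0∞) {r : ℝ} (hr : 0 < r) :
    ∫⁻ x, f (r • x) = ENNReal.ofReal ((r ^ 3)⁻¹) * ∫⁻ x, f x := by
  have h := (measurableEmbedding_const_smul₀ (α := E3) hr.ne').lintegral_map (μ := volume) f
  rw [← h, Measure.map_addHaar_smul _ hr.ne', lintegral_smul_measure, finrank_euclideanSpace_fin,
    abs_of_pos (by positivity)]
  rfl

/-- The `L¹`-normalised dilation `x ↦ 2^{3q} f(2^q x)`. -/
def dil (q : ℕ) (f : 𝓢(E3, ℝ)) : 𝓢(E3, ℝ) :=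
  ((2 : ℝ) ^ q) ^ 3 • SchwartzMap.compCLMOfContinuousLinearEquiv ℝ
    (ContinuousLinearEquiv.smulLeft (Units.mk0 ((2 : ℝ) ^ q) (by positivity)) : E3 ≃L[ℝ] E3) f

lemma dil_apply (q : ℕ) (f : 𝓢(E3, ℝ)) (x : E3) :
    dil q f x = ((2 : ℝ) ^ q) ^ 3 * f ((2 : ℝ) ^ q • x) := rfl

lemma fderiv_dil (q : ℕ) (f : 𝓢(E3, ℝ)) (x : E3) :
    fderiv ℝ (dil q f) x = ((2 : ℝ) ^ q) ^ 4 • fderiv ℝ f ((2 : ℝ) ^ q • x) := by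
  have h : (dil q f : E3 → ℝ) = fun x => ((2 : ℝ) ^ q) ^ 3 • f ((2 : ℝ) ^ q • x) := rfl
  have hd : DifferentiableAt ℝ (fun x => f ((2 : ℝ) ^ q • x)) x :=
    f.differentiableAt.comp x
      (by fun_prop : DifferentiableAt ℝ (fun x : E3 => (2 : ℝ) ^ q • x) x)
  rw [h, fderiv_fun_const_smul hd, fderiv_comp_smul, smul_smul, pow_succ _ 3]

lemma lintegral_enorm_dil (q : ℕ) (f : 𝓢(E3, ℝ)) : ∫⁻ x, ‖dil q f x‖ₑ = ∫⁻ x, ‖f x‖ₑ := by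
  have hp : (0 : ℝ) < 2 ^ q := by positivity
  simp only [dil_apply, enorm_mul]
  rw [lintegral_const_mul' _ _ enorm_ne_top,
    lintegral_comp_smul_pos (fun x => ‖f x‖ₑ) hp, ← mul_assoc,
    Real.enorm_eq_ofReal (by positivity), ← ENNReal.ofReal_mul (by positivity),
    mul_inv_cancel₀ (by positivity), ENNReal.ofReal_one, one_mul]

/-- The dilation preserves `L¹` norms, so the derivative contributes exactly one factor `2^q`. The
weight `G` will be `(1 + |·|)³`, evaluated in the rescaled variable. -/
lemma lintegral_enorm_fderiv_dil_mul (q : ℕ) (f : 𝓢(E3, ℝ)) (G : E3 → ℝ≥0∞) :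
    ∫⁻ x, ‖fderiv ℝ (dil q f) x‖ₑ * G ((2 : ℝ) ^ q • x) =
      ENNReal.ofReal (2 ^ q) * ∫⁻ x, ‖fderiv ℝ f x‖ₑ * G x := by
  have hp : (0 : ℝ) < 2 ^ q := by positivity
  simp only [fderiv_dil, enorm_smul, mul_assoc]
  rw [lintegral_const_mul' _ _ enorm_ne_top,
    lintegral_comp_smul_pos (fun x => ‖fderiv ℝ f x‖ₑ * G x) hp, ← mul_assoc,
    Real.enorm_eq_ofReal (by positivity), ← ENNReal.ofReal_mul (by positivity), pow_succ _ 3]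
  congr 2
  field_simp

lemma lintegral_enorm_fderiv_dil (q : ℕ) (f : 𝓢(E3, ℝ)) :
    ∫⁻ x, ‖fderiv ℝ (dil q f) x‖ₑ = ENNReal.ofReal (2 ^ q) * ∫⁻ x, ‖fderiv ℝ f x‖ₑ := by
  simpa using lintegral_enorm_fderiv_dil_mul q f (fun _ => 1)

lemma integral_dil (q : ℕ) (f : 𝓢(E3, ℝ)) : ∫ x, dil q f x = ∫ x, f x := by
  have hp : (0 : ℝ) < 2 ^ q := by positivity
  simp only [dil_apply]
  rw [integral_const_mul, Measure.integral_comp_smul volume f, finrank_euclideanSpace_fin,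
    abs_of_pos (by positivity), smul_eq_mul]
  field_simp

lemma dil_neg {f : 𝓢(E3, ℝ)} (hf : ∀ x, f (-x) = f x) (q : ℕ) (x : E3) :
    dil q f (-x) = dil q f x := by
  rw [dil_apply, dil_apply, smul_neg, hf]

lemma lintegral_enorm_lt_top {G : Type*} [NormedAddCommGroup G] [NormedSpace ℝ G] (f : 𝓢(E3, G)) :
    ∫⁻ x, ‖f x‖ₑ < ⊤ := f.integrable.2

lemma lintegral_enorm_fderiv_lt_top (f : 𝓢(E3, ℝ)) : ∫⁻ x, ‖fderiv ℝ f x‖ₑ < ⊤ :=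
  lintegral_enorm_lt_top (SchwartzMap.fderivCLM ℝ E3 ℝ f)

/-- Decay of order 7 absorbs the weight of order 3 and leaves order 4, integrable in dimension 3.
The cubic weight comes from the cube of an increment that grows linearly in the shift. -/
lemma lintegral_moment_lt_top (f : 𝓢(E3, ℝ)) :
    ∫⁻ x, ‖fderiv ℝ f x‖ₑ * ENNReal.ofReal (1 + ‖x‖) ^ 3 < ⊤ := by
  obtain ⟨C, hC0, hC⟩ := exists_decay_bound (SchwartzMap.fderivCLM ℝ E3 ℝ f) 7
  have h4 : Integrable (fun x : E3 => C * (1 + ‖x‖) ^ (-(4 : ℝ))) volume :=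
    (integrable_one_add_norm (by simp; norm_num)).const_mul C
  refine lt_of_le_of_lt (lintegral_mono fun x => ?_) h4.2
  have hx : 0 < 1 + ‖x‖ := by positivity
  rw [← ENNReal.ofReal_pow hx.le, ← ofReal_norm, ← ENNReal.ofReal_mul (norm_nonneg _),
    Real.enorm_eq_ofReal (by positivity)]
  refine ENNReal.ofReal_le_ofReal ?_
  have h := hC x
  rw [SchwartzMap.fderivCLM_apply] at h
  calc ‖fderiv ℝ f x‖ * (1 + ‖x‖) ^ 3
      ≤ (C * (1 + ‖x‖) ^ (-((7 : ℕ) : ℝ))) * (1 + ‖x‖) ^ 3 := by gcongr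
    _ = C * (1 + ‖x‖) ^ (-(4 : ℝ)) := by
        rw [mul_assoc, ← Real.rpow_natCast (1 + ‖x‖) 3, ← Real.rpow_add hx]
        norm_num

/-! ### Real convolutions of Schwartz functions -/

/-- The complexification of a real Schwartz function. -/
def complexify (f : 𝓢(E3, ℝ)) : 𝓢(E3, ℂ) := SchwartzMap.postcompCLM (𝕜 := ℝ) Complex.ofRealCLM f

lemma complexify_apply (f : 𝓢(E3, ℝ)) (x : E3) : complexify f x = (f x : ℂ) := rfl

/-- The real part of a complex Schwartz function. -/
def rePart (f : 𝓢(E3, ℂ)) : 𝓢(E3, ℝ) := SchwartzMap.postcompCLM (𝕜 := ℝ) Complex.reCLM f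

@[simp] lemma rePart_apply (f : 𝓢(E3, ℂ)) (x : E3) : rePart f x = (f x).re := rfl

lemma ofReal_conv (k f : E3 → ℝ) (x : E3) :
    ((conv k f x : ℝ) : ℂ) =
      ((fun x => (k x : ℂ)) ⋆[ContinuousLinearMap.mul ℂ ℂ, volume] fun x => (f x : ℂ)) x := by
  rw [conv, ← integral_complex_ofReal]
  simp [convolution]

/-- The convolution of two real Schwartz functions. -/
def rconv (k f : 𝓢(E3, ℝ)) : 𝓢(E3, ℝ) :=
  rePart (SchwartzMap.convolution (ContinuousLinearMap.mul ℂ ℂ) (complexify k) (complexify f))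

lemma rconv_apply (k f : 𝓢(E3, ℝ)) (x : E3) : rconv k f x = conv k f x := by
  rw [rconv, rePart_apply, SchwartzMap.convolution_apply]
  exact (congrArg Complex.re (ofReal_conv k f x)).symm.trans (Complex.ofReal_re _)

lemma coe_rconv (k f : 𝓢(E3, ℝ)) : ⇑(rconv k f) = conv k f := funext (rconv_apply k f)

/-! ### Kernels of Fourier multipliers -/

/-- Real, even, smooth, compactly supported symbols. -/
structure IsSymbol (m : E3 → ℝ) : Prop where
  smooth : ContDiff ℝ ∞ m
  compact : HasCompactSupport m
  even : ∀ ξ, m (-ξ) = m ξ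

namespace IsSymbol

variable {m m₁ m₂ : E3 → ℝ}

lemma mul (h₁ : IsSymbol m₁) (h₂ : IsSymbol m₂) : IsSymbol fun ξ => m₁ ξ * m₂ ξ :=
  ⟨h₁.smooth.mul h₂.smooth, h₁.compact.mul_right, fun ξ => by simp [h₁.even, h₂.even]⟩

lemma sub (h₁ : IsSymbol m₁) (h₂ : IsSymbol m₂) : IsSymbol fun ξ => m₁ ξ - m₂ ξ :=
  ⟨h₁.smooth.sub h₂.smooth, h₁.compact.sub h₂.compact, fun ξ => by simp [h₁.even, h₂.even]⟩

lemma comp_smul (h : IsSymbol m) {c : ℝ} (hc : c ≠ 0) : IsSymbol fun ξ => m (c • ξ) :=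
  ⟨h.smooth.comp (contDiff_const_smul c), h.compact.comp_smul hc, fun ξ => by
    rw [smul_neg, h.even]⟩

/-- The symbol in the normalisation of Mathlib's Fourier transform. -/
def toSchwartz (h : IsSymbol m) : 𝓢(E3, ℂ) :=
  HasCompactSupport.toSchwartzMap (f := fun η : E3 => ((m ((2 * Real.pi) • η) : ℝ) : ℂ))
    ((h.comp_smul (by positivity)).compact.comp_left (g := Complex.ofReal) rfl)
    (Complex.ofRealCLM.contDiff.comp (h.comp_smul (by positivity)).smooth)

lemma toSchwartz_apply (h : IsSymbol m) (η : E3) :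
    h.toSchwartz η = ((m ((2 * Real.pi) • η) : ℝ) : ℂ) := rfl

/-- The kernel of the multiplier, as a Schwartz function. -/
def kern (h : IsSymbol m) : 𝓢(E3, ℝ) := rePart (𝓕⁻ h.toSchwartz)

lemma coe_kern (h : IsSymbol m) : ⇑h.kern = symbolKernel m := by
  ext x
  rw [kern, rePart_apply, SchwartzMap.fourierInv_coe]
  rfl

lemma fourierInv_neg (h : IsSymbol m) (x : E3) : 𝓕⁻ h.toSchwartz (-x) = 𝓕⁻ h.toSchwartz x := by
  rw [SchwartzMap.fourierInv_coe, Real.fourierInv_eq', Real.fourierInv_eq',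
    ← integral_neg_eq_self]
  simp [toSchwartz_apply, h.even]

/-- Conjugation replaces `x` by `-x` for a real symbol, and evenness undoes this. The kernel is thus
real, so nothing is lost in taking real parts. -/
lemma conj_fourierInv (h : IsSymbol m) (x : E3) :
    (starRingEnd ℂ) (𝓕⁻ h.toSchwartz x) = 𝓕⁻ h.toSchwartz x := by
  conv_rhs => rw [← h.fourierInv_neg]
  rw [SchwartzMap.fourierInv_coe, Real.fourierInv_eq', Real.fourierInv_eq', ← integral_conj]
  congr with v
  simp [toSchwartz_apply, ← Complex.exp_conj, Complex.conj_ofNat]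

lemma complexify_kern (h : IsSymbol m) : complexify h.kern = 𝓕⁻ h.toSchwartz := by
  ext x
  exact Complex.conj_eq_iff_re.1 (h.conj_fourierInv x)

lemma fourier_complexify_kern (h : IsSymbol m) : 𝓕 (complexify h.kern) = h.toSchwartz := by
  rw [complexify_kern, FourierTransform.fourier_fourierInv_eq]

lemma kern_neg (h : IsSymbol m) (x : E3) : h.kern (-x) = h.kern x := by
  rw [kern, rePart_apply, rePart_apply, h.fourierInv_neg]

/-- The integral of the kernel is its Fourier transform at the origin. -/
lemma integral_kern (h : IsSymbol m) : ∫ x, h.kern x = m 0 := by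
  have h1 : 𝓕 (complexify h.kern) 0 = ((m 0 : ℝ) : ℂ) := by
    rw [fourier_complexify_kern, toSchwartz_apply, smul_zero]
  rw [SchwartzMap.fourier_coe, Real.fourier_eq'] at h1
  simp only [inner_zero_right, mul_zero, Complex.ofReal_zero, zero_mul, Complex.exp_zero,
    one_smul, complexify_apply] at h1
  rw [integral_complex_ofReal] at h1
  exact_mod_cast h1

/-- The convolution theorem, read after a Fourier transform: convolving kernels multiplies symbols.
-/
lemma conv_kern (h₁ : IsSymbol m₁) (h₂ : IsSymbol m₂) :
    conv h₁.kern h₂.kern = (h₁.mul h₂).kern := by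
  rw [← coe_rconv]
  suffices h : SchwartzMap.convolution (ContinuousLinearMap.mul ℂ ℂ) (complexify h₁.kern)
      (complexify h₂.kern) = 𝓕⁻ (h₁.mul h₂).toSchwartz by
    rw [rconv, h]; rfl
  set c : 𝓢(E3, ℂ) := SchwartzMap.convolution (ContinuousLinearMap.mul ℂ ℂ)
    (complexify h₁.kern) (complexify h₂.kern) with hc
  have h : 𝓕⁻ (𝓕 c : 𝓢(E3, ℂ)) = c := FourierTransform.fourierInv_fourier_eq c
  rw [← h, hc, SchwartzMap.fourier_convolution, fourier_complexify_kern, fourier_complexify_kern]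
  congr 1
  ext x
  simp [toSchwartz_apply]

lemma kern_congr (h₁ : IsSymbol m₁) (h₂ : IsSymbol m₂) (h : ∀ ξ, m₁ ξ = m₂ ξ) :
    h₁.kern = h₂.kern := by
  obtain rfl : m₁ = m₂ := funext h
  rfl

lemma kern_sub (h₁ : IsSymbol m₁) (h₂ : IsSymbol m₂) (x : E3) :
    (h₁.sub h₂).kern x = h₁.kern x - h₂.kern x := by
  have : (h₁.sub h₂).toSchwartz = h₁.toSchwartz - h₂.toSchwartz := by
    ext x
    simp [toSchwartz_apply]
  have h : 𝓕⁻ (h₁.sub h₂).toSchwartz = 𝓕⁻ h₁.toSchwartz - 𝓕⁻ h₂.toSchwartz := by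
    rw [this]
    exact map_sub (FourierTransform.fourierInvCLM ℂ 𝓢(E3, ℂ)) _ _
  simp [kern, h]

lemma kern_dil (h : IsSymbol m) (q : ℕ) :
    (h.comp_smul (c := ((2 : ℝ) ^ q)⁻¹) (by positivity)).kern = dil q h.kern := by
  ext x
  have hp : (0 : ℝ) < 2 ^ q := by positivity
  rw [dil_apply, kern, kern, rePart_apply, rePart_apply, SchwartzMap.fourierInv_coe,
    SchwartzMap.fourierInv_coe, Real.fourierInv_eq', Real.fourierInv_eq',
    ← Complex.re_ofReal_mul, ← Complex.real_smul]
  congr 1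
  have hs := Measure.integral_comp_smul (volume : Measure E3) (fun v =>
    Complex.exp (↑(2 * Real.pi * inner ℝ v ((2 : ℝ) ^ q • x)) * Complex.I) • h.toSchwartz v)
    ((2 : ℝ) ^ q)⁻¹
  rw [finrank_euclideanSpace_fin, abs_of_pos (by positivity), inv_pow, inv_inv] at hs
  rw [← hs]
  congr with v
  rw [inner_smul_left, inner_smul_right, toSchwartz_apply, toSchwartz_apply, smul_comm]
  simp only [RCLike.conj_to_real]
  rw [inv_mul_cancel_left₀ hp.ne']

end IsSymbol

/-! ### Approximation of the identity -/

section Approx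

variable {F : Type*} [NormedAddCommGroup F]

/-- Continuity of translations in `L²`, packaged as a continuous function of the shift so that
dominated convergence applies to it. -/
lemma exists_continuous_translate {u : E3 → F} (hu : MemLp u 2 volume) :
    ∃ T : E3 → ℝ≥0∞, Continuous T ∧ T 0 = 0 ∧
      ∀ y, eLpNorm (fun x => u (x - y) - u x) 2 volume = T y := by
  let g : C(E3, C(E3, E3)) := (ContinuousMap.mk (fun z : E3 × E3 => z.2 - z.1) (by fun_prop)).curry
  have hg : ∀ y, MeasurePreserving (g y) (volume : Measure E3) volume := fun y =>
    measurePreserving_sub_right volume y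
  let τ : E3 → Lp F 2 (volume : Measure E3) := fun y =>
    Lp.compMeasurePreserving (g y) (hg y) (hu.toLp u)
  have hτ : Continuous τ :=
    continuous_const.compMeasurePreservingLp g.continuous hg (by norm_num)
  refine ⟨fun y => ‖τ y - τ 0‖ₑ, by fun_prop, by simp, fun y => ?_⟩
  have h : ∀ y, τ y =ᵐ[volume] fun x => u (x - y) := fun y => by
    refine (Lp.coeFn_compMeasurePreserving _ (hg y)).trans ?_
    exact (hg y).quasiMeasurePreserving.ae_eq_comp hu.coeFn_toLp
  beta_reduce
  rw [Lp.enorm_def]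
  refine eLpNorm_congr_ae ?_
  filter_upwards [Lp.coeFn_sub (τ y) (τ 0), h y, h 0] with x h1 h2 h3
  rw [h1, Pi.sub_apply, h2, h3, sub_zero]

variable [NormedSpace ℝ F] [CompleteSpace F]

lemma conv_sub_self {k : E3 → ℝ} (hk : Integrable k volume) (hk' : MemLp k 2 volume)
    (h1 : ∫ y, k y = 1) {u : E3 → F} (hu : MemLp u 2 volume) (x : E3) :
    conv k u x - u x = ∫ y, k y • (u (x - y) - u x) := by
  simp only [smul_sub]
  rw [integral_sub (integrable_conv hk' hu x) (hk.smul_const _), integral_smul_const, h1, one_smul]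
  rfl

/-- Since `k_q` has integral one, the error is an average of increments of `u`. Jensen bounds its
square by `‖k‖₁ ∫ |k(z)| T(2^{-q} z)² dz`; the kernel may change sign, whence the factor `‖k‖₁`.
Dominated convergence concludes. -/
lemma tendsto_eLpNorm_conv_dil_sub {k : 𝓢(E3, ℝ)} (h1 : ∫ y, k y = 1) {u : E3 → F}
    (hu : MemLp u 2 volume) :
    Tendsto (fun q => eLpNorm (fun x => conv (dil q k) u x - u x) 2 volume) atTop (𝓝 0) := by
  obtain ⟨T, hTc, hT0, hT⟩ := exists_continuous_translate hu
  have hTle : ∀ y, T y ≤ 2 * eLpNorm u 2 volume := fun y => by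
    rw [← hT y, two_mul]
    refine (eLpNorm_sub_le (memLp_comp_sub_right hu y).1 hu.1 (by norm_num)).trans ?_
    rw [eLpNorm_comp_sub_right hu.1]
  have key : ∀ q, eLpNorm (fun x => conv (dil q k) u x - u x) 2 volume ^ 2 ≤
      (∫⁻ y, ‖k y‖ₑ) * ∫⁻ z, ‖k z‖ₑ * T (((2 : ℝ) ^ q)⁻¹ • z) ^ 2 := by
    intro q
    have hp : (0 : ℝ) < 2 ^ q := by positivity
    have h := eLpNorm_integral_smul_pow_le (dil q k).integrable.1
      (g := fun x y => u (x - y) - u x)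
      ((aestronglyMeasurable_uncurry_sub hu.1).sub hu.1.comp_fst) 1
    simp only [Nat.reduceAdd, Nat.cast_ofNat, pow_one, hT, lintegral_enorm_dil] at h
    simp only [conv_sub_self (dil q k).integrable ((dil q k).memLp 2)
      ((integral_dil q k).trans h1) hu]
    refine h.trans (le_of_eq ?_)
    congr 1
    have hs := lintegral_comp_smul_pos
      (fun z => ‖k z‖ₑ * T (((2 : ℝ) ^ q)⁻¹ • z) ^ 2) hp
    simp only [inv_smul_smul₀ hp.ne'] at hs
    simp only [dil_apply, enorm_mul, mul_assoc]
    rw [lintegral_const_mul' _ _ enorm_ne_top, hs, ← mul_assoc, Real.enorm_eq_ofReal (by positivity),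
      ← ENNReal.ofReal_mul (by positivity), mul_inv_cancel₀ (by positivity), ENNReal.ofReal_one,
      one_mul]
  have hlim : Tendsto (fun q : ℕ => ∫⁻ z, ‖k z‖ₑ * T (((2 : ℝ) ^ q)⁻¹ • z) ^ 2) atTop
      (𝓝 (∫⁻ _ : E3, 0)) := by
    refine tendsto_lintegral_of_dominated_convergence
      (fun z => ‖k z‖ₑ * (2 * eLpNorm u 2 volume) ^ 2) (fun q => ?_) (fun q => ?_) ?_ ?_
    · exact k.continuous.enorm.measurable.mul
        ((hTc.comp (by fun_prop : Continuous fun z : E3 => ((2 : ℝ) ^ q)⁻¹ • z)).measurable.pow_const _)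
    · exact .of_forall fun z => mul_le_mul' le_rfl (pow_le_pow_left' (hTle _) 2)
    · rw [lintegral_mul_const' _ _ (by finiteness [hu.2.ne])]
      exact ENNReal.mul_ne_top (lintegral_enorm_lt_top k).ne (by finiteness [hu.2.ne])
    · refine .of_forall fun z => ?_
      have hz : Tendsto (fun q : ℕ => ((2 : ℝ) ^ q)⁻¹ • z) atTop (𝓝 0) := by
        have h2 : Tendsto (fun q : ℕ => ((2 : ℝ) ^ q)⁻¹) atTop (𝓝 0) :=
          tendsto_inv_atTop_zero.comp (tendsto_pow_atTop_atTop_of_one_lt one_lt_two)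
        simpa using h2.smul_const z
      have hTz := (hTc.tendsto 0).comp hz
      rw [hT0] at hTz
      have := ENNReal.Tendsto.const_mul (a := ‖k z‖ₑ) (ENNReal.Tendsto.pow (n := 2) hTz) (Or.inr enorm_ne_top)
      simpa using this
  rw [lintegral_zero] at hlim
  have hlim' := ENNReal.Tendsto.const_mul (a := ∫⁻ y, ‖k y‖ₑ) hlim
    (Or.inr (lintegral_enorm_lt_top k).ne)
  rw [mul_zero] at hlim'
  have hsq := tendsto_of_tendsto_of_tendsto_of_le_of_le tendsto_const_nhds hlim'
    (fun q => zero_le) key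
  have hr := (ENNReal.continuous_rpow_const (y := (1 / 2 : ℝ))).tendsto 0 |>.comp hsq
  rw [ENNReal.zero_rpow_of_pos (by norm_num)] at hr
  refine hr.congr fun q => ?_
  rw [Function.comp_apply, ← ENNReal.rpow_natCast, ← ENNReal.rpow_mul]
  norm_num

/-- Almost everywhere convergence is what Fatou's lemma needs to carry `L³` bounds from the partial
sums to `u`. -/
lemma exists_subseq_conv_dil_tendsto_ae {k : 𝓢(E3, ℝ)} (h1 : ∫ y, k y = 1) {u : E3 → F}
    (hu : MemLp u 2 volume) : ∃ ns : ℕ → ℕ, StrictMono ns ∧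
      ∀ᵐ x, Tendsto (fun n => conv (dil (ns n) k) u x) atTop (𝓝 (u x)) := by
  refine TendstoInMeasure.exists_seq_tendsto_ae (tendstoInMeasure_of_tendsto_eLpNorm
    (p := 2) (by norm_num) (fun q => (aestronglyMeasurable_conv (dil q k).integrable.1 hu.1)) hu.1
    (tendsto_eLpNorm_conv_dil_sub h1 hu))

end Approx

/-! ### The Littlewood-Paley kernels -/

lemma waveNumber_eq (q : ℕ) : waveNumber q = 2 ^ q := rfl

namespace IsCutoff

variable {χ : E3 → ℝ}

lemma isSymbol (hχ : IsCutoff χ) : IsSymbol χ where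
  smooth := hχ.smooth
  compact := (isCompact_closedBall (0 : E3) 1).of_isClosed_subset (isClosed_tsupport χ)
    (hχ.support_subset.trans Metric.ball_subset_closedBall)
  even ξ := hχ.radial _ _ (norm_neg ξ)

lemma eq_zero (hχ : IsCutoff χ) {ξ : E3} (hξ : 1 ≤ ‖ξ‖) : χ ξ = 0 := by
  refine image_eq_zero_of_notMem_tsupport fun h => ?_
  have := mem_ball_zero_iff.1 (hχ.support_subset h)
  linarith

/-- The kernel `F⁻¹ χ`. -/
def kernel (hχ : IsCutoff χ) : 𝓢(E3, ℝ) := hχ.isSymbol.kern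

lemma kernel_neg (hχ : IsCutoff χ) (x : E3) : hχ.kernel (-x) = hχ.kernel x :=
  hχ.isSymbol.kern_neg x

lemma integral_kernel (hχ : IsCutoff χ) : ∫ x, hχ.kernel x = 1 := by
  rw [kernel, IsSymbol.integral_kern, hχ.eq_one 0 (by simp)]

/-- The symbol `χ(2^{-q} ξ)` is admissible. -/
lemma isSymbol_dil (hχ : IsCutoff χ) (q : ℕ) : IsSymbol fun ξ => χ (((2 : ℝ) ^ q)⁻¹ • ξ) :=
  hχ.isSymbol.comp_smul (by positivity)

lemma kern_isSymbol_dil (hχ : IsCutoff χ) (q : ℕ) : (hχ.isSymbol_dil q).kern = dil q hχ.kernel :=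
  hχ.isSymbol.kern_dil q

/-- The support of `χ(2^{-p}·)` lies in the ball of radius `2^p ≤ 2^{q-1}`, on which `χ(2^{-q}·)`
equals one. -/
lemma mul_eq_right (hχ : IsCutoff χ) {p q : ℕ} (h : p < q) (ξ : E3) :
    χ (((2 : ℝ) ^ q)⁻¹ • ξ) * χ (((2 : ℝ) ^ p)⁻¹ • ξ) = χ (((2 : ℝ) ^ p)⁻¹ • ξ) := by
  have hp : (0 : ℝ) < 2 ^ p := by positivity
  have hq : (0 : ℝ) < 2 ^ q := by positivity
  by_cases hξ : ‖ξ‖ < 2 ^ p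
  · rw [hχ.eq_one (((2 : ℝ) ^ q)⁻¹ • ξ), one_mul]
    rw [norm_smul, norm_inv, Real.norm_of_nonneg hq.le, inv_mul_le_iff₀ hq]
    have : (2 : ℝ) ^ (p + 1) ≤ 2 ^ q := pow_le_pow_right₀ one_le_two h
    rw [pow_succ] at this
    linarith
  · rw [hχ.eq_zero (ξ := ((2 : ℝ) ^ p)⁻¹ • ξ), mul_zero]
    rw [norm_smul, norm_inv, Real.norm_of_nonneg hp.le, le_inv_mul_iff₀ hp]
    linarith

/-- The kernel of the block `Δ_q`. -/
def blockKernel (hχ : IsCutoff χ) (q : ℕ) : 𝓢(E3, ℝ) :=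
  ((hχ.isSymbol_dil (q + 1)).sub (hχ.isSymbol_dil q)).kern

lemma blockKernel_apply (hχ : IsCutoff χ) (q : ℕ) (x : E3) :
    hχ.blockKernel q x = dil (q + 1) hχ.kernel x - dil q hχ.kernel x := by
  rw [blockKernel, IsSymbol.kern_sub (hχ.isSymbol_dil _) (hχ.isSymbol_dil _), kern_isSymbol_dil, kern_isSymbol_dil]

/-- The block symbol involves `χ` at scales `q` and `q + 1`, so `q + 2` is the first scale whose
cutoff reproduces it. -/
lemma conv_dil_blockKernel (hχ : IsCutoff χ) (q : ℕ) :
    conv (dil (q + 2) hχ.kernel) (hχ.blockKernel q) = hχ.blockKernel q := by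
  rw [← kern_isSymbol_dil, blockKernel, IsSymbol.conv_kern]
  refine congrArg _ (IsSymbol.kern_congr _ _ fun ξ => ?_)
  rw [mul_sub, hχ.mul_eq_right (by lia), hχ.mul_eq_right (by lia)]

lemma conv_dil_kernel (hχ : IsCutoff χ) :
    conv (dil 1 hχ.kernel) hχ.kernel = hχ.kernel := by
  rw [← kern_isSymbol_dil, kernel, IsSymbol.conv_kern]
  refine congrArg _ (IsSymbol.kern_congr _ _ fun ξ => ?_)
  simpa using hχ.mul_eq_right zero_lt_one ξ

section

variable {F : Type*} [NormedAddCommGroup F] [NormedSpace ℝ F]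

lemma lowBlock_eq (hχ : IsCutoff χ) (u : E3 → F) : lowBlock χ u = conv hχ.kernel u := by
  rw [lowBlock, multiplier_eq_conv, kernel, IsSymbol.coe_kern]

lemma block_eq (hχ : IsCutoff χ) (q : ℕ) (u : E3 → F) :
    block χ q u = conv (hχ.blockKernel q) u := by
  rw [block, multiplier_eq_conv, blockKernel, IsSymbol.coe_kern]
  congr 2
  ext ξ
  rw [shell, waveNumber_eq, smul_smul, pow_succ, mul_inv_rev]

/-- Telescoping of the shell symbols. Only pointwise integrability is assumed, because the identity
is also applied to the products `u_i u_j`, which are merely in `L¹`. -/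
lemma partialSum_eq (hχ : IsCutoff χ) {u : E3 → F} {x : E3}
    (hu : ∀ k : 𝓢(E3, ℝ), Integrable (fun t => k t • u (x - t)) volume) (Q : ℕ) :
    partialSum χ Q u x = conv (dil (Q + 1) hχ.kernel) u x := by
  have hb : ∀ q, block χ q u x =
      conv (dil (q + 1) hχ.kernel) u x - conv (dil q hχ.kernel) u x := by
    intro q
    rw [hχ.block_eq]
    simp only [conv, blockKernel_apply, sub_smul]
    exact integral_sub (hu _) (hu _)
  simp only [partialSum, hb]
  rw [Finset.sum_range_sub (fun q => conv (dil q hχ.kernel) u x), hχ.lowBlock_eq]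
  have : dil 0 hχ.kernel = hχ.kernel := by ext x; simp [dil_apply]
  rw [this]
  abel

lemma partialSum_eq_of_memLp (hχ : IsCutoff χ) {u : E3 → F} (hu : MemLp u 2 volume) (Q : ℕ) :
    partialSum χ Q u = conv (dil (Q + 1) hχ.kernel) u :=
  funext fun x => hχ.partialSum_eq (fun k => integrable_conv (k.memLp 2) hu x) Q

variable [CompleteSpace F]

lemma conv_dil_block (hχ : IsCutoff χ) (q : ℕ) {u : E3 → F} (hu : MemLp u 2 volume) :
    conv (dil (q + 2) hχ.kernel) (block χ q u) = block χ q u := by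
  ext x
  rw [hχ.block_eq, ← conv_assoc (dil _ _).integrable ((dil _ _).memLp 2)
    (hχ.blockKernel q).integrable ((hχ.blockKernel q).memLp 2) hu, conv_dil_blockKernel]

lemma conv_dil_lowBlock (hχ : IsCutoff χ) {u : E3 → F} (hu : MemLp u 2 volume) :
    conv (dil 1 hχ.kernel) (lowBlock χ u) = lowBlock χ u := by
  ext x
  rw [hχ.lowBlock_eq, ← conv_assoc (dil _ _).integrable ((dil _ _).memLp 2)
    hχ.kernel.integrable (hχ.kernel.memLp 2) hu, conv_dil_kernel]

end

end IsCutoff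

/-! ### Increments in `L³` of smooth or frequency-localised functions. -/

section Increments

variable {F : Type*} [NormedAddCommGroup F]

lemma eLpNorm_three_pow (f : E3 → F) : eLpNorm f 3 volume ^ 3 = ∫⁻ x, ‖f x‖ₑ ^ 3 :=
  eLpNorm_natCast_pow f (n := 3) (by norm_num)

lemma eLpNorm_two_pow (f : E3 → F) : eLpNorm f 2 volume ^ 2 = ∫⁻ x, ‖f x‖ₑ ^ 2 :=
  eLpNorm_natCast_pow f (n := 2) (by norm_num)

lemma eLpNorm_increment_le_two_mul {f : E3 → F} (hf : AEStronglyMeasurable f volume) (y : E3) :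
    eLpNorm (fun x => f (x - y) - f x) 3 volume ≤ 2 * eLpNorm f 3 volume := by
  refine (eLpNorm_sub_le (hf.comp_measurePreserving (measurePreserving_sub_right volume y)) hf
    (by norm_num)).trans (le_of_eq ?_)
  rw [two_mul]
  congr 1
  exact eLpNorm_comp_sub_right hf y

variable [NormedSpace ℝ F]

/-- The convolution is bounded by Cauchy–Schwarz and lies in `L²`, so `|f|³ ≤ C |f|²` is integrable.
Hence every single block has a finite `L³` norm. -/
lemma memLp_three_conv {k : 𝓢(E3, ℝ)} {u : E3 → F} (hu : MemLp u 2 volume) :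
    MemLp (conv k u) 3 volume := by
  have h2 : MemLp (conv k u) 2 volume := memLp_two_conv k.integrable hu
  refine ⟨h2.1, ?_⟩
  obtain ⟨C, hC⟩ : ∃ C, C = eLpNorm k 2 volume * eLpNorm u 2 volume := ⟨_, rfl⟩
  have hCt : C < ⊤ := by
    rw [hC]
    exact ENNReal.mul_lt_top (k.memLp 2 volume).eLpNorm_lt_top hu.eLpNorm_lt_top
  have hle : ∀ x, ‖conv k u x‖ₑ ^ 3 ≤ C * ‖conv k u x‖ₑ ^ 2 := fun x => by
    rw [pow_succ' _ 2, hC]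
    exact mul_le_mul' (enorm_conv_le (k.memLp 2) hu x) le_rfl
  have h3 : eLpNorm (conv k u) 3 volume ^ 3 < ⊤ := by
    rw [eLpNorm_three_pow]
    refine (lintegral_mono hle).trans_lt ?_
    rw [lintegral_const_mul' _ _ hCt.ne, ← eLpNorm_two_pow]
    exact ENNReal.mul_lt_top hCt (ENNReal.pow_lt_top h2.2)
  exact lt_top_iff_ne_top.2 fun h => by rw [h, ENNReal.top_pow (by norm_num)] at h3; exact h3.ne rfl

/-- Bernstein's inequality for increments of a function reproduced by a kernel. -/
lemma eLpNorm_increment_le (k : 𝓢(E3, ℝ)) {f : E3 → F} (hf : MemLp f 2 volume)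
    (hkf : conv k f = f) (y : E3) :
    eLpNorm (fun x => f (x - y) - f x) 3 volume ≤
      ‖y‖ₑ * (∫⁻ x, ‖fderiv ℝ k x‖ₑ) * eLpNorm f 3 volume := by
  have h : (fun x => f (x - y) - f x) = conv (fun t => k (t - y) - k t) f := by
    ext x
    rw [conv_sub_left (memLp_comp_sub_right (k.memLp 2) y) (k.memLp 2) hf]
    rw [congrFun hkf x, ← congrFun hkf (x - y), conv_swap k f (x - y), conv_swap _ f x]
    simp only [sub_right_comm]
  rw [h]
  have hm : AEStronglyMeasurable (fun t => k (t - y) - k t) volume :=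
    ((k.continuous.comp (by fun_prop : Continuous fun t : E3 => t - y)).sub
      k.continuous).aestronglyMeasurable
  refine (eLpNorm_conv_le hm hf.1 2).trans ?_
  exact mul_le_mul' (lintegral_enorm_sub_translate_le k y) le_rfl

end Increments

/-! ### Weighted dyadic sums -/

/-- The number `2^{1/3}`. -/
def cbrtTwo : ℝ≥0∞ := 2 ^ (1 / 3 : ℝ)

lemma cbrtTwo_pow_three : cbrtTwo ^ 3 = 2 := by
  rw [cbrtTwo, ← ENNReal.rpow_natCast, ← ENNReal.rpow_mul]
  norm_num

lemma cbrtTwo_ne_top : cbrtTwo ≠ ⊤ := ENNReal.rpow_ne_top_of_nonneg (by norm_num) (by norm_num)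

lemma one_lt_cbrtTwo : 1 < cbrtTwo := ENNReal.one_lt_rpow (by norm_num) (by norm_num)

lemma cbrtTwo_mul_inv : cbrtTwo * cbrtTwo⁻¹ = 1 :=
  ENNReal.mul_inv_cancel (zero_lt_one.trans one_lt_cbrtTwo).ne' cbrtTwo_ne_top

lemma inv_cbrtTwo_lt_one : cbrtTwo⁻¹ < 1 := ENNReal.inv_lt_one.2 one_lt_cbrtTwo

/-- With this form every later weight is an integer power of `2^{1/3}`. -/
lemma dyadicSize_eq {F : Type*} [NormedAddCommGroup F] [NormedSpace ℝ F] (χ : E3 → ℝ) (q : ℕ)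
    (u : E3 → F) : dyadicSize χ q u = cbrtTwo ^ q * eLpNorm (block χ q u) 3 volume := by
  rw [dyadicSize, waveNumber_eq, ENNReal.ofReal_pow (by norm_num), ENNReal.ofReal_ofNat, cbrtTwo,
    ← ENNReal.rpow_natCast, ← ENNReal.rpow_mul, ← ENNReal.rpow_natCast, ← ENNReal.rpow_mul,
    mul_comm (q : ℝ)]

/-- The geometric series `∑ 2^{-n/3}`. -/
def geomSum : ℝ≥0∞ := ∑' n : ℕ, cbrtTwo⁻¹ ^ n

lemma geomSum_ne_top : geomSum ≠ ⊤ := by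
  rw [geomSum, ENNReal.tsum_geometric]
  exact ENNReal.inv_ne_top.2 (tsub_pos_of_lt inv_cbrtTwo_lt_one).ne'

/-- With truncated subtraction the exponent is `|Q - q|`; cutting the sum at `Q` leaves two pieces
of a geometric series. -/
lemma tsum_dist_le (Q : ℕ) : ∑' q : ℕ, cbrtTwo⁻¹ ^ ((Q - q) + (q - Q)) ≤ 2 * geomSum := by
  rw [← Summable.sum_add_tsum_nat_add' (k := Q) ENNReal.summable, two_mul]
  refine add_le_add ?_ (le_of_eq ?_)
  · refine le_trans ?_ (ENNReal.sum_le_tsum (Finset.range (Q + 1)))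
    rw [← Finset.sum_range_reflect (fun n => cbrtTwo⁻¹ ^ n)]
    refine (Finset.sum_le_sum fun q hq => le_of_eq ?_).trans
      (Finset.sum_le_sum_of_subset (Finset.range_subset_range.2 Q.le_succ))
    have := Finset.mem_range.1 hq
    congr 1
    lia
  · exact tsum_congr fun n => by congr 1; lia

section Tail

variable {F : Type*} [NormedAddCommGroup F]

lemma eLpNorm_le_of_tendsto_ae {p : ℝ≥0∞} {f : ℕ → E3 → F} {g : E3 → F} {C : ℝ≥0∞}
    (hf : ∀ n, AEStronglyMeasurable (f n) volume) (hC : ∀ n, eLpNorm (f n) p volume ≤ C)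
    (h : ∀ᵐ x, Tendsto (fun n => f n x) atTop (𝓝 (g x))) : eLpNorm g p volume ≤ C :=
  (Lp.eLpNorm_lim_le_liminf_eLpNorm hf g h).trans
    (liminf_le_of_frequently_le' (Frequently.of_forall hC))

variable [NormedSpace ℝ F]

/-- The weighted dyadic sum `2^{-Q/3} ‖Δ_{-1}u‖₃ + ∑_q 2^{-|q-Q|/3} λ_q^{1/3} ‖Δ_q u‖₃`. -/
def dyadicTail (χ : E3 → ℝ) (Q : ℕ) (u : E3 → F) : ℝ≥0∞ :=
  cbrtTwo⁻¹ ^ Q * eLpNorm (lowBlock χ u) 3 volume +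
    ∑' q : ℕ, cbrtTwo⁻¹ ^ ((Q - q) + (q - Q)) * dyadicSize χ q u

/-- Uniformity in `Q` is the point: this supplies the dominating function for the time integral. -/
lemma dyadicTail_le (χ : E3 → ℝ) (Q : ℕ) (u : E3 → F) :
    dyadicTail χ Q u ≤ (1 + 2 * geomSum) * besovNorm χ u := by
  rw [dyadicTail, add_mul]
  refine add_le_add ?_ ?_
  · exact mul_le_mul' (pow_le_one₀ bot_le inv_cbrtTwo_lt_one.le) le_self_add
  · calc _ ≤ ∑' q : ℕ, cbrtTwo⁻¹ ^ ((Q - q) + (q - Q)) * besovNorm χ u := by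
          refine ENNReal.tsum_le_tsum fun q => mul_le_mul' le_rfl ?_
          exact (le_iSup (fun q => dyadicSize χ q u) q).trans le_add_self
      _ ≤ _ := by
          rw [ENNReal.tsum_mul_right]
          exact mul_le_mul' (tsum_dist_le Q) le_rfl

variable {χ : E3 → ℝ}

lemma IsCutoff.eLpNorm_lowBlock_ne_top (hχ : IsCutoff χ) {u : E3 → F} (hu : MemLp u 2 volume) :
    eLpNorm (lowBlock χ u) 3 volume ≠ ⊤ := by
  rw [hχ.lowBlock_eq]
  exact (memLp_three_conv hu).eLpNorm_ne_top

lemma IsCutoff.dyadicSize_ne_top (hχ : IsCutoff χ) {u : E3 → F} (hu : MemLp u 2 volume) (q : ℕ) :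
    dyadicSize χ q u ≠ ⊤ := by
  rw [dyadicSize_eq, hχ.block_eq]
  exact ENNReal.mul_ne_top (ENNReal.pow_ne_top cbrtTwo_ne_top) (memLp_three_conv hu).eLpNorm_ne_top

/-- The sum is split at an index `N` beyond which the dyadic sizes are at most `η`; the finitely
many remaining terms decay like `2^{-Q/3}`. -/
lemma IsCutoff.exists_dyadicTail_le (hχ : IsCutoff χ) {u : E3 → F} (hu : MemLp u 2 volume)
    (hB : MemBesovC χ u) {η : ℝ≥0∞} (hη : 0 < η) :
    ∃ c : ℝ≥0∞, c ≠ ⊤ ∧ ∀ Q, dyadicTail χ Q u ≤ cbrtTwo⁻¹ ^ Q * c + η * (2 * geomSum) := by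
  obtain ⟨N, hN⟩ := eventually_atTop.1 (ENNReal.tendsto_nhds_zero.1 hB η hη)
  -- The extra weight `2^{q/3}` in the constant comes from `2^{-|Q-q|/3} ≤ 2^{-Q/3} 2^{q/3}`.
  refine ⟨eLpNorm (lowBlock χ u) 3 volume + ∑ q ∈ Finset.range N, cbrtTwo ^ q * dyadicSize χ q u,
    ENNReal.add_ne_top.2 ⟨hχ.eLpNorm_lowBlock_ne_top hu, ENNReal.sum_ne_top.2 fun q _ =>
      ENNReal.mul_ne_top (ENNReal.pow_ne_top cbrtTwo_ne_top) (hχ.dyadicSize_ne_top hu q)⟩,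
    fun Q => ?_⟩
  rw [dyadicTail, mul_add, add_assoc]
  gcongr
  have h1 : ∀ q, cbrtTwo⁻¹ ^ ((Q - q) + (q - Q)) * dyadicSize χ q u ≤
      (if q ∈ Finset.range N then cbrtTwo⁻¹ ^ Q * (cbrtTwo ^ q * dyadicSize χ q u) else 0) +
        cbrtTwo⁻¹ ^ ((Q - q) + (q - Q)) * η := by
    intro q
    split_ifs with hq
    · refine le_add_right ?_
      rw [← mul_assoc]
      gcongr
      rcases le_total q Q with h | h
      · obtain ⟨j, rfl⟩ := Nat.exists_eq_add_of_le h
        have e : cbrtTwo⁻¹ ^ (q + j) * cbrtTwo ^ q = (cbrtTwo * cbrtTwo⁻¹) ^ q * cbrtTwo⁻¹ ^ j := by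
          ring
        rw [e, cbrtTwo_mul_inv, one_pow, one_mul]
        exact le_of_eq (by congr 1; lia)
      · obtain ⟨j, rfl⟩ := Nat.exists_eq_add_of_le h
        have e : cbrtTwo⁻¹ ^ Q * cbrtTwo ^ (Q + j) = (cbrtTwo * cbrtTwo⁻¹) ^ Q * cbrtTwo ^ j := by
          ring
        rw [e, cbrtTwo_mul_inv, one_pow, one_mul]
        exact (pow_le_one₀ bot_le inv_cbrtTwo_lt_one.le).trans (one_le_pow₀ one_lt_cbrtTwo.le)
    · rw [zero_add]
      gcongr
      exact hN q (by simpa using hq)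
  refine (ENNReal.tsum_le_tsum h1).trans ?_
  rw [ENNReal.tsum_add, ENNReal.tsum_mul_right, mul_comm η, Finset.mul_sum,
    tsum_eq_sum (s := Finset.range N) (fun q hq => if_neg hq)]
  refine add_le_add (le_of_eq (Finset.sum_congr rfl fun q hq => if_pos hq)) ?_
  exact mul_le_mul' (tsum_dist_le Q) le_rfl

lemma IsCutoff.tendsto_dyadicTail (hχ : IsCutoff χ) {u : E3 → F} (hu : MemLp u 2 volume)
    (hB : MemBesovC χ u) : Tendsto (fun Q => dyadicTail χ Q u) atTop (𝓝 0) := by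
  rw [ENNReal.tendsto_nhds_zero]
  intro ε hε
  have hG : (2 * geomSum) ≠ ⊤ := ENNReal.mul_ne_top (by norm_num) geomSum_ne_top
  obtain ⟨η, hη, hηε⟩ : ∃ η : ℝ≥0∞, 0 < η ∧ η * (2 * geomSum) ≤ ε / 2 := by
    refine ⟨ε / 2 / (2 * geomSum), ENNReal.div_pos (ENNReal.half_pos hε.ne').ne' hG, ?_⟩
    rw [mul_comm]
    exact ENNReal.mul_div_le
  obtain ⟨c, hc, hle⟩ := hχ.exists_dyadicTail_le hu hB hη
  have h1 : Tendsto (fun Q : ℕ => cbrtTwo⁻¹ ^ Q * c) atTop (𝓝 0) := by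
    simpa using ENNReal.Tendsto.mul_const
      (ENNReal.tendsto_pow_atTop_nhds_zero_of_lt_one inv_cbrtTwo_lt_one) (Or.inr hc)
  filter_upwards [ENNReal.tendsto_nhds_zero.1 h1 (ε / 2) (ENNReal.half_pos hε.ne')] with Q hQ
  exact (hle Q).trans ((add_le_add hQ hηε).trans (ENNReal.add_halves ε).le)

/-! ### Increments in `L³` -/

/-- For `q ≤ Q`, Bernstein's inequality gives a factor `2^q |y| = 2^{-(Q-q)} 2^Q |y|`; for `q ≥ Q`,
the increment is at most twice the norm. The constant `2 + 4A` and the factor `1 + 2^Q |y|` cover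
both cases. -/
lemma IsCutoff.eLpNorm_increment_block_le [CompleteSpace F] (hχ : IsCutoff χ) {u : E3 → F}
    (hu : MemLp u 2 volume) (Q q : ℕ) (y : E3) :
    eLpNorm (fun x => block χ q u (x - y) - block χ q u x) 3 volume ≤
      (2 + 4 * ∫⁻ x, ‖fderiv ℝ hχ.kernel x‖ₑ) * (1 + 2 ^ Q * ‖y‖ₑ) * cbrtTwo⁻¹ ^ Q *
        (cbrtTwo⁻¹ ^ ((Q - q) + (q - Q)) * dyadicSize χ q u) := by
  have hmem : MemLp (block χ q u) 2 volume := by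
    rw [hχ.block_eq]; exact memLp_two_conv (hχ.blockKernel q).integrable hu
  rw [dyadicSize_eq]
  set A := ∫⁻ x, ‖fderiv ℝ hχ.kernel x‖ₑ
  set b := eLpNorm (block χ q u) 3 volume
  rcases le_total q Q with h | h
  · obtain ⟨j, rfl⟩ := Nat.exists_eq_add_of_le h
    refine (eLpNorm_increment_le (dil (q + 2) hχ.kernel) hmem (hχ.conv_dil_block q hu) y).trans ?_
    rw [lintegral_enorm_fderiv_dil, ENNReal.ofReal_pow (by norm_num), ENNReal.ofReal_ofNat]
    have e : (q + j - q) + (q - (q + j)) = j := by lia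
    rw [e]
    calc ‖y‖ₑ * (2 ^ (q + 2) * A) * b
        = (4 * A) * (2 ^ q * ‖y‖ₑ) * b := by ring
      -- With `j = Q - q`, the decay `2^{-j}` is weakened to `2^{-2j/3}`, which is what the weights
      -- `2^{-Q/3} 2^{-j/3} 2^{q/3}` amount to.
      _ ≤ (4 * A) * ((2 ^ q * cbrtTwo ^ j) * ‖y‖ₑ) * b := by
          gcongr
          exact le_mul_of_one_le_right bot_le (one_le_pow₀ one_lt_cbrtTwo.le)
      _ = (4 * A) * (2 ^ (q + j) * ‖y‖ₑ) * cbrtTwo⁻¹ ^ (q + j) *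
            (cbrtTwo⁻¹ ^ j * (cbrtTwo ^ q * b)) := by
          have e1 : (4 * A) * (2 ^ (q + j) * ‖y‖ₑ) * cbrtTwo⁻¹ ^ (q + j) *
            (cbrtTwo⁻¹ ^ j * (cbrtTwo ^ q * b)) = (4 * A) * (2 ^ q * 2 ^ j * ‖y‖ₑ) * b *
              ((cbrtTwo * cbrtTwo⁻¹) ^ q * (cbrtTwo⁻¹ ^ 2) ^ j) := by ring
          have e2 : (2 : ℝ≥0∞) ^ j * (cbrtTwo⁻¹ ^ 2) ^ j = cbrtTwo ^ j := by
            rw [← mul_pow, ← cbrtTwo_pow_three]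
            congr 1
            calc cbrtTwo ^ 3 * cbrtTwo⁻¹ ^ 2 = cbrtTwo * (cbrtTwo * cbrtTwo⁻¹) ^ 2 := by ring
              _ = cbrtTwo := by rw [cbrtTwo_mul_inv]; simp
          rw [e1, cbrtTwo_mul_inv, one_pow, one_mul, ← e2]
          ring
      _ ≤ _ := by
          gcongr
          · exact le_add_self
          · exact le_add_self
  · obtain ⟨j, rfl⟩ := Nat.exists_eq_add_of_le h
    refine (eLpNorm_increment_le_two_mul hmem.1 y).trans ?_
    have e : (Q - (Q + j)) + (Q + j - Q) = j := by lia
    rw [e]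
    calc 2 * b = 2 * 1 * cbrtTwo⁻¹ ^ Q * (cbrtTwo⁻¹ ^ j * (cbrtTwo ^ (Q + j) * b)) := by
          have e1 : 2 * 1 * cbrtTwo⁻¹ ^ Q * (cbrtTwo⁻¹ ^ j * (cbrtTwo ^ (Q + j) * b)) =
            2 * b * (cbrtTwo * cbrtTwo⁻¹) ^ (Q + j) := by ring
          rw [e1, cbrtTwo_mul_inv, one_pow, mul_one]
      _ ≤ _ := by
          gcongr
          · exact le_self_add
          · exact le_self_add

lemma IsCutoff.eLpNorm_increment_lowBlock_le [CompleteSpace F] (hχ : IsCutoff χ) {u : E3 → F}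
    (hu : MemLp u 2 volume) (Q : ℕ) (y : E3) :
    eLpNorm (fun x => lowBlock χ u (x - y) - lowBlock χ u x) 3 volume ≤
      (2 + 4 * ∫⁻ x, ‖fderiv ℝ hχ.kernel x‖ₑ) * (1 + 2 ^ Q * ‖y‖ₑ) * cbrtTwo⁻¹ ^ Q *
        (cbrtTwo⁻¹ ^ Q * eLpNorm (lowBlock χ u) 3 volume) := by
  have hmem : MemLp (lowBlock χ u) 2 volume := by
    rw [hχ.lowBlock_eq]; exact memLp_two_conv hχ.kernel.integrable hu
  set A := ∫⁻ x, ‖fderiv ℝ hχ.kernel x‖ₑ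
  set b := eLpNorm (lowBlock χ u) 3 volume
  refine (eLpNorm_increment_le (dil 1 hχ.kernel) hmem (hχ.conv_dil_lowBlock hu) y).trans ?_
  rw [lintegral_enorm_fderiv_dil, ENNReal.ofReal_pow (by norm_num), ENNReal.ofReal_ofNat]
  calc ‖y‖ₑ * (2 ^ 1 * A) * b
      ≤ (4 * A) * (cbrtTwo ^ Q * ‖y‖ₑ) * b := by
        calc _ = (2 * A) * (1 * ‖y‖ₑ) * b := by ring
          _ ≤ _ := by
            gcongr
            · norm_num
            · exact one_le_pow₀ one_lt_cbrtTwo.le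
    _ = (4 * A) * (2 ^ Q * ‖y‖ₑ) * cbrtTwo⁻¹ ^ Q * (cbrtTwo⁻¹ ^ Q * b) := by
        have e1 : (4 * A) * (2 ^ Q * ‖y‖ₑ) * cbrtTwo⁻¹ ^ Q * (cbrtTwo⁻¹ ^ Q * b) =
          (4 * A) * (((2 : ℝ≥0∞) * cbrtTwo⁻¹ ^ 2) ^ Q * ‖y‖ₑ) * b := by ring
        have e2 : (2 : ℝ≥0∞) * cbrtTwo⁻¹ ^ 2 = cbrtTwo := by
          rw [← cbrtTwo_pow_three]
          calc cbrtTwo ^ 3 * cbrtTwo⁻¹ ^ 2 = cbrtTwo * (cbrtTwo * cbrtTwo⁻¹) ^ 2 := by ring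
            _ = cbrtTwo := by rw [cbrtTwo_mul_inv]; simp
        rw [e1, e2]
    _ ≤ _ := by
        gcongr
        · exact le_add_self
        · exact le_add_self

/-- The number `N` of summed blocks does not enter the bound, so `N` can tend to infinity with `Q`
fixed. -/
lemma IsCutoff.eLpNorm_increment_partialSum_le [CompleteSpace F] (hχ : IsCutoff χ) {u : E3 → F}
    (hu : MemLp u 2 volume) (Q N : ℕ) (y : E3) :
    eLpNorm (fun x => partialSum χ N u (x - y) - partialSum χ N u x) 3 volume ≤
      (2 + 4 * ∫⁻ x, ‖fderiv ℝ hχ.kernel x‖ₑ) * (1 + 2 ^ Q * ‖y‖ₑ) * cbrtTwo⁻¹ ^ Q *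
        dyadicTail χ Q u := by
  have hm : ∀ f : E3 → F, AEStronglyMeasurable f volume →
      AEStronglyMeasurable (fun x => f (x - y) - f x) volume := fun f hf =>
    (hf.comp_measurePreserving (measurePreserving_sub_right volume y)).sub hf
  have hblock : ∀ q, AEStronglyMeasurable (block χ q u) volume := fun q => by
    rw [hχ.block_eq]; exact (memLp_two_conv (hχ.blockKernel q).integrable hu).1
  have hlow : AEStronglyMeasurable (lowBlock χ u) volume := by
    rw [hχ.lowBlock_eq]; exact (memLp_two_conv hχ.kernel.integrable hu).1
  have h : (fun x => partialSum χ N u (x - y) - partialSum χ N u x) =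
      (fun x => lowBlock χ u (x - y) - lowBlock χ u x) +
        ∑ q ∈ Finset.range (N + 1), fun x => block χ q u (x - y) - block χ q u x := by
    ext x
    simp only [partialSum, Pi.add_apply, Finset.sum_apply, Finset.sum_sub_distrib]
    abel
  rw [h]
  refine (eLpNorm_add_le (hm _ hlow) (Finset.aestronglyMeasurable_sum _ fun q _ => hm _ (hblock q))
    (by norm_num)).trans ?_
  rw [dyadicTail, mul_add]
  refine add_le_add (hχ.eLpNorm_increment_lowBlock_le hu Q y) ?_
  refine (eLpNorm_sum_le (fun q _ => hm _ (hblock q)) (by norm_num)).trans ?_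
  rw [← ENNReal.tsum_mul_left]
  exact (Finset.sum_le_sum fun q _ => hχ.eLpNorm_increment_block_le hu Q q y).trans
    (ENNReal.sum_le_tsum _)

lemma IsCutoff.exists_subseq_partialSum [CompleteSpace F] (hχ : IsCutoff χ) {u : E3 → F}
    (hu : MemLp u 2 volume) : ∃ ns : ℕ → ℕ,
      ∀ᵐ x, Tendsto (fun n => partialSum χ (ns n) u x) atTop (𝓝 (u x)) := by
  obtain ⟨ns, hns, h⟩ := exists_subseq_conv_dil_tendsto_ae hχ.integral_kernel hu
  -- `S_N` uses the kernel at scale `N + 1`, so the indices are lowered by one; starting the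
  -- subsequence at `n + 1` keeps them positive before the subtraction.
  refine ⟨fun n => ns (n + 1) - 1, ?_⟩
  filter_upwards [h] with x hx
  refine ((tendsto_add_atTop_iff_nat 1).2 hx).congr fun n => ?_
  rw [hχ.partialSum_eq_of_memLp hu]
  have : 0 < ns (n + 1) := (Nat.zero_le _).trans_lt (hns (Nat.lt_succ_self n))
  rw [Nat.sub_add_cancel this]

lemma IsCutoff.aestronglyMeasurable_partialSum (hχ : IsCutoff χ) {u : E3 → F}
    (hu : MemLp u 2 volume) (N : ℕ) : AEStronglyMeasurable (partialSum χ N u) volume := by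
  rw [hχ.partialSum_eq_of_memLp hu]
  exact aestronglyMeasurable_conv (dil _ _).integrable.1 hu.1

/-- Fatou along the subsequence of partial sums. For `|y|` of order `2^{-Q}` this reads `‖δ_y u‖₃ ≲
|y|^{1/3} D_Q`. -/
lemma IsCutoff.eLpNorm_increment_le [CompleteSpace F] (hχ : IsCutoff χ) {u : E3 → F}
    (hu : MemLp u 2 volume) (Q : ℕ) (y : E3) :
    eLpNorm (fun x => u (x - y) - u x) 3 volume ≤
      (2 + 4 * ∫⁻ x, ‖fderiv ℝ hχ.kernel x‖ₑ) * (1 + 2 ^ Q * ‖y‖ₑ) * cbrtTwo⁻¹ ^ Q *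
        dyadicTail χ Q u := by
  obtain ⟨ns, h⟩ := hχ.exists_subseq_partialSum hu
  refine eLpNorm_le_of_tendsto_ae (fun n => ?_)
    (fun n => hχ.eLpNorm_increment_partialSum_le hu Q (ns n) y) ?_
  · have hm := hχ.aestronglyMeasurable_partialSum hu (ns n)
    exact (hm.comp_measurePreserving (measurePreserving_sub_right volume y)).sub hm
  · filter_upwards [h, (measurePreserving_sub_right volume y).quasiMeasurePreserving.ae h]
      with x h1 h2
    exact h2.sub h1

/-- At `Q = 0` the weights of `dyadicTail` cancel, and it is the plain sum of the `L³` norms of all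
blocks. -/
lemma IsCutoff.memLp_three [CompleteSpace F] (hχ : IsCutoff χ) {u : E3 → F}
    (hu : MemLp u 2 volume) (hB : MemBesovC χ u) : MemLp u 3 volume := by
  refine ⟨hu.1, ?_⟩
  have hfin : dyadicTail χ 0 u < ⊤ := by
    obtain ⟨c, hc, h⟩ := hχ.exists_dyadicTail_le hu hB zero_lt_one
    refine (h 0).trans_lt ?_
    rw [pow_zero, one_mul, one_mul]
    exact ENNReal.add_lt_top.2 ⟨hc.lt_top,
      ENNReal.mul_lt_top (by norm_num) geomSum_ne_top.lt_top⟩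
  have hblock : ∀ q, AEStronglyMeasurable (block χ q u) volume := fun q => by
    rw [hχ.block_eq]; exact (memLp_two_conv (hχ.blockKernel q).integrable hu).1
  have hlow : AEStronglyMeasurable (lowBlock χ u) volume := by
    rw [hχ.lowBlock_eq]; exact (memLp_two_conv hχ.kernel.integrable hu).1
  obtain ⟨ns, h⟩ := hχ.exists_subseq_partialSum hu
  refine (eLpNorm_le_of_tendsto_ae (fun n => hχ.aestronglyMeasurable_partialSum hu (ns n))
    (fun n => ?_) h).trans_lt hfin
  have e : partialSum χ (ns n) u =
      lowBlock χ u + ∑ q ∈ Finset.range (ns n + 1), block χ q u := by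
    ext x
    simp [partialSum]
  rw [e]
  refine (eLpNorm_add_le hlow (Finset.aestronglyMeasurable_sum _ fun q _ => hblock q)
    (by norm_num)).trans ?_
  rw [dyadicTail, pow_zero, one_mul]
  refine add_le_add le_rfl ((eLpNorm_sum_le (fun q _ => hblock q) (by norm_num)).trans ?_)
  refine (Finset.sum_le_sum fun q _ => ?_).trans (ENNReal.sum_le_tsum _)
  rw [dyadicSize_eq, ← mul_assoc, zero_tsub, zero_add, tsub_zero, ← mul_pow, mul_comm cbrtTwo⁻¹,
    cbrtTwo_mul_inv, one_pow, one_mul]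

end Tail

/-! ### Divergence-free fields tested against Schwartz functions -/

lemma exists_norm_fderiv_le (f : 𝓢(E3, ℝ)) : ∃ C, 0 ≤ C ∧ ∀ x, ‖fderiv ℝ f x‖ ≤ C := by
  obtain ⟨C, h0, h⟩ := exists_decay_bound (SchwartzMap.fderivCLM ℝ E3 ℝ f) 0
  exact ⟨C, h0, fun x => by simpa using h x⟩

/-- The test function is cut off by `ρ(x / (n+1))`. The derivative of the cutoff carries a factor `1
/ (n+1)`, so that term disappears in the limit by dominated convergence. -/
lemma IsDivFree.integral_schwartz {u : E3 → E3} (h : IsDivFree u) (hu : MemLp u 2 volume)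
    (g : 𝓢(E3, ℝ)) : ∫ x, fderiv ℝ g x (u x) = 0 := by
  let ρ : ContDiffBump (0 : E3) := ⟨1, 2, one_pos, one_lt_two⟩
  have hρs : ContDiff ℝ ∞ ρ := ρ.contDiff
  obtain ⟨C, hC0, hC⟩ := exists_norm_fderiv_le (ρ.hasCompactSupport.toSchwartzMap hρs)
  change ∀ x, ‖fderiv ℝ ρ x‖ ≤ C at hC
  let c : ℕ → ℝ := fun n => ((n : ℝ) + 1)⁻¹
  have hc0 : ∀ n, 0 < c n := fun n => by positivity
  have hc1 : ∀ n, c n ≤ 1 := fun n => inv_le_one_of_one_le₀ (by simp)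
  have hct : Tendsto c atTop (𝓝 0) :=
    tendsto_inv_atTop_zero.comp (tendsto_natCast_atTop_atTop.atTop_add tendsto_const_nhds)
  have hd : ∀ n x, HasFDerivAt (fun x => ρ (c n • x) * g x)
      (ρ (c n • x) • fderiv ℝ g x + g x • (c n • fderiv ℝ ρ (c n • x))) x := by
    intro n x
    have h1 : HasFDerivAt (fun x : E3 => ρ (c n • x)) (c n • fderiv ℝ ρ (c n • x)) x := by
      have hρd : HasFDerivAt ρ (fderiv ℝ ρ (c n • x)) (c n • x) :=
        (hρs.differentiable (by simp)).differentiableAt.hasFDerivAt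
      have h2 := hρd.comp x ((hasFDerivAt_id x).const_smul (c n))
      convert! h2 using 1
      ext v
      simp
    exact h1.mul (g.hasFDerivAt x)
  have hzero : ∀ n, ∫ x, (ρ (c n • x) • fderiv ℝ g x + g x • (c n • fderiv ℝ ρ (c n • x))) (u x) = 0 := by
    intro n
    have h1 := h (fun x => ρ (c n • x) * g x)
      ((hρs.comp (contDiff_const_smul (c n))).mul (g.smooth ⊤))
      ((ρ.hasCompactSupport.comp_smul (hc0 n).ne').mul_right)
    simpa only [(hd n _).fderiv] using h1
  have hm : ∀ L : E3 → E3 →L[ℝ] ℝ, Continuous L →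
      AEStronglyMeasurable (fun x => L x (u x)) volume := fun L hL =>
    (ContinuousLinearMap.id ℝ (E3 →L[ℝ] ℝ)).aestronglyMeasurable_comp₂ hL.aestronglyMeasurable hu.1
  have hgc : Continuous fun x => fderiv ℝ g x := (g.smooth 1).continuous_fderiv (by norm_num)
  have hρc : Continuous fun x => fderiv ℝ ρ x := hρs.continuous_fderiv (by simp)
  have hbi : Integrable (fun x => (‖fderiv ℝ g x‖ + C * ‖g x‖) * ‖u x‖) volume := by
    have h1 := ((SchwartzMap.fderivCLM ℝ E3 ℝ g).memLp 2 volume).norm.integrable_mul hu.norm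
    have h2 := (((g.memLp 2 volume).norm).integrable_mul hu.norm).const_mul C
    refine (h1.add h2).congr (.of_forall fun x => ?_)
    simp only [Pi.add_apply, Pi.mul_apply, SchwartzMap.fderivCLM_apply]
    ring
  have hlim := tendsto_integral_of_dominated_convergence
    (F := fun n x => (ρ (c n • x) • fderiv ℝ g x + g x • (c n • fderiv ℝ ρ (c n • x))) (u x))
    (f := fun x => fderiv ℝ g x (u x)) (μ := volume) _ (fun n => ?_) hbi (fun n => ?_) ?_
  · simp only [hzero] at hlim
    exact (tendsto_nhds_unique hlim tendsto_const_nhds)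
  · refine hm _ ?_
    have hs : Continuous fun x : E3 => c n • x := by fun_prop
    exact ((hρs.continuous.comp hs).smul hgc).add
      (g.continuous.smul ((hρc.comp hs).const_smul (c n)))
  · refine .of_forall fun x => ?_
    refine (ContinuousLinearMap.le_opNorm _ _).trans (mul_le_mul_of_nonneg_right ?_ (norm_nonneg _))
    refine (norm_add_le _ _).trans (add_le_add ?_ ?_)
    · rw [norm_smul, Real.norm_of_nonneg ρ.nonneg]
      exact mul_le_of_le_one_left (norm_nonneg _) ρ.le_one
    · rw [norm_smul, norm_smul, mul_comm, Real.norm_of_nonneg (hc0 n).le]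
      refine mul_le_mul_of_nonneg_right ?_ (norm_nonneg _)
      exact (mul_le_of_le_one_left (norm_nonneg _) (hc1 n)).trans (hC _)
  · refine .of_forall fun x => ?_
    have hcx : Tendsto (fun n => c n • x) atTop (𝓝 0) := by simpa using hct.smul_const x
    have h1 : Tendsto (fun n => ρ (c n • x)) atTop (𝓝 1) := by
      have := (hρs.continuous.tendsto 0).comp hcx
      rwa [ρ.one_of_mem_closedBall (by simp; exact zero_le_one)] at this
    have h2 : Tendsto (fun n => fderiv ℝ ρ (c n • x) (u x)) atTop (𝓝 (fderiv ℝ ρ 0 (u x))) :=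
      (((hρc.clm_apply continuous_const).tendsto 0).comp hcx)
    have h3 := (h1.mul_const (fderiv ℝ g x (u x))).add ((hct.mul h2).const_mul (g x))
    simpa using h3

/-! ### The Duchon-Robert identity -/

section DuchonRobert

variable {h : 𝓢(E3, ℝ)} {u : E3 → E3}

lemma fderiv_neg_of_even (heven : ∀ x, h (-x) = h x) (x : E3) :
    fderiv ℝ h (-x) = -fderiv ℝ h x := by
  have h1 : (fun y => h (-y)) = h := funext heven
  have h2 : HasFDerivAt (fun y => h (-y)) ((fderiv ℝ h (-x)).comp (-ContinuousLinearMap.id ℝ E3)) x :=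
    h.differentiableAt.hasFDerivAt.comp x (hasFDerivAt_id x).neg
  rw [h1] at h2
  rw [h2.fderiv]
  ext v
  simp

/-- The involution exchanging `x` and `x - w`. -/
lemma measurePreserving_swap_sub : MeasurePreserving
    (fun z : E3 × E3 => (z.1 - z.2, -z.2)) (volume.prod volume) (volume.prod volume) :=
  ((MeasurePreserving.id volume).prod (Measure.measurePreserving_neg volume)).comp
    (measurePreserving_sub_prod volume volume)

lemma integral_comp_swap_sub {G : E3 × E3 → ℝ} (hG : Integrable G (volume.prod volume)) :
    ∫ z, G (z.1 - z.2, -z.2) ∂(volume.prod volume) = ∫ z, G z ∂(volume.prod volume) := by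
  have hmp := measurePreserving_swap_sub
  conv_rhs => rw [← hmp.map_eq]
  rw [integral_map hmp.measurable.aemeasurable]
  rw [hmp.map_eq]
  exact hG.1

lemma integrable_comp_swap_sub {G : E3 × E3 → ℝ} (hG : Integrable G (volume.prod volume)) :
    Integrable (fun z : E3 × E3 => G (z.1 - z.2, -z.2)) (volume.prod volume) :=
  measurePreserving_swap_sub.integrable_comp_of_integrable hG

lemma integrable_cubic_bound (h : 𝓢(E3, ℝ)) (hu : MemLp u 3 volume) :
    Integrable (fun z : E3 × E3 => ‖fderiv ℝ h z.2‖ * (‖u z.1‖ ^ 3 + ‖u (z.1 - z.2)‖ ^ 3))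
      (volume.prod volume) := by
  have h3 : Integrable (fun x => ‖u x‖ ^ 3) volume := hu.integrable_norm_pow (by norm_num)
  have hp : Integrable (fun w => ‖fderiv ℝ h w‖) volume :=
    (SchwartzMap.fderivCLM ℝ E3 ℝ h).integrable.norm
  have h1 : Integrable (fun z : E3 × E3 => ‖u z.1‖ ^ 3 * ‖fderiv ℝ h z.2‖)
      (volume.prod volume) := h3.mul_prod hp
  have h2 := (measurePreserving_sub_prod (volume : Measure E3)
    (volume : Measure E3)).integrable_comp_of_integrable h1
  refine (h1.add h2).congr (.of_forall fun z => ?_)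
  simp only [Pi.add_apply, Function.comp_apply]
  ring

lemma integrable_of_cubic_bound (hu : MemLp u 3 volume) {G : E3 × E3 → ℝ}
    (hG : AEStronglyMeasurable G (volume.prod volume))
    (hle : ∀ z, ‖G z‖ ≤ ‖fderiv ℝ h z.2‖ * (‖u z.1‖ ^ 3 + ‖u (z.1 - z.2)‖ ^ 3)) :
    Integrable G (volume.prod volume) :=
  (integrable_cubic_bound h hu).mono' hG (.of_forall hle)

lemma aestronglyMeasurable_fderiv_apply {v : E3 × E3 → E3} (h : 𝓢(E3, ℝ))
    (hv : AEStronglyMeasurable v (volume.prod volume)) :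
    AEStronglyMeasurable (fun z : E3 × E3 => fderiv ℝ h z.2 (v z)) (volume.prod volume) := by
  have hc : Continuous fun z : E3 × E3 => fderiv ℝ h z.2 :=
    ((h.smooth 1).continuous_fderiv (by norm_num)).comp continuous_snd
  exact (ContinuousLinearMap.id ℝ (E3 →L[ℝ] ℝ)).aestronglyMeasurable_comp₂ hc.aestronglyMeasurable hv

lemma mul_sq_le_cube {a b : ℝ} (ha : 0 ≤ a) (hb : 0 ≤ b) : a ^ 2 * b ≤ a ^ 3 + b ^ 3 := by
  rcases le_total a b with hab | hab
  · have : a ^ 2 * b ≤ b ^ 2 * b := by gcongr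
    nlinarith [pow_nonneg ha 3]
  · have : a ^ 2 * b ≤ a ^ 2 * a := by gcongr
    nlinarith [pow_nonneg hb 3]

lemma integrable_selfTransport (hu : MemLp u 3 volume) :
    Integrable (fun z : E3 × E3 => ‖u z.1‖ ^ 2 * fderiv ℝ h z.2 (u z.1)) (volume.prod volume) := by
  refine integrable_of_cubic_bound (h := h) hu
    ((hu.1.comp_fst.norm.pow 2).mul (aestronglyMeasurable_fderiv_apply h hu.1.comp_fst)) fun z => ?_
  rw [norm_mul, norm_pow, norm_norm]
  have h1 := (fderiv ℝ h z.2).le_opNorm (u z.1)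
  calc ‖u z.1‖ ^ 2 * ‖fderiv ℝ h z.2 (u z.1)‖
      ≤ ‖u z.1‖ ^ 2 * (‖fderiv ℝ h z.2‖ * ‖u z.1‖) := by gcongr
    _ = ‖fderiv ℝ h z.2‖ * (‖u z.1‖ ^ 3 + 0) := by ring
    _ ≤ _ := by gcongr; positivity

lemma integrable_energyTransport (hu : MemLp u 3 volume) :
    Integrable (fun z : E3 × E3 => ‖u z.1‖ ^ 2 * fderiv ℝ h z.2 (u (z.1 - z.2)))
      (volume.prod volume) := by
  refine integrable_of_cubic_bound (h := h) hu ((hu.1.comp_fst.norm.pow 2).mul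
    (aestronglyMeasurable_fderiv_apply h (aestronglyMeasurable_uncurry_sub hu.1))) fun z => ?_
  rw [norm_mul, norm_pow, norm_norm]
  have h1 := (fderiv ℝ h z.2).le_opNorm (u (z.1 - z.2))
  calc ‖u z.1‖ ^ 2 * ‖fderiv ℝ h z.2 (u (z.1 - z.2))‖
      ≤ ‖u z.1‖ ^ 2 * (‖fderiv ℝ h z.2‖ * ‖u (z.1 - z.2)‖) := by gcongr
    _ = ‖fderiv ℝ h z.2‖ * (‖u z.1‖ ^ 2 * ‖u (z.1 - z.2)‖) := by ring
    _ ≤ _ := by gcongr; exact mul_sq_le_cube (norm_nonneg _) (norm_nonneg _)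

lemma integrable_trilinear (hu : MemLp u 3 volume) :
    Integrable (fun z : E3 × E3 => fderiv ℝ h z.2 (u z.1) * inner ℝ (u (z.1 - z.2)) (u z.1))
      (volume.prod volume) := by
  refine integrable_of_cubic_bound (h := h) hu ((aestronglyMeasurable_fderiv_apply h
    hu.1.comp_fst).mul ((aestronglyMeasurable_uncurry_sub hu.1).inner hu.1.comp_fst)) fun z => ?_
  rw [norm_mul]
  have h1 := (fderiv ℝ h z.2).le_opNorm (u z.1)
  have h2 := norm_inner_le_norm (𝕜 := ℝ) (u (z.1 - z.2)) (u z.1)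
  calc ‖fderiv ℝ h z.2 (u z.1)‖ * ‖inner ℝ (u (z.1 - z.2)) (u z.1)‖
      ≤ (‖fderiv ℝ h z.2‖ * ‖u z.1‖) * (‖u (z.1 - z.2)‖ * ‖u z.1‖) := by gcongr
    _ = ‖fderiv ℝ h z.2‖ * (‖u z.1‖ ^ 2 * ‖u (z.1 - z.2)‖) := by ring
    _ ≤ _ := by gcongr; exact mul_sq_le_cube (norm_nonneg _) (norm_nonneg _)

/-- For fixed `x` the inner integral is that of an odd function, since `∇h` is odd. -/
lemma integral_selfTransport (heven : ∀ x, h (-x) = h x) (hu : MemLp u 3 volume) :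
    ∫ z : E3 × E3, ‖u z.1‖ ^ 2 * fderiv ℝ h z.2 (u z.1) ∂(volume.prod volume) = 0 := by
  rw [integral_prod _ (integrable_selfTransport hu)]
  have h0 : ∀ v, ∫ w, fderiv ℝ h w v = 0 := by
    intro v
    have h1 := integral_neg_eq_self (fun w => fderiv ℝ h w v) volume
    simp only [fderiv_neg_of_even heven, neg_apply, integral_neg] at h1
    linarith
  simp only [integral_const_mul, h0, mul_zero, integral_zero]

/-- For fixed `x`, the substitution `y = x - w` turns the inner integral into the divergence-free
condition tested against a translate of `h`. -/
lemma integral_energyTransport (heven : ∀ x, h (-x) = h x) (hu2 : MemLp u 2 volume)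
    (hu : MemLp u 3 volume) (hdiv : IsDivFree u) :
    ∫ z : E3 × E3, ‖u z.1‖ ^ 2 * fderiv ℝ h z.2 (u (z.1 - z.2)) ∂(volume.prod volume) = 0 := by
  rw [integral_prod _ (integrable_energyTransport hu)]
  have h0 : ∀ x, ∫ w, fderiv ℝ h w (u (x - w)) = 0 := by
    intro x
    have h1 := hdiv.integral_schwartz hu2 (SchwartzMap.compSubConstCLM ℝ x h)
    have h2 : ∀ y, fderiv ℝ (SchwartzMap.compSubConstCLM ℝ x h) y = fderiv ℝ h (y - x) := by
      intro y
      have : (SchwartzMap.compSubConstCLM ℝ x h : E3 → ℝ) = fun y => h (y - x) :=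
        funext fun y => SchwartzMap.compSubConstCLM_apply ..
      rw [this, fderiv_comp_sub]
    simp only [h2] at h1
    rw [← integral_sub_left_eq_self _ volume x]
    simp only [sub_sub_cancel]
    rw [← neg_eq_zero, ← integral_neg, ← h1]
    congr with y
    rw [← neg_apply, ← fderiv_neg_of_even heven, neg_sub]
  simp only [integral_const_mul, h0, mul_zero, integral_zero]

lemma trilinear_conv_eq (hu2 : MemLp u 2 volume) (hu : MemLp u 3 volume) :
    trilinear u (conv h u) u =
      ∫ z : E3 × E3, fderiv ℝ h z.2 (u z.1) * inner ℝ (u (z.1 - z.2)) (u z.1)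
        ∂(volume.prod volume) := by
  rw [integral_prod _ (integrable_trilinear hu), trilinear]
  congr with x
  rw [fderiv_conv_apply h hu2, conv, real_inner_comm]
  refine ((innerSL ℝ (u x)).integral_comp_comm
    (integrable_conv ((∂_{u x} h : 𝓢(E3, ℝ)).memLp 2 volume) hu2 x)).symm.trans ?_
  congr with w
  simp [SchwartzMap.lineDerivOp_apply_eq_fderiv, real_inner_comm]

/-- Expanding the cube gives six terms. The involution `(x, w) ↦ (x - w, -w)` together with the
oddness of `∇h` pairs them: two are self-transport terms and two are energy-transport terms, all of
integral zero, while the two mixed terms each contribute `2 b(u, h ⋆ u, u)`. -/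
lemma duchonRobert (heven : ∀ x, h (-x) = h x) (hu2 : MemLp u 2 volume)
    (hu : MemLp u 3 volume) (hdiv : IsDivFree u) :
    ∫ z : E3 × E3, ‖u (z.1 - z.2) - u z.1‖ ^ 2 * fderiv ℝ h z.2 (u (z.1 - z.2) - u z.1)
      ∂(volume.prod volume) = 4 * trilinear u (conv h u) u := by
  rw [trilinear_conv_eq hu2 hu]
  have i1 := integrable_selfTransport (h := h) hu
  have i2 := integrable_energyTransport (h := h) hu
  have i3 := integrable_trilinear (h := h) hu
  have e1 := integral_comp_swap_sub i1
  have e2 := integral_comp_swap_sub i2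
  have e3 := integral_comp_swap_sub i3
  have j1 := integrable_comp_swap_sub i1
  have j2 := integrable_comp_swap_sub i2
  have j3 := integrable_comp_swap_sub i3
  have z1 := integral_selfTransport heven hu
  have z2 := integral_energyTransport heven hu2 hu hdiv
  simp only [sub_neg_eq_add, sub_add_cancel] at e1 e2 e3 j1 j2 j3
  have hsum := integral_add ((((j2.sub j1).add (j3.const_mul 2)).add (i3.const_mul 2)).add i2) i1.neg
  have hsum2 := integral_add (((j2.sub j1).add (j3.const_mul 2)).add (i3.const_mul 2)) i2
  have hsum3 := integral_add ((j2.sub j1).add (j3.const_mul 2)) (i3.const_mul 2)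
  have hsum4 := integral_add (j2.sub j1) (j3.const_mul 2)
  have hsum5 := integral_sub j2 j1
  simp only [Pi.add_apply, Pi.sub_apply, Pi.neg_apply, integral_const_mul, integral_neg] at hsum hsum2 hsum3 hsum4 hsum5
  rw [hsum2, hsum3, hsum4, hsum5, e1, e2, e3, z1, z2] at hsum
  refine Eq.trans ?_ (hsum.trans (by ring))
  congr with z
  rw [fderiv_neg_of_even heven]
  simp only [neg_apply, map_sub]
  rw [norm_sub_sq_real, real_inner_comm (u (z.1 - z.2)) (u z.1)]
  ring

/-- The energy flux through the scale of a kernel is controlled by the increments of the field. -/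
lemma enorm_trilinear_conv_le (heven : ∀ x, h (-x) = h x) (hu2 : MemLp u 2 volume)
    (hu : MemLp u 3 volume) (hdiv : IsDivFree u) :
    ‖trilinear u (conv h u) u‖ₑ ≤
      ∫⁻ w, ‖fderiv ℝ h w‖ₑ * eLpNorm (fun x => u (x - w) - u x) 3 volume ^ 3 := by
  have hδ : AEStronglyMeasurable (fun z : E3 × E3 => u (z.1 - z.2) - u z.1)
      (volume.prod volume) := (aestronglyMeasurable_uncurry_sub hu.1).sub hu.1.comp_fst
  have hc : Continuous fun z : E3 × E3 => fderiv ℝ h z.2 :=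
    ((h.smooth 1).continuous_fderiv (by norm_num)).comp continuous_snd
  have hm : AEMeasurable (fun z : E3 × E3 => ‖fderiv ℝ h z.2‖ₑ * ‖u (z.1 - z.2) - u z.1‖ₑ ^ 3)
      (volume.prod volume) := hc.enorm.measurable.aemeasurable.mul (hδ.enorm.pow_const 3)
  calc ‖trilinear u (conv h u) u‖ₑ ≤ ‖4 * trilinear u (conv h u) u‖ₑ := by
        rw [enorm_mul]
        refine le_mul_of_one_le_left bot_le ?_
        rw [Real.enorm_eq_ofReal (by norm_num)]
        norm_num
    _ ≤ ∫⁻ z : E3 × E3, ‖fderiv ℝ h z.2‖ₑ * ‖u (z.1 - z.2) - u z.1‖ₑ ^ 3 ∂(volume.prod volume) := by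
        rw [← duchonRobert heven hu2 hu hdiv]
        refine (enorm_integral_le_lintegral_enorm _).trans (lintegral_mono fun z => ?_)
        rw [enorm_mul, enorm_pow, enorm_norm]
        refine (mul_le_mul' le_rfl (ContinuousLinearMap.le_opENorm _ _)).trans (le_of_eq ?_)
        ring
    _ = _ := by
        rw [lintegral_prod_symm _ hm]
        refine lintegral_congr fun w => ?_
        dsimp only
        rw [lintegral_const_mul' _ _ enorm_ne_top, eLpNorm_three_pow]

end DuchonRobert

/-- The flux at wave number `2^Q` is bounded by the cube of the weighted dyadic sum. -/
lemma IsCutoff.exists_enorm_trilinear_le {χ : E3 → ℝ} (hχ : IsCutoff χ) {h : 𝓢(E3, ℝ)}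
    (heven : ∀ x, h (-x) = h x) : ∃ C : ℝ≥0∞, C ≠ ⊤ ∧ ∀ u : E3 → E3, MemLp u 2 volume →
      MemBesovC χ u → IsDivFree u → ∀ Q,
        ‖trilinear u (conv (dil Q h) u) u‖ₑ ≤ C * dyadicTail χ Q u ^ 3 := by
  set A := 2 + 4 * ∫⁻ x, ‖fderiv ℝ hχ.kernel x‖ₑ with hA
  set M := ∫⁻ x, ‖fderiv ℝ h x‖ₑ * ENNReal.ofReal (1 + ‖x‖) ^ 3 with hM
  have hAt : A ≠ ⊤ := ENNReal.add_ne_top.2 ⟨by norm_num,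
    ENNReal.mul_ne_top (by norm_num) (lintegral_enorm_fderiv_lt_top _).ne⟩
  refine ⟨A ^ 3 * M, ENNReal.mul_ne_top (ENNReal.pow_ne_top hAt) (lintegral_moment_lt_top h).ne,
    fun u hu hB hdiv Q => ?_⟩
  refine (enorm_trilinear_conv_le (dil_neg heven Q) hu (hχ.memLp_three hu hB) hdiv).trans ?_
  set D := dyadicTail χ Q u
  have hpt : ∀ w : E3, ‖fderiv ℝ (dil Q h) w‖ₑ *
      eLpNorm (fun x => u (x - w) - u x) 3 volume ^ 3 ≤
      (‖fderiv ℝ (dil Q h) w‖ₑ * ENNReal.ofReal (1 + ‖(2 : ℝ) ^ Q • w‖) ^ 3) *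
        (A ^ 3 * (cbrtTwo⁻¹ ^ Q) ^ 3 * D ^ 3) := by
    intro w
    refine (mul_le_mul' le_rfl (pow_le_pow_left' (hχ.eLpNorm_increment_le hu Q w) 3)).trans
      (le_of_eq ?_)
    have : ENNReal.ofReal (1 + ‖(2 : ℝ) ^ Q • w‖) = 1 + 2 ^ Q * ‖w‖ₑ := by
      rw [ENNReal.ofReal_add zero_le_one (norm_nonneg _), ofReal_norm, enorm_smul,
        Real.enorm_eq_ofReal (by positivity), ENNReal.ofReal_pow (by norm_num),
        ENNReal.ofReal_ofNat, ENNReal.ofReal_one]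
    rw [this]
    ring
  refine (lintegral_mono hpt).trans (le_of_eq ?_)
  have hm : Measurable fun w : E3 =>
      ‖fderiv ℝ (dil Q h) w‖ₑ * ENNReal.ofReal (1 + ‖(2 : ℝ) ^ Q • w‖) ^ 3 := by
    have hc : Continuous fun w => fderiv ℝ (dil Q h) w :=
      ((dil Q h).smooth 1).continuous_fderiv (by norm_num)
    exact hc.enorm.measurable.mul
      ((by fun_prop : Measurable fun w : E3 => 1 + ‖(2 : ℝ) ^ Q • w‖).ennreal_ofReal.pow_const 3)
  rw [lintegral_mul_const _ hm,
    lintegral_enorm_fderiv_dil_mul Q h (fun w => ENNReal.ofReal (1 + ‖w‖) ^ 3), ← hM]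
  -- The critical balance: one derivative of the kernel against three increments of order 1/3.
  have e : ENNReal.ofReal (2 ^ Q) * (cbrtTwo⁻¹ ^ Q) ^ 3 = 1 := by
    rw [ENNReal.ofReal_pow (by norm_num), ENNReal.ofReal_ofNat, ← cbrtTwo_pow_three]
    calc (cbrtTwo ^ 3) ^ Q * (cbrtTwo⁻¹ ^ Q) ^ 3 = (cbrtTwo * cbrtTwo⁻¹) ^ (3 * Q) := by ring
      _ = 1 := by rw [cbrtTwo_mul_inv, one_pow]
  calc _ = (ENNReal.ofReal (2 ^ Q) * (cbrtTwo⁻¹ ^ Q) ^ 3) * (A ^ 3 * M * D ^ 3) := by ring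
    _ = _ := by rw [e, one_mul]

/-! ### The energy flux as a trilinear form -/

lemma memLp_two_kernel (k : 𝓢(E3, ℝ)) : MemLp k 2 volume := k.memLp 2 volume

/-- Convolution with an even kernel is symmetric for the pairing of integrable functions with
bounded ones. -/
lemma integral_conv_mul {k : 𝓢(E3, ℝ)} (heven : ∀ x, k (-x) = k x) {f g : E3 → ℝ}
    (hf : Integrable f volume) (hg : AEStronglyMeasurable g volume) {C : ℝ}
    (hC : ∀ x, ‖g x‖ ≤ C) : ∫ x, conv k f x * g x = ∫ x, f x * conv k g x := by
  have hG : Integrable (fun z : E3 × E3 => k z.2 * f z.1 * g (z.1 - z.2))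
      (volume.prod volume) := by
    have h1 : Integrable (fun z : E3 × E3 => f z.1 * k z.2) (volume.prod volume) :=
      hf.mul_prod k.integrable
    refine (h1.mul_bdd (c := C) (aestronglyMeasurable_uncurry_sub hg)
      (.of_forall fun z => hC _)).congr (.of_forall fun z => ?_)
    dsimp only
    ring
  have e := integral_comp_swap_sub hG
  have hG' := integrable_comp_swap_sub hG
  rw [integral_prod _ hG, integral_prod _ hG'] at e
  simp only [sub_neg_eq_add, sub_add_cancel, heven] at e
  calc ∫ x, conv k f x * g x = ∫ x, ∫ t, k t * f (x - t) * g x := by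
        congr with x
        rw [conv, ← integral_mul_const]
        simp only [smul_eq_mul]
    _ = ∫ x, ∫ t, k t * f x * g (x - t) := e
    _ = ∫ x, f x * conv k g x := by
        congr with x
        rw [conv, ← integral_const_mul]
        congr with t
        simp only [smul_eq_mul]
        ring

lemma integrable_conv_mul {k : 𝓢(E3, ℝ)} {f g : E3 → ℝ} (hf : Integrable f volume)
    (hg : AEStronglyMeasurable g volume) {C : ℝ} (hC : ∀ x, ‖g x‖ ≤ C) :
    Integrable (fun x => conv k f x * g x) volume := by
  have h1 : MemLp (conv k f) (0 + 1 : ℕ) volume :=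
    memLp_conv k.integrable 0 (by simpa using memLp_one_iff_integrable.2 hf)
  have h2 : Integrable (conv k f) volume := memLp_one_iff_integrable.1 (by simpa using h1)
  exact h2.mul_bdd (c := C) hg (.of_forall hC)

variable {u : E3 → E3}

lemma fderiv_conv_eq (k : 𝓢(E3, ℝ)) (hu : MemLp u 2 volume) (v : E3) :
    (fun x => fderiv ℝ (conv k u) x v) = conv (∂_{v} k : 𝓢(E3, ℝ)) u :=
  funext fun x => fderiv_conv_apply k hu x v

lemma memLp_fderiv_conv (k : 𝓢(E3, ℝ)) (hu : MemLp u 2 volume) (v : E3) :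
    MemLp (fun x => fderiv ℝ (conv k u) x v) 2 volume := by
  rw [fderiv_conv_eq k hu]
  exact memLp_two_conv (∂_{v} k : 𝓢(E3, ℝ)).integrable hu

lemma exists_norm_fderiv_conv_le (k : 𝓢(E3, ℝ)) (hu : MemLp u 2 volume) (v : E3) :
    ∃ C, ∀ x, ‖fderiv ℝ (conv k u) x v‖ ≤ C :=
  ⟨_, fun x => by
    rw [fderiv_conv_apply k hu]
    exact norm_conv_le (memLp_two_kernel _) hu x⟩

/-- Convolutions commute with each other and with derivatives, so the second mollification can be
absorbed into the kernel. -/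
lemma conv_fderiv_conv (k : 𝓢(E3, ℝ)) (hu : MemLp u 2 volume) (v x : E3) (i : Fin 3) :
    conv k (fun y => fderiv ℝ (conv k u) y v i) x = fderiv ℝ (conv (rconv k k) u) x v i := by
  have h1 := conv_comp_clm (EuclideanSpace.proj i : E3 →L[ℝ] ℝ) (memLp_two_kernel k)
    (memLp_fderiv_conv k hu v) x
  have h2 : conv (rconv k k) u = conv k (conv k u) := by
    funext y
    rw [coe_rconv, conv_assoc k.integrable (memLp_two_kernel k) k.integrable
      (memLp_two_kernel k) hu]
  have h3 := conv_left_comm k.integrable (memLp_two_kernel k)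
    (∂_{v} k : 𝓢(E3, ℝ)).integrable (memLp_two_kernel _) hu x
  rw [h2, fderiv_conv_apply k (memLp_two_conv k.integrable hu), ← h3, ← fderiv_conv_eq k hu]
  exact h1

lemma integrable_mul_components (hu : MemLp u 2 volume) (i j : Fin 3) :
    Integrable (fun y => u y i * u y j) volume := by
  have h : ∀ i, MemLp (fun y => u y i) 2 volume := fun i =>
    (EuclideanSpace.proj i : E3 →L[ℝ] ℝ).comp_memLp' hu
  exact (h i).integrable_mul (h j)

lemma inner_clm_apply_self (A : E3 →L[ℝ] E3) (v : E3) :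
    inner ℝ (A v) v = ∑ i, ∑ j, v i * v j * A (stdVec j) i := by
  have hv : A v = ∑ j, v j • A (stdVec j) := by
    conv_lhs => rw [← (EuclideanSpace.basisFun (Fin 3) ℝ).sum_repr v]
    simp [stdVec]
  rw [hv, PiLp.inner_apply]
  refine Finset.sum_congr rfl fun i _ => ?_
  simp only [WithLp.ofLp_sum, Finset.sum_apply, PiLp.smul_apply, smul_eq_mul, RCLike.inner_apply,
    conj_trivial, Finset.mul_sum]
  exact Finset.sum_congr rfl fun j _ => by ring

lemma IsCutoff.fluxDensity_eq {χ : E3 → ℝ} (hχ : IsCutoff χ) (hu : MemLp u 2 volume) (Q : ℕ)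
    (x : E3) : fluxDensity χ Q u x = ∑ i, ∑ j,
      conv (dil (Q + 1) hχ.kernel) (fun y => u y i * u y j) x *
        fderiv ℝ (conv (dil (Q + 1) hχ.kernel) u) x (stdVec j) i := by
  rw [fluxDensity, Matrix.trace]
  simp only [Matrix.diag_apply, Matrix.mul_apply, partialSumTensor, gradMatrix, Matrix.of_apply,
    hχ.partialSum_eq_of_memLp hu]
  refine Finset.sum_congr rfl fun i _ => Finset.sum_congr rfl fun j _ => ?_
  rw [hχ.partialSum_eq]
  intro k
  obtain ⟨C, -, hC⟩ := exists_decay_bound k 0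
  refine (((integrable_mul_components hu i j).comp_sub_left x).bdd_mul (c := C)
    k.continuous.aestronglyMeasurable (.of_forall fun t => by simpa using hC t)).congr
    (.of_forall fun t => ?_)
  simp

lemma IsCutoff.integrable_fluxDensity_summand {χ : E3 → ℝ} (hχ : IsCutoff χ)
    (hu : MemLp u 2 volume) (Q : ℕ) (i j : Fin 3) :
    Integrable (fun x => conv (dil (Q + 1) hχ.kernel) (fun y => u y i * u y j) x *
      fderiv ℝ (conv (dil (Q + 1) hχ.kernel) u) x (stdVec j) i) volume := by
  obtain ⟨C, hC⟩ := exists_norm_fderiv_conv_le (dil (Q + 1) hχ.kernel) hu (stdVec j)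
  exact integrable_conv_mul (integrable_mul_components hu i j)
    ((EuclideanSpace.proj i : E3 →L[ℝ] ℝ).comp_memLp' (memLp_fderiv_conv _ hu _)).1
    fun x => (PiLp.norm_apply_le _ i).trans (hC x)

lemma IsCutoff.integrable_fluxDensity {χ : E3 → ℝ} (hχ : IsCutoff χ) (hu : MemLp u 2 volume)
    (Q : ℕ) : Integrable (fluxDensity χ Q u) volume := by
  rw [funext (hχ.fluxDensity_eq hu Q)]
  exact integrable_finsetSum _ fun i _ => integrable_finsetSum _ fun j _ =>
    hχ.integrable_fluxDensity_summand hu Q i j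

/-- Symmetry moves `S_Q` from `u ⊗ u`, which is only integrable, onto the bounded factor `∇ S_Q u`.
This gives `b(u, S_Q² u, u)`. -/
lemma IsCutoff.energyFlux_eq {χ : E3 → ℝ} (hχ : IsCutoff χ) (hu : MemLp u 2 volume) (Q : ℕ) :
    energyFlux χ Q u = trilinear u
      (conv (rconv (dil (Q + 1) hχ.kernel) (dil (Q + 1) hχ.kernel)) u) u := by
  set k := dil (Q + 1) hχ.kernel with hk
  have hint : ∀ i j, Integrable (fun x => u x i * u x j *
      fderiv ℝ (conv (rconv k k) u) x (stdVec j) i) volume := by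
    intro i j
    obtain ⟨C, hC⟩ := exists_norm_fderiv_conv_le (rconv k k) hu (stdVec j)
    exact (integrable_mul_components hu i j).mul_bdd (c := C)
      ((EuclideanSpace.proj i : E3 →L[ℝ] ℝ).comp_memLp' (memLp_fderiv_conv _ hu _)).1
      (.of_forall fun x => (PiLp.norm_apply_le _ i).trans (hC x))
  have hsum : ∀ i j, ∫ x, conv k (fun y => u y i * u y j) x *
      fderiv ℝ (conv k u) x (stdVec j) i = ∫ x, u x i * u x j *
      fderiv ℝ (conv (rconv k k) u) x (stdVec j) i := by
    intro i j
    obtain ⟨C, hC⟩ := exists_norm_fderiv_conv_le k hu (stdVec j)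
    refine (integral_conv_mul (dil_neg hχ.kernel_neg _) (integrable_mul_components hu i j)
      ((EuclideanSpace.proj i : E3 →L[ℝ] ℝ).comp_memLp' (memLp_fderiv_conv _ hu _)).1
      fun x => (PiLp.norm_apply_le _ i).trans (hC x)).trans ?_
    congr with x
    rw [← conv_fderiv_conv k hu]
    rfl
  rw [energyFlux, funext (hχ.fluxDensity_eq hu Q), trilinear]
  simp only [inner_clm_apply_self]
  rw [integral_finsetSum _ fun i _ => integrable_finsetSum _ fun j _ =>
      hχ.integrable_fluxDensity_summand hu Q i j,
    integral_finsetSum _ fun i _ => integrable_finsetSum _ fun j _ => hint i j]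
  refine Finset.sum_congr rfl fun i _ => ?_
  rw [integral_finsetSum _ fun j _ => hχ.integrable_fluxDensity_summand hu Q i j,
    integral_finsetSum _ fun j _ => hint i j]
  exact Finset.sum_congr rfl fun j _ => hsum i j

/-- The kernel with symbol `χ ^ 2`. -/
def IsCutoff.sqKernel {χ : E3 → ℝ} (hχ : IsCutoff χ) : 𝓢(E3, ℝ) :=
  (hχ.isSymbol.mul hχ.isSymbol).kern

lemma IsCutoff.sqKernel_neg {χ : E3 → ℝ} (hχ : IsCutoff χ) (x : E3) :
    hχ.sqKernel (-x) = hχ.sqKernel x := (hχ.isSymbol.mul hχ.isSymbol).kern_neg x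

/-- The squared multiplier at every scale is a dilation of one fixed profile, which makes the
constant in the flux bound independent of the scale. -/
lemma IsCutoff.rconv_dil_kernel {χ : E3 → ℝ} (hχ : IsCutoff χ) (q : ℕ) :
    rconv (dil q hχ.kernel) (dil q hχ.kernel) = dil q hχ.sqKernel := by
  ext x
  rw [rconv_apply, ← hχ.kern_isSymbol_dil, IsSymbol.conv_kern, sqKernel, ← IsSymbol.kern_dil]

/-- The energy flux through the wave number `2 ^ q` is controlled by the local dyadic sizes. -/
lemma IsCutoff.exists_enorm_trilinear_sqKernel_le {χ : E3 → ℝ} (hχ : IsCutoff χ) :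
    ∃ C : ℝ≥0∞, C ≠ ⊤ ∧ ∀ u : E3 → E3, MemLp u 2 volume → MemBesovC χ u → IsDivFree u → ∀ q,
      ‖trilinear u (conv (rconv (dil q hχ.kernel) (dil q hχ.kernel)) u) u‖ₑ ≤
        C * dyadicTail χ q u ^ 3 := by
  obtain ⟨C, hC, h⟩ := hχ.exists_enorm_trilinear_le hχ.sqKernel_neg
  refine ⟨C, hC, fun u hu hB hd q => ?_⟩
  rw [hχ.rconv_dil_kernel]
  exact h u hu hB hd q

lemma IsCutoff.tendsto_trilinear {χ : E3 → ℝ} (hχ : IsCutoff χ) (hu : MemLp u 2 volume)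
    (hd : IsDivFree u) (hB : MemBesovC χ u) : Tendsto (fun q => trilinear u
      (conv (rconv (dil q hχ.kernel) (dil q hχ.kernel)) u) u) atTop (𝓝 0) := by
  obtain ⟨C, hC, h⟩ := hχ.exists_enorm_trilinear_sqKernel_le
  rw [tendsto_zero_iff_enorm_tendsto_zero]
  refine tendsto_of_tendsto_of_tendsto_of_le_of_le tendsto_const_nhds ?_ (fun _ => bot_le)
    fun q => h u hu hB hd q
  have h1 := ENNReal.Tendsto.const_mul (a := C)
    ((ENNReal.continuous_pow 3).tendsto 0 |>.comp (hχ.tendsto_dyadicTail hu hB)) (.inr hC)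
  simpa using h1

lemma IsCutoff.tendsto_energyFlux {χ : E3 → ℝ} (hχ : IsCutoff χ) (hu : MemLp u 2 volume)
    (hd : IsDivFree u) (hB : MemBesovC χ u) :
    Tendsto (fun Q => energyFlux χ Q u) atTop (𝓝 0) := by
  simp only [hχ.energyFlux_eq hu]
  exact (hχ.tendsto_trilinear hu hd hB).comp (tendsto_add_atTop_nat 1)

/-! ### Schwartz vector fields -/

lemma lineDerivOp_comm (φ : 𝓢(E3, ℝ)) (v w : E3) : ∂_{v} (∂_{w} φ) = ∂_{w} (∂_{v} φ) := by
  have key : ∀ v w x, (∂_{v} (∂_{w} φ) : 𝓢(E3, ℝ)) x = fderiv ℝ (fderiv ℝ φ) x v w := by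
    intro v w x
    have hd : DifferentiableAt ℝ (fderiv ℝ φ) x :=
      (((φ.smooth 2).fderiv_right (m := 1) (by norm_num)).differentiable (by norm_num)) x
    have h1 : ((∂_{w} φ : 𝓢(E3, ℝ)) : E3 → ℝ) = fun y => fderiv ℝ φ y w :=
      funext fun y => SchwartzMap.lineDerivOp_apply_eq_fderiv ..
    rw [SchwartzMap.lineDerivOp_apply_eq_fderiv, h1]
    have h2 := hd.hasFDerivAt.clm_apply (hasFDerivAt_const w x)
    rw [h2.fderiv]
    simp
  ext x
  rw [key, key]
  have hd : DifferentiableAt ℝ (fderiv ℝ φ) x :=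
    (((φ.smooth 2).fderiv_right (m := 1) (by norm_num)).differentiable (by norm_num)) x
  exact second_derivative_symmetric (fun y => φ.differentiableAt.hasFDerivAt) hd.hasFDerivAt v w

/-- A component of a Schwartz vector field. -/
def component (i : Fin 3) (ψ : 𝓢(E3, E3)) : 𝓢(E3, ℝ) :=
  SchwartzMap.postcompCLM (𝕜 := ℝ) (EuclideanSpace.proj i : E3 →L[ℝ] ℝ) ψ

lemma component_apply (i : Fin 3) (ψ : 𝓢(E3, E3)) (x : E3) : component i ψ x = ψ x i := rfl

/-- The Schwartz vector field with given components. -/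
def vecField (c : Fin 3 → 𝓢(E3, ℝ)) : 𝓢(E3, E3) :=
  ∑ i, SchwartzMap.postcompCLM (𝕜 := ℝ)
    ((ContinuousLinearMap.id ℝ ℝ).smulRight (stdVec i)) (c i)

lemma vecField_apply (c : Fin 3 → 𝓢(E3, ℝ)) (x : E3) (i : Fin 3) : vecField c x i = c i x := by
  have h : vecField c x = ∑ i, c i x • stdVec i := by
    rw [vecField, sum_apply]
    rfl
  rw [h]
  simp [stdVec, Finset.sum_apply, Pi.single_apply]

lemma component_vecField (c : Fin 3 → 𝓢(E3, ℝ)) (i : Fin 3) : component i (vecField c) = c i := by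
  ext x
  rw [component_apply, vecField_apply]

lemma trace_gradMatrix (ψ : 𝓢(E3, E3)) (x : E3) :
    (gradMatrix ψ x).trace = ∑ i, (∂_{stdVec i} (component i ψ) : 𝓢(E3, ℝ)) x := by
  rw [Matrix.trace]
  refine Finset.sum_congr rfl fun i _ => ?_
  rw [SchwartzMap.lineDerivOp_apply_eq_fderiv]
  have h : HasFDerivAt (component i ψ)
      ((EuclideanSpace.proj i : E3 →L[ℝ] ℝ).comp (fderiv ℝ ψ x)) x :=
    (EuclideanSpace.proj i : E3 →L[ℝ] ℝ).hasFDerivAt.comp x ψ.differentiableAt.hasFDerivAt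
  rw [h.fderiv]
  rfl

/-- The gradient of a Schwartz function. -/
def gradField (g : 𝓢(E3, ℝ)) : 𝓢(E3, E3) := vecField fun i => ∂_{stdVec i} g

lemma fderiv_apply_eq_sum (g : 𝓢(E3, ℝ)) (x v : E3) :
    fderiv ℝ g x v = ∑ i, v i * (∂_{stdVec i} g : 𝓢(E3, ℝ)) x := by
  conv_lhs => rw [← (EuclideanSpace.basisFun (Fin 3) ℝ).sum_repr v]
  simp [stdVec, SchwartzMap.lineDerivOp_apply_eq_fderiv]

lemma inner_gradField (g : 𝓢(E3, ℝ)) (x v : E3) :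
    inner ℝ (gradField g x) v = fderiv ℝ g x v := by
  rw [fderiv_apply_eq_sum, PiLp.inner_apply]
  refine Finset.sum_congr rfl fun i _ => ?_
  rw [gradField, vecField_apply]
  simp

/-- The divergence-free field `Δφ e_j - ∇∂_jφ`. -/
def doubleCurl (φ : 𝓢(E3, ℝ)) (j : Fin 3) : 𝓢(E3, E3) :=
  vecField (Pi.single j (Δ φ)) - gradField (∂_{stdVec j} φ)

lemma laplacian_eq_sum_stdVec {F : Type*} [NormedAddCommGroup F] [NormedSpace ℝ F]
    (φ : 𝓢(E3, F)) : Δ φ = ∑ i, ∂_{stdVec i} (∂_{stdVec i} φ) := by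
  rw [SchwartzMap.laplacian_eq_sum (EuclideanSpace.basisFun (Fin 3) ℝ)]
  simp [stdVec]

/-- The field is minus the double curl of `φ e_j`; its divergence is `∂_j Δφ - Δ ∂_j φ`. -/
lemma trace_gradMatrix_doubleCurl (φ : 𝓢(E3, ℝ)) (j : Fin 3) (x : E3) :
    (gradMatrix (doubleCurl φ j) x).trace = 0 := by
  have hc : ∀ i, component i (doubleCurl φ j) =
      Pi.single (M := fun _ => 𝓢(E3, ℝ)) j (Δ φ) i - ∂_{stdVec i} (∂_{stdVec j} φ) := by
    intro i
    ext x
    rw [component_apply, doubleCurl, sub_apply, sub_apply, PiLp.sub_apply,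
      vecField_apply, gradField, vecField_apply]
  rw [trace_gradMatrix]
  have hs : ∀ (v : E3) (f g : 𝓢(E3, ℝ)), ∂_{v} (f - g) = ∂_{v} f - ∂_{v} g := fun v f g =>
    map_sub (lineDerivOpCLM ℝ 𝓢(E3, ℝ) v) f g
  simp only [hc, hs, sub_apply, Finset.sum_sub_distrib]
  rw [Finset.sum_eq_single j, Pi.single_eq_same, laplacian_eq_sum_stdVec, lineDerivOp_sum,
    sum_apply, sub_eq_zero]
  · refine Finset.sum_congr rfl fun i _ => ?_
    rw [lineDerivOp_comm, lineDerivOp_comm φ]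
  · intro i _ hi
    rw [Pi.single_eq_of_ne hi]
    simp
  · simp

lemma integrable_inner {a b : E3 → E3} (ha : MemLp a 2 volume) (hb : MemLp b 2 volume) :
    Integrable (fun x => inner ℝ (a x) (b x)) volume :=
  (ha.norm.integrable_mul hb.norm).mono' (ha.1.inner hb.1)
    (.of_forall fun _ => norm_inner_le_norm _ _)

/-- The gradient part is invisible to a divergence-free `z`. A field orthogonal to all double curls
therefore has weakly harmonic components. -/
lemma integral_inner_doubleCurl {z : E3 → E3} (hz : MemLp z 2 volume) (hd : IsDivFree z)
    (φ : 𝓢(E3, ℝ)) (j : Fin 3) :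
    ∫ x, inner ℝ (doubleCurl φ j x) (z x) = ∫ x, z x j * (Δ φ) x := by
  have h0 := hd.integral_schwartz hz (∂_{stdVec j} φ)
  have i1 : Integrable (fun x => z x j * (Δ φ) x) volume :=
    ((EuclideanSpace.proj j : E3 →L[ℝ] ℝ).comp_memLp' hz).integrable_mul ((Δ φ).memLp 2 volume)
  have i2 : Integrable (fun x => fderiv ℝ (∂_{stdVec j} φ : 𝓢(E3, ℝ)) x (z x)) volume := by
    simp only [← inner_gradField]
    exact integrable_inner ((gradField (∂_{stdVec j} φ)).memLp 2 volume) hz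
  have h1 := integral_sub i1 i2
  rw [h0, sub_zero] at h1
  rw [← h1]
  congr with x
  rw [doubleCurl, sub_apply, inner_sub_left, inner_gradField]
  congr 1
  rw [PiLp.inner_apply]
  simp only [vecField_apply]
  rw [Finset.sum_eq_single j]
  · simp
  · intro i _ hi
    rw [Pi.single_eq_of_ne hi]
    simp
  · simp

/-! ### Liouville's theorem for square integrable functions -/

lemma lineDerivOp_rePart (f : 𝓢(E3, ℂ)) (v : E3) : ∂_{v} (rePart f) = rePart (∂_{v} f) := by
  ext x
  rw [rePart_apply, SchwartzMap.lineDerivOp_apply_eq_fderiv,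
    SchwartzMap.lineDerivOp_apply_eq_fderiv]
  have h : HasFDerivAt (rePart f) (Complex.reCLM.comp (fderiv ℝ f x)) x :=
    Complex.reCLM.hasFDerivAt.comp x f.differentiableAt.hasFDerivAt
  rw [h.fderiv]
  rfl

lemma laplacian_rePart (f : 𝓢(E3, ℂ)) : Δ (rePart f) = rePart (Δ f) := by
  have h := map_sum (SchwartzMap.postcompCLM (𝕜 := ℝ) (E := E3) Complex.reCLM)
    (fun i => ∂_{stdVec i} (∂_{stdVec i} f)) Finset.univ
  rw [laplacian_eq_sum_stdVec, laplacian_eq_sum_stdVec]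
  refine Eq.trans (Finset.sum_congr rfl fun i _ => ?_) h.symm
  rw [lineDerivOp_rePart, lineDerivOp_rePart]
  rfl

lemma fourier_laplacian_fourierInv (g : 𝓢(E3, ℂ)) (ξ : E3) :
    𝓕 (Δ (𝓕⁻ g)) ξ = -((2 * Real.pi) ^ 2 * ‖ξ‖ ^ 2 : ℝ) * g ξ := by
  have ht : (fun ξ : E3 => ‖ξ‖ ^ 2).HasTemperateGrowth := by fun_prop
  rw [SchwartzMap.laplacian_eq_fourierMultiplierCLM, FourierTransform.fourier_smul,
    SchwartzMap.fourierMultiplierCLM_apply, FourierTransform.fourier_fourierInv_eq,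
    FourierTransform.fourier_fourierInv_eq, smul_apply]
  erw [SchwartzMap.smulLeftCLM_apply_apply ht]
  simp [mul_assoc]

/-- By Plancherel the hypothesis says `|ξ|² ẑ(ξ) = 0` almost everywhere. Hence `ẑ` vanishes off the
origin, a null set. -/
lemma ae_eq_zero_of_integral_mul_laplacian {z : E3 → ℝ} (hz : MemLp z 2 volume)
    (h : ∀ φ : 𝓢(E3, ℝ), ∫ x, z x * (Δ φ) x = 0) : z =ᵐ[volume] 0 := by
  have hZ : MemLp (fun x => (z x : ℂ)) 2 volume := hz.ofReal
  have hi : ∀ φ : 𝓢(E3, ℂ), Integrable (fun x => (z x : ℂ) * (Δ φ) x) volume := fun φ =>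
    hZ.integrable_mul ((Δ φ).memLp 2 volume)
  have hre : ∀ φ : 𝓢(E3, ℂ), (∫ x, (z x : ℂ) * (Δ φ) x).re = 0 := by
    intro φ
    rw [← h (rePart φ), ← Complex.reCLM_apply, ← Complex.reCLM.integral_comp_comm (hi φ)]
    congr with x
    simp [laplacian_rePart, rePart_apply]
  have hC : ∀ φ : 𝓢(E3, ℂ), ∫ x, (z x : ℂ) * (Δ φ) x = 0 := by
    intro φ
    refine Complex.ext (hre φ) ?_
    -- The real part of `-i` times the integral is its imaginary part.
    have h1 := hre ((-Complex.I) • φ)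
    have h2 : Δ ((-Complex.I) • φ) = (-Complex.I) • Δ φ := by
      simp only [laplacian_eq_sum_stdVec, lineDerivOp_smul, Finset.smul_sum]
    have h3 : ∀ x, (z x : ℂ) * (Δ ((-Complex.I) • φ)) x = -Complex.I * ((z x : ℂ) * (Δ φ) x) := by
      intro x
      rw [h2, smul_apply, smul_eq_mul]
      ring
    simp only [h3] at h1
    rw [integral_const_mul] at h1
    simpa using h1
  set Z : Lp ℂ 2 (volume : Measure E3) := hZ.toLp _ with hZdef
  have hloc : LocallyIntegrable (fun ξ => (𝓕 Z : Lp ℂ 2 (volume : Measure E3)) ξ) volume :=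
    (Lp.memLp (𝓕 Z)).locallyIntegrable (by norm_num)
  have hF : ∀ g : 𝓢(E3, ℂ), ∫ ξ, inner ℂ ((𝓕 Z : Lp ℂ 2 (volume : Measure E3)) ξ)
      (-((2 * Real.pi) ^ 2 * ‖ξ‖ ^ 2 : ℝ) * g ξ) = 0 := by
    intro g
    have h1 : inner ℂ Z ((Δ (𝓕⁻ g)).toLp 2 volume) = 0 := by
      rw [L2.inner_def, ← hC (𝓕⁻ g)]
      refine integral_congr_ae ?_
      filter_upwards [hZ.coeFn_toLp, (Δ (𝓕⁻ g)).coeFn_toLp 2 volume] with x h1 h2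
      rw [h1, h2]
      simp [mul_comm]
    rw [← Lp.inner_fourier_eq, SchwartzMap.toLp_fourier_eq, L2.inner_def] at h1
    rw [← h1]
    refine integral_congr_ae ?_
    filter_upwards [(𝓕 (Δ (𝓕⁻ g))).coeFn_toLp 2 volume] with x h2
    rw [h2, fourier_laplacian_fourierInv]
  have hzero : ∀ᵐ ξ : E3, (‖ξ‖ ^ 2 : ℝ) • (𝓕 Z : Lp ℂ 2 (volume : Measure E3)) ξ = 0 := by
    refine ae_eq_zero_of_integral_contDiff_smul_eq_zero
      (hloc.continuous_smul (by fun_prop)) fun g hg hgc => ?_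
    have h1 := congr_arg (starRingEnd ℂ) (hF (complexify (hgc.toSchwartzMap hg)))
    rw [← integral_conj, map_zero] at h1
    have h2 : ∀ ξ, (starRingEnd ℂ) (inner ℂ ((𝓕 Z : Lp ℂ 2 (volume : Measure E3)) ξ)
        (-((2 * Real.pi) ^ 2 * ‖ξ‖ ^ 2 : ℝ) * complexify (hgc.toSchwartzMap hg) ξ)) =
        (-((2 * Real.pi) ^ 2 : ℝ) : ℂ) *
          (g ξ • (‖ξ‖ ^ 2 : ℝ) • (𝓕 Z : Lp ℂ 2 (volume : Measure E3)) ξ) := by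
      intro ξ
      have h3 : complexify (hgc.toSchwartzMap hg) ξ = (g ξ : ℂ) := rfl
      rw [h3, RCLike.inner_apply]
      simp only [map_mul, map_neg, Complex.conj_ofReal, Complex.conj_conj, Complex.real_smul]
      push_cast
      ring
    simp only [h2] at h1
    rw [integral_const_mul] at h1
    refine (mul_eq_zero.1 h1).resolve_left ?_
    simp [Real.pi_ne_zero]
  have hFZ : (𝓕 Z : Lp ℂ 2 (volume : Measure E3)) = 0 := by
    rw [Lp.eq_zero_iff_ae_eq_zero]
    have h0 : ∀ᵐ ξ : E3, ξ ≠ 0 := by simp [ae_iff]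
    filter_upwards [hzero, h0] with ξ h1 h2
    simpa [h2] using h1
  have hZ0 : Z = 0 := by
    have := Lp.norm_fourier_eq Z
    rw [hFZ, norm_zero] at this
    exact norm_eq_zero.1 this.symm
  rw [hZdef] at hZ0
  have h1 := hZ.coeFn_toLp
  rw [hZ0] at h1
  filter_upwards [h1, Lp.coeFn_zero ℂ 2 (volume : Measure E3)] with x h2 h3
  rw [h3] at h2
  simpa using h2.symm

/-! ### Density of divergence-free Schwartz fields -/

/-- Square integrable vector fields. -/
abbrev L2Field : Type := Lp E3 2 (volume : Measure E3)

lemma inner_toLp (ψ : 𝓢(E3, E3)) (w : L2Field) :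
    inner ℝ (ψ.toLp 2 volume) w = ∫ x, inner ℝ (ψ x) (w x) := by
  rw [L2.inner_def]
  refine integral_congr_ae ?_
  filter_upwards [ψ.coeFn_toLp 2 volume] with x hx
  rw [hx]

/-- The space of square integrable divergence-free fields. -/
def solenoidal : Submodule ℝ L2Field :=
  (Submodule.span ℝ (range fun g : 𝓢(E3, ℝ) => (gradField g).toLp 2 volume))ᗮ

lemma mem_solenoidal_iff {w : L2Field} :
    w ∈ solenoidal ↔ ∀ g : 𝓢(E3, ℝ), ∫ x, fderiv ℝ g x (w x) = 0 := by
  have h : ∀ g : 𝓢(E3, ℝ), inner ℝ ((gradField g).toLp 2 volume) w = ∫ x, fderiv ℝ g x (w x) := by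
    intro g
    rw [inner_toLp]
    simp only [inner_gradField]
  rw [solenoidal, Submodule.mem_orthogonal]
  refine ⟨fun hw g => ?_, fun hw v hv => ?_⟩
  · rw [← h]
    exact hw _ (Submodule.subset_span ⟨g, rfl⟩)
  · induction hv using Submodule.span_induction with
    | mem v hv =>
      obtain ⟨g, rfl⟩ := hv
      rw [h, hw]
    | zero => exact inner_zero_left _
    | add a b _ _ ha hb => rw [inner_add_left, ha, hb, add_zero]
    | smul c a _ ha => rw [inner_smul_left, ha, mul_zero]

lemma mem_solenoidal {w : L2Field} : w ∈ solenoidal ↔ IsDivFree w := by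
  rw [mem_solenoidal_iff]
  exact ⟨fun h g hg hgc => h (hgc.toSchwartzMap hg), fun h g => h.integral_schwartz (Lp.memLp w) g⟩

/-- The closure of the divergence-free Schwartz fields. -/
def schwartzSolenoidal : Submodule ℝ L2Field :=
  (Submodule.span ℝ {w | ∃ ψ : 𝓢(E3, E3), (∀ x, (gradMatrix ψ x).trace = 0) ∧
    w = ψ.toLp 2 volume}).topologicalClosure

lemma integral_fderiv_of_trace_eq_zero {ψ : 𝓢(E3, E3)} (h : ∀ x, (gradMatrix ψ x).trace = 0)
    (g : 𝓢(E3, ℝ)) : ∫ x, fderiv ℝ g x (ψ x) = 0 := by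
  have hi : ∀ i, Integrable (fun x => ψ x i * (∂_{stdVec i} g : 𝓢(E3, ℝ)) x) volume := fun i =>
    ((component i ψ).memLp 2 volume).integrable_mul ((∂_{stdVec i} g : 𝓢(E3, ℝ)).memLp 2 volume)
  have hi' : ∀ i, Integrable (fun x => (∂_{stdVec i} (component i ψ) : 𝓢(E3, ℝ)) x * g x) volume :=
    fun i => ((∂_{stdVec i} (component i ψ) : 𝓢(E3, ℝ)).memLp 2 volume).integrable_mul
      (g.memLp 2 volume)
  have hp : ∀ i, ∫ x, ψ x i * (∂_{stdVec i} g : 𝓢(E3, ℝ)) x =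
      -∫ x, (∂_{stdVec i} (component i ψ) : 𝓢(E3, ℝ)) x * g x := fun i =>
    SchwartzMap.integral_mul_lineDerivOp_right_eq_neg_left (component i ψ) g (stdVec i)
  simp only [fderiv_apply_eq_sum]
  rw [integral_finsetSum _ fun i _ => hi i]
  simp only [hp]
  rw [Finset.sum_neg_distrib, ← integral_finsetSum _ fun i _ => hi' i]
  simp only [← Finset.sum_mul, ← trace_gradMatrix, h, zero_mul, integral_zero, neg_zero]

lemma schwartzSolenoidal_le : schwartzSolenoidal ≤ solenoidal := by
  refine Submodule.topologicalClosure_minimal _ (Submodule.span_le.2 ?_)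
    (Submodule.isClosed_orthogonal _)
  rintro _ ⟨ψ, hψ, rfl⟩
  rw [SetLike.mem_coe, mem_solenoidal_iff]
  intro g
  rw [← integral_fderiv_of_trace_eq_zero hψ g]
  refine integral_congr_ae ?_
  filter_upwards [ψ.coeFn_toLp 2 volume] with x hx
  rw [hx]

/-- Every square integrable divergence-free field is a limit of divergence-free Schwartz fields. -/
lemma schwartzSolenoidal_eq : schwartzSolenoidal = solenoidal := by
  have : CompleteSpace schwartzSolenoidal :=
    (Submodule.isClosed_topologicalClosure _).completeSpace_coe
  have h := Submodule.sup_orthogonal_inf_of_hasOrthogonalProjection schwartzSolenoidal_le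
  -- The smaller space is closed, so it suffices that a divergence-free `z` orthogonal to it
  -- vanishes; the double curls force this.
  suffices hz : schwartzSolenoidalᗮ ⊓ solenoidal = ⊥ by rwa [hz, sup_bot_eq] at h
  rw [eq_bot_iff]
  rintro z ⟨hz1, hz2⟩
  have hd : IsDivFree z := mem_solenoidal.1 hz2
  have hj : ∀ j, (fun x => z x j) =ᵐ[volume] 0 := by
    intro j
    refine ae_eq_zero_of_integral_mul_laplacian
      ((EuclideanSpace.proj j : E3 →L[ℝ] ℝ).comp_memLp' (Lp.memLp z)) fun φ => ?_
    rw [← integral_inner_doubleCurl (Lp.memLp z) hd, ← inner_toLp]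
    exact hz1 _ (Submodule.le_topologicalClosure _
      (Submodule.subset_span ⟨_, trace_gradMatrix_doubleCurl φ j, rfl⟩))
  rw [Submodule.mem_bot, Lp.eq_zero_iff_ae_eq_zero]
  filter_upwards [ae_all_iff.2 hj] with x hx
  ext j
  exact hx j

/-! ### Weakly continuous curves in Hilbert spaces -/

section Hilbert

variable {H : Type*} [NormedAddCommGroup H] [InnerProductSpace ℝ H]

/-- Weak continuity on a compact interval gives pointwise boundedness of the functionals, and the
uniform boundedness principle does the rest. -/
lemma exists_norm_le_of_weaklyContinuous [CompleteSpace H] {T : ℝ} {u : ℝ → H}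
    (hu : ∀ v, ContinuousOn (fun t => inner ℝ (u t) v) (Icc 0 T)) :
    ∃ M, ∀ t ∈ Icc 0 T, ‖u t‖ ≤ M := by
  obtain ⟨M, hM⟩ := banach_steinhaus (g := fun t : Icc (0 : ℝ) T => innerSL ℝ (u t)) fun v => by
    obtain ⟨C, hC⟩ := isCompact_Icc.exists_bound_of_continuousOn (hu v)
    exact ⟨C, fun t => hC t t.2⟩
  exact ⟨M, fun t ht => by simpa using hM ⟨t, ht⟩⟩

/-- A weakly continuous curve in a separable Hilbert space is strongly measurable. -/
lemma aestronglyMeasurable_of_weaklyContinuous [CompleteSpace H] [SecondCountableTopology H]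
    {T : ℝ} {u : ℝ → H} (hu : ∀ v, ContinuousOn (fun t => inner ℝ (u t) v) (Icc 0 T)) :
    AEStronglyMeasurable u (volume.restrict (Icc 0 T)) := by
  obtain ⟨w, b, hb⟩ := exists_hilbertBasis ℝ H
  have : Countable w := by
    -- Distinct basis vectors are at distance `√2 > 1`, so these balls are disjoint, and a separable
    -- space holds only countably many.
    refine Pairwise.countable_of_isOpen_disjoint (s := fun i => Metric.ball (b i) (1 / 2))
      (fun i j hij => Metric.ball_disjoint_ball ?_) (fun _ => Metric.isOpen_ball)
      fun _ => ⟨_, Metric.mem_ball_self (by norm_num)⟩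
    have h : dist (b i) (b j) ^ 2 = 2 := by
      rw [dist_eq_norm, norm_sub_sq_real, b.orthonormal.1, b.orthonormal.1, b.orthonormal.2 hij]
      norm_num
    nlinarith [dist_nonneg (x := b i) (y := b j)]
  refine aestronglyMeasurable_of_tendsto_ae (atTop : Filter (Finset w))
    (f := fun s t => ∑ i ∈ s, inner ℝ (u t) (b i) • b i) (fun s => ?_) (.of_forall fun t => ?_)
  · refine Finset.aestronglyMeasurable_fun_sum s fun i _ => ?_
    exact ((hu (b i)).aestronglyMeasurable measurableSet_Icc).smul_const _
  · have h := b.hasSum_repr (u t)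
    simp only [b.repr_apply_apply, real_inner_comm] at h
    exact h

lemma hasDerivWithinAt_zero_of_sq_bound {g : ℝ → ℝ} {s : Set ℝ} {C : ℝ}
    (h : ∀ x ∈ s, ∀ y ∈ s, |g y - g x| ≤ C * (y - x) ^ 2) {x : ℝ} (hx : x ∈ s) :
    HasDerivWithinAt g 0 s x := by
  rw [hasDerivWithinAt_iff_isLittleO]
  simp only [smul_zero, sub_zero]
  have h1 : (fun y => g y - g x) =O[𝓝[s] x] fun y => (y - x) ^ 2 := by
    refine Asymptotics.IsBigO.of_bound C ?_
    filter_upwards [self_mem_nhdsWithin] with y hy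
    rw [Real.norm_eq_abs, Real.norm_of_nonneg (sq_nonneg _)]
    exact h x hx y hy
  refine h1.trans_isLittleO ?_
  have h2 : Tendsto (fun y => y - x) (𝓝[s] x) (𝓝 0) := by
    have : Tendsto (fun y => y - x) (𝓝 x) (𝓝 (x - x)) := (continuous_id.sub continuous_const).tendsto x
    rw [sub_self] at this
    exact this.mono_left nhdsWithin_le_nhds
  have h3 : (fun y => (y - x)) =o[𝓝[s] x] fun _ => (1 : ℝ) := (Asymptotics.isLittleO_one_iff ℝ).2 h2
  simpa [sq] using h3.mul_isBigO (Asymptotics.isBigO_refl (fun y => y - x) (𝓝[s] x))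

/-- Quadratically small increments force a zero derivative. This replaces differentiating the energy
in time, which would need more than a bounded measurable integrand. -/
lemma eq_of_sq_bound {g : ℝ → ℝ} {s : Set ℝ} (hs : Convex ℝ s) {C : ℝ}
    (h : ∀ x ∈ s, ∀ y ∈ s, |g y - g x| ≤ C * (y - x) ^ 2) {x y : ℝ} (hx : x ∈ s) (hy : y ∈ s) :
    g y = g x := by
  have := hs.norm_image_sub_le_of_norm_hasDerivWithin_le (f := g) (f' := fun _ => 0) (C := 0)
    (fun x hx => hasDerivWithinAt_zero_of_sq_bound h hx) (by simp) hx hy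
  rw [zero_mul, norm_le_zero_iff, sub_eq_zero] at this
  exact this

lemma norm_quadratic_le (S : H →L[ℝ] H →L[ℝ] H) {M : ℝ} {v : H} (hv : ‖v‖ ≤ M) (w : H) :
    ‖inner ℝ (S w v) v‖ ≤ ‖S‖ * M ^ 2 * ‖w‖ := by
  have hM0 : 0 ≤ M := (norm_nonneg _).trans hv
  calc ‖inner ℝ (S w v) v‖ ≤ ‖S w v‖ * ‖v‖ := norm_inner_le_norm _ _
    _ ≤ (‖S‖ * ‖w‖ * ‖v‖) * ‖v‖ := by gcongr; exact S.le_opNorm₂ _ _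
    _ ≤ (‖S‖ * ‖w‖ * M) * M := by gcongr
    _ = ‖S‖ * M ^ 2 * ‖w‖ := by ring

lemma intervalIntegrable_quadratic {S : H →L[ℝ] H →L[ℝ] H} {T M : ℝ} {u : ℝ → H}
    (hu : AEStronglyMeasurable u (volume.restrict (Icc 0 T))) (hM : ∀ t ∈ Icc 0 T, ‖u t‖ ≤ M)
    (w : ℝ → H) (hw : AEStronglyMeasurable w (volume.restrict (Icc 0 T)))
    (hR : ∃ R, ∀ s ∈ Icc 0 T, ‖w s‖ ≤ R) (a : ℝ) (ha : a ∈ Icc 0 T) (b : ℝ) (hb : b ∈ Icc 0 T) :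
    IntervalIntegrable (fun s => inner ℝ (S (w s) (u s)) (u s)) volume a b := by
  obtain ⟨R, hR⟩ := hR
  have h1 : IntegrableOn (fun s => inner ℝ (S (w s) (u s)) (u s)) (Icc 0 T) volume := by
    refine Integrable.mono' (g := fun _ => ‖S‖ * M ^ 2 * R) (integrable_const _) ?_ ?_
    · exact (S.aestronglyMeasurable_comp₂ hw hu).inner hu
    · filter_upwards [ae_restrict_mem measurableSet_Icc] with s hs
      exact (norm_quadratic_le S (hM s hs) _).trans (by gcongr; exact hR s hs)
  exact (h1.mono_set (uIcc_subset_Icc ha hb)).intervalIntegrable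

/-- A weak identity extends from a set of test vectors to its closed linear span. -/
lemma inner_eq_integral_of_mem_closure {B : H →L[ℝ] H} {S : H →L[ℝ] H →L[ℝ] H} {D : Set H}
    {T M : ℝ} {u : ℝ → H} (hu : AEStronglyMeasurable u (volume.restrict (Icc 0 T)))
    (hM : ∀ t ∈ Icc 0 T, ‖u t‖ ≤ M) {t : ℝ} (ht : t ∈ Icc 0 T) (v : H)
    (hI : ∀ w ∈ D, inner ℝ v (B w) = ∫ s in (0 : ℝ)..t, inner ℝ (S (B w) (u s)) (u s))
    {w : H} (hw : w ∈ (Submodule.span ℝ D).topologicalClosure) :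
    inner ℝ v (B w) = ∫ s in (0 : ℝ)..t, inner ℝ (S (B w) (u s)) (u s) := by
  have h0 : (0 : ℝ) ∈ Icc 0 T := ⟨le_rfl, ht.1.trans ht.2⟩
  have hint : ∀ w : H, IntervalIntegrable (fun s => inner ℝ (S w (u s)) (u s)) volume 0 t :=
    fun w => intervalIntegrable_quadratic hu hM (fun _ => w) aestronglyMeasurable_const
      ⟨‖w‖, fun _ _ => le_rfl⟩ 0 h0 t ht
  let R : H →L[ℝ] ℝ := LinearMap.mkContinuous
    { toFun := fun w => ∫ s in (0 : ℝ)..t, inner ℝ (S w (u s)) (u s)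
      map_add' := fun w w' => by
        rw [← intervalIntegral.integral_add (hint w) (hint w')]
        simp only [map_add, add_apply, inner_add_left]
      map_smul' := fun c w => by
        rw [RingHom.id_apply, smul_eq_mul, ← intervalIntegral.integral_const_mul]
        simp only [map_smul, smul_apply, real_inner_smul_left] }
    (‖S‖ * M ^ 2 * |t - 0|) fun w => by
      refine (intervalIntegral.norm_integral_le_of_norm_le_const (C := ‖S‖ * M ^ 2 * ‖w‖)
        fun s hs => norm_quadratic_le S (hM s ?_) w).trans (le_of_eq (by ring))
      exact uIcc_subset_Icc h0 ht (uIoc_subset_uIcc hs)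
  have h1 : EqOn ((innerSL ℝ v).comp B) (R.comp B) D := hI
  exact ContinuousLinearMap.eqOn_closure_span h1 hw

/-- Energy balance for a mollified curve `B u` that solves a quadratic equation weakly: the
quadratic term may be tested against the curve itself. -/
lemma norm_sq_sub_eq_integral {B : H →L[ℝ] H} {S : H →L[ℝ] H →L[ℝ] H} {V : Submodule ℝ H}
    {T M : ℝ} {u : ℝ → H} (hu : AEStronglyMeasurable u (volume.restrict (Icc 0 T)))
    (hM : ∀ t ∈ Icc 0 T, ‖u t‖ ≤ M) (hV : ∀ t ∈ Icc 0 T, u t ∈ V)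
    (hI : ∀ t ∈ Icc 0 T, ∀ w ∈ V, inner ℝ (B (u t) - B (u 0)) (B w) =
      ∫ s in (0 : ℝ)..t, inner ℝ (S (B w) (u s)) (u s)) {t : ℝ} (ht : t ∈ Icc 0 T) :
    ‖B (u t)‖ ^ 2 - ‖B (u 0)‖ ^ 2 = 2 * ∫ s in (0 : ℝ)..t, inner ℝ (S (B (u s)) (u s)) (u s) := by
  have h0 : (0 : ℝ) ∈ Icc 0 T := ⟨le_rfl, ht.1.trans ht.2⟩
  have hM0 : 0 ≤ M := (norm_nonneg _).trans (hM 0 h0)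
  set K := ‖S‖ * M ^ 2 with hK
  have hK0 : 0 ≤ K := by positivity
  have hq : ∀ s ∈ Icc 0 T, ∀ w, ‖inner ℝ (S w (u s)) (u s)‖ ≤ K * ‖w‖ := fun s hs w =>
    norm_quadratic_le S (hM s hs) w
  have hint := @intervalIntegrable_quadratic H _ _ S T M u hu hM
  have hconst : ∀ w : H, ∀ a ∈ Icc 0 T, ∀ b ∈ Icc 0 T,
      IntervalIntegrable (fun s => inner ℝ (S w (u s)) (u s)) volume a b := fun w =>
    hint (fun _ => w) aestronglyMeasurable_const ⟨‖w‖, fun _ _ => le_rfl⟩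
  have hD : ∀ a ∈ Icc 0 T, ∀ b ∈ Icc 0 T, ∀ w ∈ V, inner ℝ (B (u b) - B (u a)) (B w) =
      ∫ s in a..b, inner ℝ (S (B w) (u s)) (u s) := by
    intro a ha b hb w hw
    rw [← intervalIntegral.integral_interval_sub_left (hconst _ 0 h0 b hb) (hconst _ 0 h0 a ha),
      ← hI b hb w hw, ← hI a ha w hw, ← inner_sub_left, sub_sub_sub_cancel_right]
  have hsub : ∀ {a b s}, a ∈ Icc 0 T → b ∈ Icc 0 T → s ∈ uIoc a b → s ∈ Icc 0 T :=
    fun ha hb hs => uIcc_subset_Icc ha hb (uIoc_subset_uIcc hs)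
  -- Testing with `w = u b - u a` bounds the squared norm of the increment by `K |b - a|` times the
  -- norm itself.
  have hLip : ∀ a ∈ Icc 0 T, ∀ b ∈ Icc 0 T, ‖B (u b) - B (u a)‖ ≤ K * |b - a| := by
    intro a ha b hb
    have h1 := hD a ha b hb (u b - u a) (V.sub_mem (hV b hb) (hV a ha))
    have h2 := intervalIntegral.norm_integral_le_of_norm_le_const
      (f := fun s => inner ℝ (S (B (u b - u a)) (u s)) (u s)) (a := a) (b := b)
      (fun s hs => hq s (hsub ha hb hs) (B (u b - u a)))
    rw [← h1, map_sub, real_inner_self_eq_norm_sq, norm_pow, norm_norm, sq] at h2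
    rcases (norm_nonneg (B (u b) - B (u a))).eq_or_lt with h3 | h3
    · rw [← h3]
      positivity
    · refine le_of_mul_le_mul_right (h2.trans (le_of_eq ?_)) h3
      ring
  have hUint := hint (fun s => B (u s)) (B.continuous.comp_aestronglyMeasurable hu)
    ⟨‖B‖ * M, fun s hs => (B.le_opNorm _).trans (by gcongr; exact hM s hs)⟩
  -- Testing with `w = u b + u a` produces the difference of squares. Replacing `B (u b + u a)` by
  -- `2 B (u s)` under the integral costs another `2K |b - a|` by the Lipschitz bound.
  have hsq : ∀ a ∈ Icc 0 T, ∀ b ∈ Icc 0 T,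
      |(‖B (u b)‖ ^ 2 - 2 * ∫ s in (0 : ℝ)..b, inner ℝ (S (B (u s)) (u s)) (u s)) -
        (‖B (u a)‖ ^ 2 - 2 * ∫ s in (0 : ℝ)..a, inner ℝ (S (B (u s)) (u s)) (u s))| ≤
      2 * K ^ 2 * (b - a) ^ 2 := by
    intro a ha b hb
    have h1 : ‖B (u b)‖ ^ 2 - ‖B (u a)‖ ^ 2 =
        ∫ s in a..b, inner ℝ (S (B (u b + u a)) (u s)) (u s) := by
      rw [← hD a ha b hb _ (V.add_mem (hV b hb) (hV a ha)), map_add, inner_sub_left,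
        inner_add_right, inner_add_right, real_inner_self_eq_norm_sq, real_inner_self_eq_norm_sq,
        real_inner_comm]
      ring
    have h2 := intervalIntegral.integral_interval_sub_left (hUint 0 h0 b hb) (hUint 0 h0 a ha)
    have h3 := intervalIntegral.integral_sub (hconst (B (u b + u a)) a ha b hb)
      ((hUint a ha b hb).const_mul 2)
    rw [intervalIntegral.integral_const_mul, ← h1, ← h2] at h3
    have h4 := intervalIntegral.norm_integral_le_of_norm_le_const
      (f := fun s => inner ℝ (S (B (u b + u a)) (u s)) (u s) -
        2 * inner ℝ (S (B (u s)) (u s)) (u s)) (a := a) (b := b) (C := K * (2 * (K * |b - a|)))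
      (fun s hs => by
        have hs' := hsub ha hb hs
        have e : inner ℝ (S (B (u b + u a)) (u s)) (u s) - 2 * inner ℝ (S (B (u s)) (u s)) (u s) =
            inner ℝ (S ((B (u b) - B (u s)) + (B (u a) - B (u s))) (u s)) (u s) := by
          simp only [map_add, map_sub, add_apply, sub_apply, inner_add_left, inner_sub_left]
          ring
        rw [e]
        have d1 : |b - s| ≤ |b - a| :=
          abs_sub_right_of_mem_uIcc (uIoc_subset_uIcc hs)
        have d2 : |a - s| ≤ |b - a| := by
          rw [abs_sub_comm a s]
          exact abs_sub_left_of_mem_uIcc (uIoc_subset_uIcc hs)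
        refine (hq s hs' _).trans (mul_le_mul_of_nonneg_left ?_ hK0)
        calc _ ≤ ‖B (u b) - B (u s)‖ + ‖B (u a) - B (u s)‖ := norm_add_le _ _
          _ ≤ K * |b - s| + K * |a - s| := add_le_add (hLip s hs' b hb) (hLip s hs' a ha)
          _ ≤ K * |b - a| + K * |b - a| := by gcongr
          _ = _ := by ring)
    rw [h3, Real.norm_eq_abs] at h4
    refine (le_of_eq (congr_arg _ ?_)).trans (h4.trans (le_of_eq ?_))
    · ring
    · rw [← sq_abs (b - a)]
      ring
  have := eq_of_sq_bound (convex_Icc 0 T) hsq h0 ht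
  rw [intervalIntegral.integral_same, mul_zero, sub_zero] at this
  linarith

end Hilbert

/-! ### Mollification and transport as operators on `L²` -/

lemma conv_add_coe (k : 𝓢(E3, ℝ)) (v w : L2Field) :
    conv k (v + w : L2Field) = conv k v + conv k w := by
  rw [conv_congr_ae k (Lp.coeFn_add v w)]
  exact funext fun x => conv_add_right (memLp_two_kernel k) (Lp.memLp v) (Lp.memLp w) x

lemma conv_smul_coe (k : 𝓢(E3, ℝ)) (c : ℝ) (w : L2Field) :
    conv k (c • w : L2Field) = c • conv k w := by
  rw [conv_congr_ae k (Lp.coeFn_smul c w)]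
  exact funext fun x => conv_smul_right k c w x

lemma memLp_conv_coe (k : 𝓢(E3, ℝ)) (w : L2Field) : MemLp (conv k w) 2 volume :=
  memLp_two_conv k.integrable (Lp.memLp w)

/-- Convolution with a Schwartz kernel. -/
def mollify (k : 𝓢(E3, ℝ)) : L2Field →L[ℝ] L2Field :=
  LinearMap.mkContinuous
    { toFun := fun w => (memLp_conv_coe k w).toLp _
      map_add' := fun v w => by
        rw [← MemLp.toLp_add]
        exact MemLp.toLp_congr _ _ (.of_eq (conv_add_coe k v w))
      map_smul' := fun c w => by
        rw [RingHom.id_apply, ← MemLp.toLp_const_smul]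
        exact MemLp.toLp_congr _ _ (.of_eq (conv_smul_coe k c w)) }
    (∫⁻ y, ‖k y‖ₑ).toReal fun w => by
      rw [LinearMap.coe_mk, AddHom.coe_mk, Lp.norm_toLp, Lp.norm_def, ← ENNReal.toReal_mul]
      refine ENNReal.toReal_mono (ENNReal.mul_ne_top (lintegral_enorm_lt_top k).ne
        (Lp.memLp w).eLpNorm_ne_top) ?_
      exact eLpNorm_conv_le k.integrable.1 (Lp.memLp w).1 1

lemma coeFn_mollify (k : 𝓢(E3, ℝ)) (w : L2Field) : mollify k w =ᵐ[volume] conv k w :=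
  MemLp.coeFn_toLp (memLp_conv_coe k w)

lemma conv_mollify (k : 𝓢(E3, ℝ)) (w : L2Field) : conv k (mollify k w) = conv (rconv k k) w := by
  rw [conv_congr_ae k (coeFn_mollify k w), coe_rconv]
  exact funext fun x => (conv_assoc k.integrable (memLp_two_kernel k) k.integrable
    (memLp_two_kernel k) (Lp.memLp w) x).symm

/-- Fubini and the involution `(x, t) ↦ (x - t, -t)`, under which the even kernel is unchanged. -/
lemma inner_mollify_left {k : 𝓢(E3, ℝ)} (heven : ∀ x, k (-x) = k x) (v w : L2Field) :
    inner ℝ (mollify k v) w = inner ℝ v (mollify k w) := by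
  have hG : Integrable (fun z : E3 × E3 => k z.2 * inner ℝ (v (z.1 - z.2)) (w z.1))
      (volume.prod volume) := by
    have h1 : Integrable (fun z : E3 × E3 => ‖v z.1‖ ^ 2 * ‖k z.2‖) (volume.prod volume) :=
      ((Lp.memLp v).integrable_norm_pow (by norm_num)).mul_prod k.integrable.norm
    have h2 : Integrable (fun z : E3 × E3 => ‖w z.1‖ ^ 2 * ‖k z.2‖) (volume.prod volume) :=
      ((Lp.memLp w).integrable_norm_pow (by norm_num)).mul_prod k.integrable.norm
    have h3 := (measurePreserving_sub_prod (volume : Measure E3)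
      (volume : Measure E3)).integrable_comp_of_integrable h1
    refine (h3.add h2).mono' ((k.continuous.comp continuous_snd).aestronglyMeasurable.mul
      ((aestronglyMeasurable_uncurry_sub (Lp.memLp v).1).inner (Lp.memLp w).1.comp_fst))
      (.of_forall fun z => ?_)
    rw [norm_mul]
    have h4 := norm_inner_le_norm (𝕜 := ℝ) (v (z.1 - z.2)) (w z.1)
    calc ‖k z.2‖ * ‖inner ℝ (v (z.1 - z.2)) (w z.1)‖
        ≤ ‖k z.2‖ * (‖v (z.1 - z.2)‖ ^ 2 + ‖w z.1‖ ^ 2) := by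
          gcongr
          nlinarith [sq_nonneg (‖v (z.1 - z.2)‖ - ‖w z.1‖), sq_nonneg ‖v (z.1 - z.2)‖,
            sq_nonneg ‖w z.1‖]
      _ = _ := by
          simp only [Pi.add_apply, Function.comp_apply]
          ring
  have e := integral_comp_swap_sub hG
  have hG' := integrable_comp_swap_sub hG
  rw [integral_prod _ hG, integral_prod _ hG'] at e
  simp only [sub_neg_eq_add, sub_add_cancel, heven] at e
  rw [L2.inner_def, L2.inner_def]
  calc ∫ x, inner ℝ (mollify k v x) (w x) = ∫ x, ∫ t, k t * inner ℝ (v (x - t)) (w x) := by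
        refine integral_congr_ae ?_
        filter_upwards [coeFn_mollify k v] with x hx
        rw [hx, real_inner_comm]
        refine ((innerSL ℝ (w x)).integral_comp_comm
          (integrable_conv (memLp_two_kernel k) (Lp.memLp v) x)).symm.trans ?_
        congr with t
        simp [real_inner_comm]
    _ = ∫ x, ∫ t, k t * inner ℝ (v x) (w (x - t)) := e.symm
    _ = ∫ x, inner ℝ (v x) (mollify k w x) := by
        refine integral_congr_ae ?_
        filter_upwards [coeFn_mollify k w] with x hx
        rw [hx]
        refine Eq.symm (((innerSL ℝ (v x)).integral_comp_comm
          (integrable_conv (memLp_two_kernel k) (Lp.memLp w) x)).symm.trans ?_)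
        congr with t
        simp

/-- Cauchy–Schwarz with the derivative on the kernel. This uniform bound makes `transport` a bounded
bilinear map on `L²`. -/
lemma exists_norm_fderiv_conv_coe_le (k : 𝓢(E3, ℝ)) :
    ∃ C, 0 ≤ C ∧ ∀ (w : L2Field) x, ‖fderiv ℝ (conv k w) x‖ ≤ C * ‖w‖ := by
  have hf : MemLp (fun x => fderiv ℝ k x) 2 volume := (SchwartzMap.fderivCLM ℝ E3 ℝ k).memLp 2 volume
  refine ⟨(eLpNorm (fun x => fderiv ℝ k x) 2 volume).toReal, ENNReal.toReal_nonneg, fun w x => ?_⟩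
  refine ContinuousLinearMap.opNorm_le_bound _ (by positivity) fun v => ?_
  rw [fderiv_conv_apply k (Lp.memLp w)]
  refine (norm_conv_le (memLp_two_kernel _) (Lp.memLp w) x).trans ?_
  rw [← Lp.norm_def, mul_right_comm]
  gcongr
  have h1 : eLpNorm (∂_{v} k : 𝓢(E3, ℝ)) 2 volume ≤
      ENNReal.ofReal ‖v‖ * eLpNorm (fun x => fderiv ℝ k x) 2 volume := by
    refine eLpNorm_le_mul_eLpNorm_of_ae_le_mul (.of_forall fun y => ?_) 2
    rw [SchwartzMap.lineDerivOp_apply_eq_fderiv, mul_comm]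
    exact ContinuousLinearMap.le_opNorm _ _
  refine (ENNReal.toReal_mono (ENNReal.mul_ne_top ENNReal.ofReal_ne_top hf.2.ne) h1).trans ?_
  rw [ENNReal.toReal_mul, ENNReal.toReal_ofReal (norm_nonneg _), mul_comm]

lemma aestronglyMeasurable_fderiv_conv_apply (k : 𝓢(E3, ℝ)) (w a : L2Field) :
    AEStronglyMeasurable (fun x => fderiv ℝ (conv k w) x (a x)) volume :=
  (ContinuousLinearMap.id ℝ (E3 →L[ℝ] E3)).aestronglyMeasurable_comp₂
    (measurable_fderiv ℝ _).aestronglyMeasurable (Lp.memLp a).1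

lemma memLp_fderiv_conv_apply (k : 𝓢(E3, ℝ)) (w a : L2Field) :
    MemLp (fun x => fderiv ℝ (conv k w) x (a x)) 2 volume := by
  obtain ⟨C, -, hC⟩ := exists_norm_fderiv_conv_coe_le k
  exact (Lp.memLp a).of_le_mul (aestronglyMeasurable_fderiv_conv_apply k w a)
    (.of_forall fun x => ((fderiv ℝ (conv k w) x).le_opNorm _).trans
      (mul_le_mul_of_nonneg_right (hC w x) (norm_nonneg _)))

/-- The bilinear map `(w, a) ↦ (a · ∇)(k ⋆ w)`. -/
def transport (k : 𝓢(E3, ℝ)) : L2Field →L[ℝ] L2Field →L[ℝ] L2Field :=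
  LinearMap.mkContinuous₂
    (LinearMap.mk₂ ℝ (fun w a => (memLp_fderiv_conv_apply k w a).toLp _)
      (fun v w a => by
        rw [← MemLp.toLp_add]
        refine MemLp.toLp_congr _ _ (.of_forall fun x => ?_)
        dsimp only
        rw [conv_add_coe, fderiv_add (differentiable_conv k (Lp.memLp v) x)
          (differentiable_conv k (Lp.memLp w) x)]
        rfl)
      (fun c w a => by
        rw [← MemLp.toLp_const_smul]
        refine MemLp.toLp_congr _ _ (.of_forall fun x => ?_)
        dsimp only
        rw [conv_smul_coe, fderiv_const_smul (differentiable_conv k (Lp.memLp w) x)]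
        rfl)
      (fun w a b => by
        rw [← MemLp.toLp_add]
        refine MemLp.toLp_congr _ _ ?_
        filter_upwards [Lp.coeFn_add a b] with x hx
        rw [hx, Pi.add_apply, map_add]
        rfl)
      (fun c w a => by
        rw [← MemLp.toLp_const_smul]
        refine MemLp.toLp_congr _ _ ?_
        filter_upwards [Lp.coeFn_smul c a] with x hx
        rw [hx, Pi.smul_apply, map_smul]
        rfl))
    (exists_norm_fderiv_conv_coe_le k).choose fun w a => by
      obtain ⟨h0, h⟩ := (exists_norm_fderiv_conv_coe_le k).choose_spec
      rw [LinearMap.mk₂_apply]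
      refine Lp.norm_le_mul_norm_of_ae_le_mul ?_
      filter_upwards [MemLp.coeFn_toLp (memLp_fderiv_conv_apply k w a)] with x hx
      rw [hx]
      exact ((fderiv ℝ (conv k w) x).le_opNorm _).trans
        (mul_le_mul_of_nonneg_right (h w x) (norm_nonneg _))

lemma inner_transport (k : 𝓢(E3, ℝ)) (w a b : L2Field) :
    inner ℝ (transport k w a) b = trilinear a (conv k w) b := by
  rw [L2.inner_def, trilinear]
  refine integral_congr_ae ?_
  filter_upwards [MemLp.coeFn_toLp (memLp_fderiv_conv_apply k w a)] with x hx
  rw [← hx]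
  rfl

/-- Componentwise convolution of a Schwartz vector field. -/
def smoothField (k : 𝓢(E3, ℝ)) (ψ : 𝓢(E3, E3)) : 𝓢(E3, E3) :=
  vecField fun i => rconv k (component i ψ)

lemma coe_smoothField (k : 𝓢(E3, ℝ)) (ψ : 𝓢(E3, E3)) : ⇑(smoothField k ψ) = conv k ψ := by
  funext x
  ext i
  rw [smoothField, vecField_apply, rconv_apply]
  exact conv_comp_clm (EuclideanSpace.proj i : E3 →L[ℝ] ℝ) (memLp_two_kernel k)
    (ψ.memLp 2 volume) x

lemma lineDerivOp_rconv (k f : 𝓢(E3, ℝ)) (v : E3) : ∂_{v} (rconv k f) = rconv k (∂_{v} f) := by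
  ext x
  rw [SchwartzMap.lineDerivOp_apply_eq_fderiv, coe_rconv, conv_comm,
    fderiv_conv_apply f (memLp_two_kernel k), conv_comm, rconv_apply]

lemma trace_gradMatrix_smoothField (k : 𝓢(E3, ℝ)) {ψ : 𝓢(E3, E3)}
    (h : ∀ x, (gradMatrix ψ x).trace = 0) (x : E3) :
    (gradMatrix (smoothField k ψ) x).trace = 0 := by
  simp only [trace_gradMatrix] at h ⊢
  simp only [smoothField, component_vecField, lineDerivOp_rconv, rconv_apply]
  simp only [conv]
  rw [← integral_finsetSum _ fun i _ => integrable_conv (memLp_two_kernel k)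
    (memLp_two_kernel (∂_{stdVec i} (component i ψ))) x]
  simp only [← Finset.smul_sum, h, smul_zero, integral_zero]

/-! ### Energy conservation -/

section

variable {T : ℝ} {u : ℝ → L2Field}

lemma pairing_toLp (v : L2Field) (ψ : 𝓢(E3, E3)) :
    pairing v ψ = inner ℝ v (ψ.toLp 2 volume) := by
  rw [real_inner_comm, inner_toLp, pairing]
  simp only [real_inner_comm]

lemma IsWeakSolution.aestronglyMeasurable (hu : IsWeakSolution T u) :
    AEStronglyMeasurable u (volume.restrict (Icc 0 T)) := by
  have : Fact ((2 : ℝ≥0∞) ≠ ⊤) := ⟨ENNReal.ofNat_ne_top⟩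
  have : SecondCountableTopology L2Field := UniformSpace.secondCountable_of_separable L2Field
  exact aestronglyMeasurable_of_weaklyContinuous hu.weaklyContinuous

lemma hasDerivWithinAt_const_schwartz (ψ : 𝓢(E3, E3)) (s : Set ℝ) (t : ℝ) :
    HasDerivWithinAt (fun _ : ℝ => ψ) 0 s t := by
  have h : ContinuousLinearMap.toSpanSingleton ℝ (0 : 𝓢(E3, E3)) = 0 := by
    ext
    simp
  rw [HasDerivWithinAt, HasDerivAtFilter, h]
  exact hasFDerivWithinAt_const ψ t s

/-- Test fields constant in time are enough; the time dependence is recovered in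
`norm_sq_sub_eq_integral`. -/
lemma IsWeakSolution.pairing_sub_eq (hu : IsWeakSolution T u) {ψ : 𝓢(E3, E3)}
    (h : ∀ x, (gradMatrix ψ x).trace = 0) {t : ℝ} (ht : t ∈ Icc 0 T) :
    pairing (u t) ψ - pairing (u 0) ψ = ∫ s in (0 : ℝ)..t, trilinear (u s) ψ (u s) := by
  have h1 := hu.weakForm (fun _ => ψ) (fun _ => 0)
    ⟨fun t _ => hasDerivWithinAt_const_schwartz ψ _ t, continuousOn_const, fun _ _ => h⟩ t ht
  have h2 : ∀ s, pairing (u s) (0 : 𝓢(E3, E3)) = 0 := fun s => by simp [pairing]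
  simpa only [h2, intervalIntegral.integral_zero, sub_zero] using h1

/-- The test field is `k ⋆ k ⋆ φ`, which is again Schwartz and divergence free. On the left one
mollification passes to `u` by symmetry; on the right both stay inside the gradient. -/
lemma IsWeakSolution.inner_mollify_schwartz (hu : IsWeakSolution T u) {k : 𝓢(E3, ℝ)}
    (heven : ∀ x, k (-x) = k x) {φ : 𝓢(E3, E3)} (h : ∀ x, (gradMatrix φ x).trace = 0) {t : ℝ}
    (ht : t ∈ Icc 0 T) :
    inner ℝ (mollify k (u t) - mollify k (u 0)) (mollify k (φ.toLp 2 volume)) =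
      ∫ s in (0 : ℝ)..t,
        inner ℝ (transport k (mollify k (φ.toLp 2 volume)) (u s)) (u s) := by
  set ψ := smoothField k (smoothField k φ) with hψ
  have e1 : ⇑ψ = conv k (mollify k (φ.toLp 2 volume)) := by
    rw [hψ, coe_smoothField, coe_smoothField]
    refine conv_congr_ae k ?_
    rw [← conv_congr_ae k (φ.coeFn_toLp 2 volume)]
    exact (coeFn_mollify k _).symm
  have e2 : ψ.toLp 2 volume = mollify k (mollify k (φ.toLp 2 volume)) := by
    refine Lp.ext ((ψ.coeFn_toLp 2 volume).trans ?_)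
    rw [e1]
    exact (coeFn_mollify k _).symm
  have h1 := hu.pairing_sub_eq
    (trace_gradMatrix_smoothField k (trace_gradMatrix_smoothField k h)) ht
  rw [← hψ, pairing_toLp, pairing_toLp, e2, ← inner_mollify_left heven (u t),
    ← inner_mollify_left heven (u 0), ← inner_sub_left] at h1
  simp only [inner_transport, ← e1]
  exact h1

/-- Density extends the tested identity to every divergence-free `L²` field, hence to combinations
of the values of `u`. -/
lemma IsWeakSolution.norm_sq_mollify_sub (hu : IsWeakSolution T u) {k : 𝓢(E3, ℝ)}
    (heven : ∀ x, k (-x) = k x) {t : ℝ} (ht : t ∈ Icc 0 T) :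
    ‖mollify k (u t)‖ ^ 2 - ‖mollify k (u 0)‖ ^ 2 =
      2 * ∫ s in (0 : ℝ)..t, inner ℝ (transport k (mollify k (u s)) (u s)) (u s) := by
  have hm := hu.aestronglyMeasurable
  obtain ⟨M, hM⟩ := exists_norm_le_of_weaklyContinuous hu.weaklyContinuous
  refine norm_sq_sub_eq_integral (V := solenoidal) hm hM
    (fun t ht => mem_solenoidal.2 (hu.divFree t ht)) (fun t ht w hw => ?_) ht
  rw [← schwartzSolenoidal_eq] at hw
  refine inner_eq_integral_of_mem_closure hm hM ht _ ?_ hw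
  rintro _ ⟨φ, hφ, rfl⟩
  exact hu.inner_mollify_schwartz heven hφ ht

lemma tendsto_mollify_dil {k : 𝓢(E3, ℝ)} (h1 : ∫ y, k y = 1) (w : L2Field) :
    Tendsto (fun q => mollify (dil q k) w) atTop (𝓝 w) := by
  rw [tendsto_iff_norm_sub_tendsto_zero]
  have h := (ENNReal.tendsto_toReal ENNReal.zero_ne_top).comp
    (tendsto_eLpNorm_conv_dil_sub h1 (Lp.memLp w))
  refine h.congr fun q => ?_
  rw [Lp.norm_def, Function.comp_apply]
  congr 1
  refine eLpNorm_congr_ae ?_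
  filter_upwards [Lp.coeFn_sub (mollify (dil q k) w) w, coeFn_mollify (dil q k) w] with x h1 h2
  rw [h1, Pi.sub_apply, h2]

lemma energy_eq_norm_sq (w : L2Field) : energy w = 1 / 2 * ‖w‖ ^ 2 := by
  rw [energy, ← real_inner_self_eq_norm_sq, L2.inner_def]
  simp only [real_inner_self_eq_norm_sq]

/-- The total flux through the wave number `2 ^ q` tends to zero. -/
lemma IsCutoff.tendsto_integral_flux {χ : E3 → ℝ} (hχ : IsCutoff χ) (hu : IsWeakSolution T u)
    (hB : MemL3BesovC χ T u) {t : ℝ} (ht : t ∈ Icc 0 T) :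
    Tendsto (fun q => ∫ s in (0 : ℝ)..t, inner ℝ (transport (dil q hχ.kernel)
      (mollify (dil q hχ.kernel) (u s)) (u s)) (u s)) atTop (𝓝 0) := by
  obtain ⟨C, hC, hle⟩ := hχ.exists_enorm_trilinear_sqKernel_le
  have hm := hu.aestronglyMeasurable
  set f : ℕ → ℝ → ℝ := fun q s => inner ℝ (transport (dil q hχ.kernel)
    (mollify (dil q hχ.kernel) (u s)) (u s)) (u s) with hf
  have hfe : ∀ q s, f q s = trilinear (u s)
      (conv (rconv (dil q hχ.kernel) (dil q hχ.kernel)) (u s)) (u s) := fun q s => by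
    rw [hf]
    dsimp only
    rw [inner_transport, conv_mollify]
  -- Dominated convergence in time: the flux vanishes for almost every `s`, and its majorant is the
  -- cube of the Besov norm, of finite integral by assumption.
  have hlim : Tendsto (fun q => ∫⁻ s in Icc 0 T, ‖f q s‖ₑ) atTop (𝓝 0) := by
    have h := tendsto_lintegral_of_dominated_convergence' (μ := volume.restrict (Icc 0 T))
      (F := fun q s => ‖f q s‖ₑ) (f := fun _ => 0)
      (fun s => C * (1 + 2 * geomSum) ^ 3 * besovNorm χ (u s) ^ 3) (fun q => ?_) (fun q => ?_) ?_ ?_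
    · simpa using h
    · exact ((ContinuousLinearMap.aestronglyMeasurable_comp₂ _
        ((mollify _).continuous.comp_aestronglyMeasurable hm) hm).inner hm).enorm
    · filter_upwards [hB.1, ae_restrict_mem measurableSet_Icc] with s hs hsT
      rw [hfe, mul_assoc, ← mul_pow]
      refine (hle _ (Lp.memLp (u s)) hs (hu.divFree s hsT) q).trans ?_
      gcongr
      exact dyadicTail_le χ q _
    · have hc : C * (1 + 2 * geomSum) ^ 3 ≠ ⊤ := ENNReal.mul_ne_top hC (ENNReal.pow_ne_top
        (ENNReal.add_ne_top.2 ⟨ENNReal.one_ne_top, ENNReal.mul_ne_top (by norm_num) geomSum_ne_top⟩))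
      -- A finite constant may be pulled out without measurability of the Besov norm in time.
      rw [lintegral_const_mul' _ _ hc]
      exact ENNReal.mul_ne_top hc hB.2.ne
    · filter_upwards [hB.1, ae_restrict_mem measurableSet_Icc] with s hs hsT
      simp only [hfe]
      exact tendsto_zero_iff_enorm_tendsto_zero.1
        (hχ.tendsto_trilinear (Lp.memLp (u s)) (hu.divFree s hsT) hs)
  rw [tendsto_zero_iff_enorm_tendsto_zero]
  refine tendsto_of_tendsto_of_tendsto_of_le_of_le tendsto_const_nhds hlim (fun _ => bot_le)
    fun q => ?_
  dsimp only
  rw [intervalIntegral.integral_of_le ht.1]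
  refine (enorm_integral_le_lintegral_enorm _).trans (lintegral_mono_set ?_)
  exact fun s hs => ⟨hs.1.le, hs.2.trans ht.2⟩

/-- Weak solutions of critical Besov regularity conserve energy. -/
lemma IsCutoff.energy_eq {χ : E3 → ℝ} (hχ : IsCutoff χ) (hu : IsWeakSolution T u)
    (hB : MemL3BesovC χ T u) {t : ℝ} (ht : t ∈ Icc 0 T) : energy (u t) = energy (u 0) := by
  have h1 : ∀ w : L2Field, Tendsto (fun q => ‖mollify (dil q hχ.kernel) w‖ ^ 2) atTop
      (𝓝 (‖w‖ ^ 2)) := fun w => (tendsto_mollify_dil hχ.integral_kernel w).norm.pow 2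
  have h2 := (h1 (u t)).sub (h1 (u 0))
  simp only [hu.norm_sq_mollify_sub (dil_neg hχ.kernel_neg _) ht] at h2
  have h3 := tendsto_nhds_unique h2 ((hχ.tendsto_integral_flux hu hB ht).const_mul 2)
  rw [mul_zero, sub_eq_zero] at h3
  rw [energy_eq_norm_sq, energy_eq_norm_sq, h3]

end

end EulerFlux

end

open EulerFlux in
theorem mainTheorem1 (χ : E3 → ℝ) (hχ : IsCutoff χ) :
    (∀ u : E3 → E3, MemLp u 2 volume → IsDivFree u → MemBesovC χ u →
      (∀ Q : ℕ, Integrable (fluxDensity χ Q u) volume) ∧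
        Tendsto (fun Q : ℕ => energyFlux χ Q u) atTop (𝓝 0)) ∧
    (∀ (T : ℝ), 0 < T → ∀ u : ℝ → Lp E3 2 (volume : Measure E3),
      IsWeakSolution T u → MemL3BesovC χ T u →
        ∀ t ∈ Icc 0 T, energy (u t) = energy (u 0)) :=
  ⟨fun _ hu hd hB => ⟨hχ.integrable_fluxDensity hu, hχ.tendsto_energyFlux hu hd hB⟩,
    fun _ _ _ hu hB _ ht => hχ.energy_eq hu hB ht⟩
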